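/- **Setting.** Fix $\kappa>0$. An environment is a sequence $\omega=(\omega_x)_{x\in\mathbb Z}$ with $\omega_x\in[\kappa,1-\kappa]$. Let $(X_n)_{n\ge 0}$ be the nearest-neighbour random walk on $\mathbb Z$ that jumps from $x$ to $x+1$ with probability $\omega_x$ and to $x-1$ with probability $1-\omega_x$. Let $V:\mathbb Z\to\mathbb R$ be the potential with $V(0)=0$ and $V(x)-V(x-1)=\ln\frac{1-\omega_x}{\omega_x}$, and let $\mu(x)=e^{-V(x)}/\omega_x$, which is a reversible measure. For $N\ge 1$ let $V_N:[-1,1]\to\mathbb R$ be the linear interpolation of the values $V_N(k/N)=V(k)/\sqrt N$, let $I_N=(-1,1)\cap\mathbb Z/N$, and let $\mu_N(x)=\mu(Nx)$ for $x\in\mathbb Z/N$. For finite $D\subset\mathbb Z/N$ let $\mathcal L^{(N)}(D)$ be the restriction to $D\times D$ of the matrix $\mathbb I-\mathbb P$, where $\mathbb P$ is the transition matrix of the rescaled walk $X_n/N$; $\sigma(\cdot)$ denotes the spectrum and $\|\cdot\|_2$ the norm of $L^2(I_N,\mu_N)$. Let $P^\omega_{N,x}$ be the law of the rescaled walk started in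 $x$, and $\tau_A=\min\{n\ge1: X_n/N\in A\}$. **Good paths.** Let $\gamma\in C([-1,1])$ and $h,\delta>0$. A point $x$ is an $h$-minimum of $\gamma$ if there are $a<x<b$ in $[-1,1]$ with $\gamma(a)\ge\gamma(x)+h$, $\gamma(b)\ge\gamma(x)+h$ and $\gamma(x)=\min_{[a,b]}\gamma$. Two $h$-minima $x,x'$ are equivalent if $|\gamma(z)-\gamma(x)|<h$ for all $z$ between $x$ and $x'$ (both included). $M_h^-(\gamma)$ is the set of the smallest elements of the equivalence classes. For disjoint finite sets $A,B$ let $z^*(A,B)$ be the smallest point $z$ that lies between some $a\in A$ and some $b\in B$ and satisfies $\gamma(z)=\min_{a\in A,b\in B}\max_{[a\wedge b,a\vee b]}\gamma$. The path $\gamma$ belongs to $\mathcal A_{h,\delta}$ (is a good path) if $M_h^-(\gamma)\neq\emptyset$, if $\gamma(z^*(x,(M_h^-(\gamma)\cup\{-1,1\})\setminus\{x\}))-\gamma(x)\ge h+\delta$ for all $x\in M_h^-(\gamma)$, and if there is a labeling $M_h^-(\gamma)=\{x_1,\dots,x_q\}$ without repetitions such that, with $S_k=\{x_1,\dots,x_k\}\cup\{-1,1\}$,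 $$\gamma(z^*(x_k,S_{k-1}))-\gamma(x_k)\ \ge\ \gamma(z^*(x_j,S_{k-1}))-\gamma(x_j)+\delta\qquad(1\le k<j\le q).$$ This labeling is then unique. Put $d_k=\gamma(z^*(x_k,S_{k-1}))-\gamma(x_k)$. **Theorem 1.** There are constants $c,c',C>0$ that depend only on $\kappa$ and, for all $Q,\delta>0$, an integer $N(\delta,Q)$ (depending also on $\kappa$) such that the following holds for every $h>0$, every $N\ge N(\delta,Q)$ and every environment $\omega$ as above for which $V_N\in\mathcal A_{h,\delta}$ and $q=|M_h^-(V_N)|\le Q$. Let $x_1,\dots,x_q$ be the above labeling of $M_h^-(V_N)$, and $S_k$, $d_k$ the corresponding objects for $\gamma=V_N$. All $x_k$ belong to $I_N$, and with $\lambda_N^*=\min\sigma(\mathcal L^{(N)}(I_N\setminus M_h^-(V_N)))$, the matrix $\mathcal L^{(N)}(I_N)$ has exactly $q$ eigenvalues $\lambda_1<\dots<\lambda_q$ below $\lambda_N^*$. The threshold satisfies $$\lambda_N^*\ \ge\ c\,N^{-2}e^{-h\sqrt N}.$$ For $1\le k\le q$ define $h_k$ on $I_N$ by $h_k(x_k)=1$,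 $h_k(x)=0$ for $x\in S_{k-1}$, and $h_k(x)=P^\omega_{N,x}(\tau_{x_k}<\tau_{S_{k-1}})$ at all other $x\in I_N$. Then $$\left|\lambda_k-\Lambda_k\right|\le C e^{-\frac{\delta}{10}\sqrt N}\,\Lambda_k,\qquad \Lambda_k=\frac{\mu_N(x_k)\,P^\omega_{N,x_k}(\tau_{S_{k-1}}<\tau_{x_k})}{\|h_k\|_2^2},$$ $$c\,N^{-2}e^{-\sqrt N d_k}\ \le\ \lambda_k\ \le\ c'\,e^{-\sqrt N d_k},$$ and there is an eigenvector $\psi_k$ of $\mathcal L^{(N)}(I_N)$ with eigenvalue $\lambda_k$ and $\|\psi_k\|_2=1$ such that $$\left\|\psi_k-\frac{h_k}{\|h_k\|_2}\right\|_2\le e^{-\frac{\delta}{10}\sqrt N}.$$ -/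

import Mathlib

open MeasureTheory ProbabilityTheory

noncomputable section

namespace SinaiWalk

/-! ### Paths on `[-1, 1]`: h-minima, saddle points, good paths

A path is a function `γ : ℝ → ℝ`; only its values on `[-1, 1]` are used below. -/

/-- `x` is an h-minimum of the path `γ` on `[-1, 1]`. -/
def IsHMin (h : ℝ) (γ : ℝ → ℝ) (x : ℝ) : Prop :=
  ∃ a b : ℝ, -1 ≤ a ∧ a < x ∧ x < b ∧ b ≤ 1 ∧
    γ x + h ≤ γ a ∧ γ x + h ≤ γ b ∧ ∀ z ∈ Set.Icc a b, γ x ≤ γ z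

/-- Equivalence of h-minima: `γ` deviates by less than `h` from its value at `x` on the closed
interval between the two points. -/
def HEquiv (h : ℝ) (γ : ℝ → ℝ) (x x' : ℝ) : Prop :=
  ∀ z ∈ Set.uIcc x x', |γ z - γ x| < h

/-- The set `M_h^-(γ)`: the smallest element of every equivalence class of h-minima. -/
def hMinima (h : ℝ) (γ : ℝ → ℝ) : Set ℝ :=
  {x | IsHMin h γ x ∧ ∀ y, IsHMin h γ y → HEquiv h γ x y → x ≤ y}

/-- `min_{a ∈ A, b ∈ B} max_{[a ∧ b, a ∨ b]} γ`. -/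
def minMax (γ : ℝ → ℝ) (A B : Set ℝ) : ℝ :=
  sInf {m | ∃ a ∈ A, ∃ b ∈ B, m = sSup (γ '' Set.uIcc a b)}

/-- The set `Z(A, B)` of saddle points between `A` and `B`. -/
def saddles (γ : ℝ → ℝ) (A B : Set ℝ) : Set ℝ :=
  {z | (∃ a ∈ A, ∃ b ∈ B, z ∈ Set.uIcc a b) ∧ γ z = minMax γ A B}

/-- The leftmost saddle point `z*(A, B)`. -/
def zStar (γ : ℝ → ℝ) (A B : Set ℝ) : ℝ := sInf (saddles γ A B)

/-- The barrier `γ(z*(x, S)) - γ(x)` that separates `x` from `S`. -/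
def barrier (γ : ℝ → ℝ) (x : ℝ) (S : Set ℝ) : ℝ := γ (zStar γ {x} S) - γ x

/-- For a labeling `x 0, x 1, …, x (q-1)` of points, `S x k` consists of the `k` points of lowest
label and of the two end points. -/
def S {q : ℕ} (x : Fin q → ℝ) (k : ℕ) : Set ℝ :=
  {y | ∃ i : Fin q, (i : ℕ) < k ∧ y = x i} ∪ {-1, 1}

/-- `x` labels the points of `M_h^-(γ)`, without repetition, and satisfies the nondegeneracy
condition with gap `δ`. The labels start from `0`. -/
def IsLabeling (h δ : ℝ) (γ : ℝ → ℝ) {q : ℕ} (x : Fin q → ℝ) : Prop :=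
  Function.Injective x ∧ Set.range x = hMinima h γ ∧
    ∀ k j : Fin q, k < j → barrier γ (x j) (S x k) + δ ≤ barrier γ (x k) (S x k)

/-- The family `𝒜_{h,δ}` of good paths in `C([-1, 1])`. -/
def IsGoodPath (h δ : ℝ) (γ : ℝ → ℝ) : Prop :=
  ContinuousOn γ (Set.Icc (-1) 1) ∧
  (hMinima h γ).Nonempty ∧
  (∀ x ∈ hMinima h γ, h + δ ≤ barrier γ x ((hMinima h γ ∪ {-1, 1}) \ {x})) ∧
  ∃ (q : ℕ) (x : Fin q → ℝ), IsLabeling h δ γ x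

/-! ### Environment, potential, reversible measure -/

/-- An environment: `ω x` is the probability of the jump from `x` to `x + 1`. -/
abbrev Environment : Type := ℤ → unitInterval

/-- The potential: `∑_{i=1}^x log ((1 - ω_i) / ω_i)` for `x ≥ 1`, `0` for `x = 0` and
`-∑_{i=x+1}^0 log ((1 - ω_i) / ω_i)` for `x ≤ -1` (one of the two sums below is always empty). -/
def potential (ω : Environment) (x : ℤ) : ℝ :=
  ∑ i ∈ Finset.Ioc 0 x, Real.log ((1 - (ω i : ℝ)) / ω i)
    - ∑ i ∈ Finset.Ioc x 0, Real.log ((1 - (ω i : ℝ)) / ω i)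

/-- The rescaled potential `V_N`: the linear interpolation of the values `V(k) / √N` at `k / N`. -/
def rescaledPotential (ω : Environment) (N : ℕ) (t : ℝ) : ℝ :=
  ((1 - Int.fract (N * t)) * potential ω ⌊N * t⌋
    + Int.fract (N * t) * potential ω (⌊N * t⌋ + 1)) / √N

/-- The reversible measure `μ(x) = e^{-V(x)} / ω_x`. -/
def mu (ω : Environment) (x : ℤ) : ℝ := Real.exp (-potential ω x) / ω x

/-! ### Generator with Dirichlet conditions

A point `n / N` of the rescaled lattice `ℤ / N` is represented by the integer `n`. -/

/-- The transition matrix. -/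
def transition (ω : Environment) (x y : ℤ) : ℝ :=
  if y = x + 1 then (ω x : ℝ) else if y = x - 1 then 1 - (ω x : ℝ) else 0

/-- The generator `𝕀 - ℙ` with Dirichlet conditions outside `D`. -/
def generator (ω : Environment) (D : Finset ℤ) : Matrix D D ℝ :=
  Matrix.of fun x y => (if x = y then 1 else 0) - transition ω x y

/-- The norm of `L²(D, μ)`. -/
def norm2 (ω : Environment) (D : Finset ℤ) (f : D → ℝ) : ℝ :=
  √(∑ x : D, mu ω x * f x ^ 2)

/-- The interval `I_N = (-1, 1) ∩ ℤ / N`. -/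
def box (N : ℕ) : Finset ℤ := Finset.Ioo (-(N : ℤ)) N

open Classical in
/-- `I_N \ M` for a set `M` of reals. -/
def boxMinus (N : ℕ) (M : Set ℝ) : Finset ℤ := (box N).filter fun n => (n / N : ℝ) ∉ M

/-! ### The random walk -/

/-- The law of the next position of the walk. -/
def step (ω : Environment) (x : ℤ) : Measure ℤ :=
  ENNReal.ofReal (ω x) • Measure.dirac (x + 1)
    + ENNReal.ofReal (1 - ω x) • Measure.dirac (x - 1)

/-- The transition kernel of the walk. -/
def stepKernel (ω : Environment) : Kernel ℤ ℤ := ⟨step ω, measurable_of_countable _⟩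

instance (ω : Environment) : IsMarkovKernel (stepKernel ω) where
  isProbabilityMeasure x := ⟨by
    change step ω x Set.univ = 1
    simp only [step, Measure.coe_add, Measure.coe_smul, Pi.add_apply, Pi.smul_apply,
      measure_univ, smul_eq_mul, mul_one]
    rw [← ENNReal.ofReal_add (ω x).2.1 (sub_nonneg.2 (ω x).2.2)]
    simp⟩

/-- The law on trajectories of the walk `(X_n)` started in `x`. -/
def walkLaw (ω : Environment) (x : ℤ) : Measure (ℕ → ℤ) :=
  Kernel.trajMeasure (X := fun _ => ℤ) (Measure.dirac x) fun n =>
    (stepKernel ω).comap (fun p : (i : Finset.Iic n) → ℤ => p ⟨n, Finset.mem_Iic.2 le_rfl⟩)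
      (measurable_pi_apply _)

/-- `τ_A = min {n ≥ 1 : X_n / N ∈ A}` (and `⊤` if there is no such `n`). -/
def tau (N : ℕ) (A : Set ℝ) : (ℕ → ℤ) → WithTop ℕ :=
  hittingAfter (fun (n : ℕ) (X : ℕ → ℤ) => (X n / N : ℝ)) A 1

/-- The probability of `τ_A < τ_B` for the rescaled walk that starts in `n / N`. -/
def hitProb (ω : Environment) (N : ℕ) (n : ℤ) (A B : Set ℝ) : ℝ :=
  (walkLaw ω n).real {X | tau N A X < tau N B X}

open Classical in
/-- The equilibrium potential `h_k` on `I_N`: it is `1` at `x k`, `0` on `S x k`, and elsewhere the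
probability that the walk hits `x k` before `S x k`. -/
def eqPotential (ω : Environment) (N : ℕ) {q : ℕ} (x : Fin q → ℝ) (k : Fin q) (n : box N) : ℝ :=
  if ((n : ℤ) / N : ℝ) = x k then 1
  else if ((n : ℤ) / N : ℝ) ∈ S x k then 0
  else hitProb ω N n {x k} (S x k)

end SinaiWalk

end

/-! Detailed balance makes the generator with zero boundary values symmetric in `L²(μ)`; its
quadratic form is the Dirichlet form `energy`. The generator applied to h_k vanishes off S_{k-1} ∪
{x_k}, and h_j with j > k vanishes on that set. Hence the h_k are pairwise orthogonal for the form,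
and form-orthogonal to the space W of functions vanishing at all x_i. The matrix of the values
h_k(x_i) is triangular with unit diagonal, so W and the h_k span everything. The form is therefore
exactly block diagonal: Λ_k on the normalized h_k, and a form bounded below by λ* on W.

What remains is linear algebra (`IsTrialSystem`). Suppose that the normalized h_k are almost
orthogonal in L², and that the Λ_k are far from each other and far below λ*. Min-max then gives q
eigenvalues far below λ* and no others below λ*. Near orthogonality to W is not needed: if u = v + w
is a unit eigenvector with small eigenvalue r, with v in the span of the h_k and w ∈ W, then λ*‖w‖²
≤ ⟨Tw, w⟩ = ⟨Tu, w⟩ = r⟨u, w⟩ forces w to be small. Pairing the eigenvalue equation with each trial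
vector shows that v is dominated by one of them (`exists_close`).

The analytic input is one-dimensional. Harmonic functions are affine in the resistance Σ e^V, so
capacities and the values of h_k are explicit quotients of resistances, governed by the largest
value of V on the way. Every site can reach a lower h-minimum or the boundary without climbing more
than h (`exists_hMinima_below`). With Cauchy-Schwarz this bounds λ* from below. Combined with the
gap δ it shows that the mass of h_k away from its own valley, and the overlap of two different h_k,
carry a factor exponentially small in δ√N. Polynomial factors in N are absorbed by part of this
exponential. -/

noncomputable section
namespace SinaiWalk

/-! ### The Markov property of the walk -/

/-- The trajectories that follow the path `p` up to time `n`. -/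
def pathCylinder (n : ℕ) (p : ℕ → ℤ) : Set (ℕ → ℤ) := {X | ∀ i ≤ n, X i = p i}

lemma measurableSet_pathCylinder (n : ℕ) (p : ℕ → ℤ) : MeasurableSet (pathCylinder n p) := by
  have : pathCylinder n p = ⋂ i ∈ Set.Iic n, (fun X : ℕ → ℤ => X i) ⁻¹' {p i} := by
    ext X; simp [pathCylinder]
  rw [this]
  exact MeasurableSet.biInter (Set.to_countable _)
    fun i _ => measurable_pi_apply i (measurableSet_singleton _)

instance (ω : Environment) (x : ℤ) : IsProbabilityMeasure (walkLaw ω x) := by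
  unfold walkLaw; infer_instance

lemma walkLaw_map_zero (ω : Environment) (x : ℤ) :
    (walkLaw ω x).map (fun X => X 0) = Measure.dirac x := by
  have h1 : (fun X : ℕ → ℤ => X 0) =
      (fun p : (i : Finset.Iic 0) → ℤ => p ⟨0, by simp⟩) ∘ Preorder.frestrictLe 0 := rfl
  rw [h1, ← Measure.map_map (by fun_prop) (by fun_prop), walkLaw, Kernel.trajMeasure,
    Measure.map_comp _ _ (by fun_prop), Kernel.traj_map_frestrictLe, Kernel.partialTraj_self,
    Measure.id_comp, Measure.map_map (by fun_prop) (by fun_prop)]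
  exact Measure.map_id

lemma walkLaw_ae_zero (ω : Environment) (x : ℤ) : ∀ᵐ X ∂(walkLaw ω x), X 0 = x := by
  have h : ∀ᵐ y ∂(walkLaw ω x).map (fun X => X 0), y = x := by
    rw [walkLaw_map_zero]
    exact (ae_dirac_iff (measurableSet_singleton x)).2 rfl
  exact ae_of_ae_map (measurable_pi_apply (X := fun _ : ℕ => ℤ) 0).aemeasurable h

lemma walkLaw_pathCylinder_zero (ω : Environment) (p : ℕ → ℤ) :
    walkLaw ω (p 0) (pathCylinder 0 p) = 1 := by
  have h := walkLaw_ae_zero ω (p 0)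
  rw [← prob_compl_eq_zero_iff (measurableSet_pathCylinder 0 p)]
  refine measure_mono_null ?_ h
  intro X hX h0
  exact hX fun i hi => by obtain rfl : i = 0 := by lia
                          exact h0

/-- The joint law of the history up to time `n` and of the next position is a composition product;
both sides are evaluated on a product of two singletons. -/
lemma walkLaw_pathCylinder_succ (ω : Environment) (x : ℤ) (n : ℕ) (p : ℕ → ℤ) :
    walkLaw ω x (pathCylinder (n + 1) p)
      = walkLaw ω x (pathCylinder n p) * step ω (p n) {p (n + 1)} := by
  have key := Kernel.map_frestrictLe_trajMeasure_compProd_eq_map_trajMeasure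
    (X := fun _ => ℤ) (μ₀ := Measure.dirac x) (κ := fun n =>
    (stepKernel ω).comap (fun p : (i : Finset.Iic n) → ℤ => p ⟨n, Finset.mem_Iic.2 le_rfl⟩)
      (measurable_pi_apply _)) (a := n)
  have hpre : Preorder.frestrictLe (π := fun _ => ℤ) n ⁻¹' {Preorder.frestrictLe n p}
      = pathCylinder n p := by
    ext X
    simp [pathCylinder, funext_iff]
  have h2 := congrArg (fun μ => μ ({Preorder.frestrictLe n p} ×ˢ {p (n + 1)})) key
  beta_reduce at h2
  rw [Measure.map_apply (by fun_prop)
      ((measurableSet_singleton _).prod (measurableSet_singleton _)),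
    Measure.compProd_apply_prod (measurableSet_singleton _) (measurableSet_singleton _),
    Measure.restrict_singleton, lintegral_smul_measure, lintegral_dirac,
    Measure.map_apply (by fun_prop) (measurableSet_singleton _), hpre] at h2
  refine Eq.trans ?_ h2.symm
  change walkLaw ω x _ = walkLaw ω x _
  congr 1
  ext X
  simp only [pathCylinder, Set.mem_ofPred_eq, Set.mem_preimage, Set.mem_prod,
    Set.mem_singleton_iff, funext_iff, Subtype.forall, Finset.mem_Iic,
    Preorder.frestrictLe_apply]
  constructor
  · exact fun h => ⟨fun i hi => h i (by lia), h _ le_rfl⟩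
  · rintro ⟨h, h'⟩ i hi
    rcases Nat.lt_or_ge n i with h1 | h1
    · obtain rfl : i = n + 1 := by lia
      exact h'
    · exact h i h1

lemma walkLaw_pathCylinder_eq_zero (ω : Environment) {x : ℤ} {p : ℕ → ℤ} (h : p 0 ≠ x) (n : ℕ) :
    walkLaw ω x (pathCylinder n p) = 0 := by
  refine measure_mono_null ?_ (walkLaw_ae_zero ω x)
  intro X hX h0
  exact h ((hX 0 (Nat.zero_le _)).symm.trans h0)

/-- The path `p` preceded by the point `x`. -/
def consPath (x : ℤ) (p : ℕ → ℤ) : ℕ → ℤ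
  | 0 => x
  | n + 1 => p n

/-- The trajectory after the first step. -/
def shift (X : ℕ → ℤ) : ℕ → ℤ := fun n => X (n + 1)

lemma measurable_shift : Measurable shift :=
  measurable_pi_lambda _ fun n => measurable_pi_apply (n + 1)

/-- Cylinder probabilities are products of step probabilities of a time-homogeneous chain, so the
first factor splits off as well as the last. The induction peels off last steps. -/
lemma walkLaw_consPath (ω : Environment) (x : ℤ) (p : ℕ → ℤ) (n : ℕ) :
    walkLaw ω x (pathCylinder (n + 1) (consPath x p))
      = step ω x {p 0} * walkLaw ω (p 0) (pathCylinder n p) := by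
  induction n with
  | zero =>
    rw [walkLaw_pathCylinder_succ, walkLaw_pathCylinder_zero, mul_one]
    have := walkLaw_pathCylinder_zero ω (consPath x p)
    simp only [consPath] at this ⊢
    rw [this, one_mul]
  | succ n ih =>
    rw [walkLaw_pathCylinder_succ, ih, walkLaw_pathCylinder_succ, mul_assoc]
    rfl

lemma walkLaw_map_shift_pathCylinder (ω : Environment) (x : ℤ) (p : ℕ → ℤ) (n : ℕ) :
    (walkLaw ω x).map shift (pathCylinder n p)
      = step ω x {p 0} * walkLaw ω (p 0) (pathCylinder n p) := by
  rw [Measure.map_apply measurable_shift (measurableSet_pathCylinder n p), ← walkLaw_consPath]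
  -- The two events differ only by the constraint at time 0, which holds almost surely.
  refine measure_congr ?_
  filter_upwards [walkLaw_ae_zero ω x] with X hX
  refine propext ⟨fun h i hi => ?_, fun h i hi => h (i + 1) (by lia)⟩
  cases i with
  | zero => exact hX
  | succ i => exact h i (by lia)

/-- Histories up to time `n` form a countable space whose points correspond to cylinders, so
cylinders determine these marginals. Every finite set of times lies in some `Iic n`, and projective
limits of finite measures are unique. -/
lemma measure_ext_of_pathCylinder {μ ν : Measure (ℕ → ℤ)} [IsFiniteMeasure μ] [IsFiniteMeasure ν]
    (h : ∀ n p, μ (pathCylinder n p) = ν (pathCylinder n p)) : μ = ν := by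
  have h1 : ∀ n : ℕ, μ.map (Finset.Iic n).restrict = ν.map (Finset.Iic n).restrict := by
    intro n
    refine Measure.ext_of_singleton fun p => ?_
    rw [Measure.map_apply (by fun_prop) (measurableSet_singleton _),
      Measure.map_apply (by fun_prop) (measurableSet_singleton _)]
    -- The value 0 after time `n` is arbitrary: the cylinder does not look beyond `n`.
    have : (Finset.Iic n).restrict (π := fun _ => ℤ) ⁻¹' {p}
        = pathCylinder n (fun i => if hi : i ≤ n then p ⟨i, by simpa using hi⟩ else 0) := by
      ext X
      simp only [Set.mem_preimage, Set.mem_singleton_iff, pathCylinder, Set.mem_ofPred_eq,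
        funext_iff, Subtype.forall, Finset.mem_Iic, Finset.restrict]
      exact forall_congr' fun i => ⟨fun h hi => by rw [h hi, dif_pos hi],
        fun h hi => by rw [h hi, dif_pos hi]⟩
    rw [this]
    exact h _ _
  have h2 : ∀ I : Finset ℕ, μ.map I.restrict = ν.map I.restrict := by
    intro I
    have hI : I ⊆ Finset.Iic (I.sup id) := fun i hi =>
      Finset.mem_Iic.2 (Finset.le_sup (f := id) hi)
    have : I.restrict (π := fun _ => ℤ) =
        Finset.restrict₂ hI ∘ (Finset.Iic (I.sup id)).restrict := rfl
    rw [this, ← Measure.map_map (by fun_prop) (by fun_prop),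
      ← Measure.map_map (by fun_prop) (by fun_prop), h1]
  exact IsProjectiveLimit.unique (P := fun I => ν.map I.restrict) (fun I => h2 I) fun I => rfl

/-- The Markov property after the first step. -/
lemma walkLaw_map_shift (ω : Environment) (x : ℤ) :
    (walkLaw ω x).map shift = ENNReal.ofReal (ω x) • walkLaw ω (x + 1)
      + ENNReal.ofReal (1 - ω x) • walkLaw ω (x - 1) := by
  have := Measure.isFiniteMeasure_map (walkLaw ω x) shift
  have h1 : IsFiniteMeasure (ENNReal.ofReal (ω x) • walkLaw ω (x + 1)) :=
    Measure.smul_finite _ ENNReal.ofReal_ne_top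
  have h2 : IsFiniteMeasure (ENNReal.ofReal (1 - ω x) • walkLaw ω (x - 1)) :=
    Measure.smul_finite _ ENNReal.ofReal_ne_top
  refine measure_ext_of_pathCylinder fun n p => ?_
  rw [walkLaw_map_shift_pathCylinder]
  simp only [step, Measure.coe_add, Measure.coe_smul, Pi.add_apply, Pi.smul_apply, smul_eq_mul,
    Measure.dirac_apply, Set.indicator_apply, Set.mem_singleton_iff, Pi.one_apply]
  -- A cylinder is charged only by the walk that starts in `p 0`, so at most one of the two terms
  -- survives.
  by_cases h1 : x + 1 = p 0
  · have h3 : walkLaw ω (x - 1) (pathCylinder n p) = 0 :=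
      walkLaw_pathCylinder_eq_zero ω (by lia) n
    rw [h3, if_pos h1, if_neg (by lia), h1]; simp
  · by_cases h2 : x - 1 = p 0
    · have h3 : walkLaw ω (x + 1) (pathCylinder n p) = 0 :=
        walkLaw_pathCylinder_eq_zero ω (by lia) n
      rw [h3, if_neg h1, if_pos h2, h2]; simp
    · rw [if_neg h1, if_neg h2, walkLaw_pathCylinder_eq_zero ω (Ne.symm h1),
        walkLaw_pathCylinder_eq_zero ω (Ne.symm h2)]; simp

/-! ### Hitting times and first-step analysis. -/

lemma tau_lt_tau_iff (N : ℕ) (A B : Set ℝ) (X : ℕ → ℤ) :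
    tau N A X < tau N B X ↔
      ∃ n, (X (n + 1) / N : ℝ) ∈ A ∧ ∀ i ≤ n, (X (i + 1) / N : ℝ) ∉ B := by
  constructor
  · intro h
    have hA : tau N A X ≠ ⊤ := ne_top_of_lt h
    obtain ⟨n, hn⟩ := WithTop.ne_top_iff_exists.1 hA
    have hle : tau N A X ≤ (n : WithTop ℕ) := hn.symm.le
    obtain ⟨j, ⟨hj1, hj2⟩, hj⟩ := hittingAfter_le_iff.1 hle
    obtain ⟨j, rfl⟩ := Nat.exists_eq_add_of_le' hj1
    refine ⟨j, hj, fun i hi => ?_⟩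
    refine notMem_of_lt_hittingAfter (u := fun (n : ℕ) (X : ℕ → ℤ) => (X n / N : ℝ)) (n := 1)
      (lt_of_le_of_lt ?_ h) (by lia)
    rw [← hn]
    exact_mod_cast (by lia : i + 1 ≤ n)
  · rintro ⟨n, hA, hB⟩
    have h1 : tau N A X ≤ ((n + 1 : ℕ) : WithTop ℕ) :=
      hittingAfter_le_of_mem (u := fun (n : ℕ) (X : ℕ → ℤ) => (X n / N : ℝ)) (by lia) hA
    refine lt_of_le_of_lt h1 (not_le.1 fun h2 => ?_)
    obtain ⟨j, ⟨hj1, hj2⟩, hj⟩ := hittingAfter_le_iff.1 h2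
    obtain ⟨j, rfl⟩ := Nat.exists_eq_add_of_le' hj1
    exact hB j (by lia) hj

lemma measurableSet_tau_lt_tau (N : ℕ) (A B : Set ℝ) :
    MeasurableSet {X | tau N A X < tau N B X} := by
  have h : ∀ (C : Set ℝ) (n : ℕ), MeasurableSet {X : ℕ → ℤ | (X n / N : ℝ) ∈ C} := fun C n =>
    measurable_pi_apply (X := fun _ : ℕ => ℤ) n
      (MeasurableSet.of_discrete (s := {z : ℤ | (z / N : ℝ) ∈ C}))
  have : {X | tau N A X < tau N B X} = ⋃ n, ({X : ℕ → ℤ | (X (n + 1) / N : ℝ) ∈ A} ∩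
      ⋂ i ∈ Set.Iic n, {X : ℕ → ℤ | (X (i + 1) / N : ℝ) ∈ B}ᶜ) := by
    ext X
    simp [tau_lt_tau_iff]
  rw [this]
  exact MeasurableSet.iUnion fun n => (h A _).inter
    (MeasurableSet.biInter (Set.to_countable _) fun i _ => (h B _).compl)

/-- `tau` ignores time 0, but after one step the current position matters. The event on the left is
what `τ_A < τ_B` becomes for the shifted trajectory; a point of both `A` and `B` counts as a hit of
`B`. -/
lemma walkLaw_hit (ω : Environment) (N : ℕ) (A B : Set ℝ) (y : ℤ) [Decidable ((y / N : ℝ) ∈ A)]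
    [Decidable ((y / N : ℝ) ∈ B)] :
    (walkLaw ω y).real {X | (X 0 / N : ℝ) ∉ B ∧ ((X 0 / N : ℝ) ∈ A ∨ tau N A X < tau N B X)}
      = if (y / N : ℝ) ∈ B then 0 else if (y / N : ℝ) ∈ A then 1 else hitProb ω N y A B := by
  have h0 := walkLaw_ae_zero ω y
  split_ifs with hB hA
  · rw [measureReal_def, (measure_eq_zero_iff_ae_notMem).2, ENNReal.toReal_zero]
    filter_upwards [h0] with X hX h
    exact h.1 (by rwa [hX])
  · rw [← probReal_univ (μ := walkLaw ω y)]
    refine measureReal_congr ?_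
    filter_upwards [h0] with X hX
    refine propext ⟨fun _ => trivial, fun _ => ⟨by rwa [hX], Or.inl (by rwa [hX])⟩⟩
  · refine measureReal_congr ?_
    filter_upwards [h0] with X hX
    refine propext ⟨fun h => h.2.resolve_left (by rwa [hX]), fun h => ⟨by rwa [hX], Or.inr h⟩⟩

open Classical in
/-- The equation that the hitting probabilities satisfy by the Markov property. -/
lemma hitProb_eq (ω : Environment) (N : ℕ) (A B : Set ℝ) (x : ℤ) (u : ℤ → ℝ)
    (hu : ∀ y : ℤ, u y = if (y / N : ℝ) ∈ B then 0 else if (y / N : ℝ) ∈ A then 1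
      else hitProb ω N y A B) :
    hitProb ω N x A B = ω x * u (x + 1) + (1 - ω x) * u (x - 1) := by
  set G : Set (ℕ → ℤ) :=
    {X | (X 0 / N : ℝ) ∉ B ∧ ((X 0 / N : ℝ) ∈ A ∨ tau N A X < tau N B X)} with hG
  have hGm : MeasurableSet G := by
    have h : ∀ (C : Set ℝ), MeasurableSet {X : ℕ → ℤ | (X 0 / N : ℝ) ∈ C} := fun C =>
      measurable_pi_apply (X := fun _ : ℕ => ℤ) 0
        (MeasurableSet.of_discrete (s := {z : ℤ | (z / N : ℝ) ∈ C}))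
    exact (h B).compl.inter ((h A).union (measurableSet_tau_lt_tau N A B))
  -- Time 1 of the trajectory is time 0 of its shift, which is why `G` also inspects `X 0`.
  have h1 : {X | tau N A X < tau N B X} = shift ⁻¹' G := by
    ext X
    simp only [Set.mem_ofPred_eq, hG, Set.mem_preimage, tau_lt_tau_iff, shift]
    constructor
    · rintro ⟨n, h1, h2⟩
      refine ⟨h2 0 (by lia), ?_⟩
      cases n with
      | zero => exact Or.inl h1
      | succ n => exact Or.inr ⟨n, h1, fun i hi => h2 (i + 1) (by lia)⟩
    · rintro ⟨h1, h2 | ⟨n, h2, h3⟩⟩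
      · exact ⟨0, h2, fun i hi => by obtain rfl : i = 0 := by lia
                                     exact h1⟩
      · refine ⟨n + 1, h2, fun i hi => ?_⟩
        cases i with
        | zero => exact h1
        | succ i => exact h3 i (by lia)
  have h2 : hitProb ω N x A B = ((walkLaw ω x).map shift).real G := by
    rw [hitProb, h1, measureReal_def, measureReal_def, Measure.map_apply measurable_shift hGm]
  have h3 := (ω x).2.1
  have h4 : 0 ≤ 1 - (ω x : ℝ) := sub_nonneg.2 (ω x).2.2
  rw [h2, walkLaw_map_shift, hu, hu, ← walkLaw_hit, ← walkLaw_hit, measureReal_def]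
  simp only [Measure.coe_add, Measure.coe_smul, Pi.add_apply, Pi.smul_apply, smul_eq_mul]
  rw [ENNReal.toReal_add (ENNReal.mul_ne_top ENNReal.ofReal_ne_top (measure_ne_top _ _))
    (ENNReal.mul_ne_top ENNReal.ofReal_ne_top (measure_ne_top _ _)), ENNReal.toReal_mul,
    ENNReal.toReal_mul, ENNReal.toReal_ofReal h3, ENNReal.toReal_ofReal h4]
  rfl

/-! ### Elliptic environments, resistances and harmonic functions on the lattice -/

/-- The environment takes its values in `[κ, 1 - κ]`. -/
def Elliptic (κ : ℝ) (ω : Environment) : Prop := ∀ y, κ ≤ (ω y : ℝ) ∧ (ω y : ℝ) ≤ 1 - κ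

lemma potential_succ (ω : Environment) (x : ℤ) :
    potential ω (x + 1) = potential ω x + Real.log ((1 - (ω (x + 1) : ℝ)) / ω (x + 1)) := by
  unfold potential
  rcases lt_or_ge x 0 with h | h
  · have h1 : Finset.Ioc x 0 = insert (x + 1) (Finset.Ioc (x + 1) 0) := by
      ext i; simp only [Finset.mem_Ioc, Finset.mem_insert]; lia
    rw [h1, Finset.sum_insert (by simp), Finset.Ioc_eq_empty (by lia : ¬ 0 < x + 1),
      Finset.Ioc_eq_empty (by lia : ¬ 0 < x)]
    simp
  · have h1 : Finset.Ioc 0 (x + 1) = insert (x + 1) (Finset.Ioc 0 x) := by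
      ext i; simp only [Finset.mem_Ioc, Finset.mem_insert]; lia
    rw [h1, Finset.sum_insert (by simp), Finset.Ioc_eq_empty (by lia : ¬ x + 1 < 0),
      Finset.Ioc_eq_empty (by lia : ¬ x < 0)]
    simp [add_comm]

section
variable {κ : ℝ} {ω : Environment}

lemma Elliptic.pos (hω : Elliptic κ ω) (hκ : 0 < κ) (x : ℤ) : 0 < (ω x : ℝ) :=
  hκ.trans_le (hω x).1

lemma Elliptic.lt_one (hω : Elliptic κ ω) (hκ : 0 < κ) (x : ℤ) : (ω x : ℝ) < 1 := by
  linarith [(hω x).2]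

lemma exp_potential_succ (hω : Elliptic κ ω) (hκ : 0 < κ) (x : ℤ) :
    Real.exp (potential ω (x + 1))
      = Real.exp (potential ω x) * ((1 - (ω (x + 1) : ℝ)) / ω (x + 1)) := by
  rw [potential_succ, Real.exp_add, Real.exp_log]
  exact div_pos (sub_pos.2 (hω.lt_one hκ _)) (hω.pos hκ _)

/-- Needed because the resistance between `a` and `b` contains the weight of `a` but not that of
`b`: a barrier at the right end is moved one site to the left at the cost of `κ`. -/
lemma mul_exp_potential_succ_le (hω : Elliptic κ ω) (hκ : 0 < κ) (x : ℤ) :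
    κ * Real.exp (potential ω (x + 1)) ≤ Real.exp (potential ω x) := by
  have h0 := hω.pos hκ (x + 1)
  have h1 := Real.exp_pos (potential ω x)
  rw [exp_potential_succ hω hκ, mul_left_comm]
  refine mul_le_of_le_one_right h1.le ?_
  rw [← mul_div_assoc, div_le_one h0]
  nlinarith [(hω (x + 1)).1]

lemma mu_pos (hω : Elliptic κ ω) (hκ : 0 < κ) (x : ℤ) : 0 < mu ω x :=
  div_pos (Real.exp_pos _) (hω.pos hκ x)

lemma exp_neg_le_mu (hω : Elliptic κ ω) (hκ : 0 < κ) (x : ℤ) :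
    Real.exp (-potential ω x) ≤ mu ω x :=
  le_div_self (Real.exp_pos _).le (hω.pos hκ x) (hω.lt_one hκ x).le

lemma mu_le (hω : Elliptic κ ω) (hκ : 0 < κ) (x : ℤ) :
    mu ω x ≤ Real.exp (-potential ω x) / κ :=
  div_le_div_of_nonneg_left (Real.exp_pos _).le hκ (hω x).1

/-- With `mu_mul_left` this is reversibility: the edge between `x` and `x + 1` has conductance
`e^{-V(x)}` seen from either end. -/
lemma mu_mul_right (hω : Elliptic κ ω) (hκ : 0 < κ) (x : ℤ) :
    mu ω x * ω x = Real.exp (-potential ω x) :=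
  div_mul_cancel₀ _ (hω.pos hκ x).ne'

lemma mu_mul_left (hω : Elliptic κ ω) (hκ : 0 < κ) (x : ℤ) :
    mu ω (x + 1) * (1 - ω (x + 1)) = Real.exp (-potential ω x) := by
  have h0 := hω.pos hκ (x + 1)
  have h1 := sub_pos.2 (hω.lt_one hκ (x + 1))
  rw [mu, Real.exp_neg, Real.exp_neg, exp_potential_succ hω hκ]
  have := (Real.exp_pos (potential ω x)).ne'
  field_simp

/-- The resistance `∑_{a ≤ z < b} e^{V(z)}` between `a` and `b`. -/
def res (ω : Environment) (a b : ℤ) : ℝ := ∑ z ∈ Finset.Ico a b, Real.exp (potential ω z)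

lemma res_nonneg (ω : Environment) (a b : ℤ) : 0 ≤ res ω a b :=
  Finset.sum_nonneg fun _ _ => (Real.exp_pos _).le

lemma exp_le_res {a b z : ℤ} (ha : a ≤ z) (hb : z < b) :
    Real.exp (potential ω z) ≤ res ω a b :=
  Finset.single_le_sum (f := fun z => Real.exp (potential ω z))
    (fun _ _ => (Real.exp_pos _).le) (Finset.mem_Ico.2 ⟨ha, hb⟩)

lemma res_pos {a b : ℤ} (h : a < b) : 0 < res ω a b :=
  (Real.exp_pos _).trans_le (exp_le_res le_rfl h)

lemma res_succ {a b : ℤ} (h : a ≤ b) :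
    res ω a (b + 1) = res ω a b + Real.exp (potential ω b) := by
  have h1 : Finset.Ico a (b + 1) = insert b (Finset.Ico a b) := by
    ext i; simp only [Finset.mem_Ico, Finset.mem_insert]; lia
  rw [res, h1, Finset.sum_insert (by simp), add_comm]; rfl

lemma res_self (ω : Environment) (a : ℤ) : res ω a a = 0 := by simp [res]

lemma res_add {a b c : ℤ} (h : a ≤ b) (h' : b ≤ c) :
    res ω a b + res ω b c = res ω a c := by
  unfold res
  rw [← Finset.sum_union (Finset.Ico_disjoint_Ico_consecutive a b c),
    Finset.Ico_union_Ico_eq_Ico h h']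

lemma res_le {a b : ℤ} {t : ℝ} (hab : a ≤ b) (h : ∀ z, a ≤ z → z < b → potential ω z ≤ t) :
    res ω a b ≤ (b - a) * Real.exp t := by
  have := Finset.sum_le_card_nsmul (Finset.Ico a b) (fun z => Real.exp (potential ω z))
    (Real.exp t) fun z hz => Real.exp_le_exp.2
      (h z (Finset.mem_Ico.1 hz).1 (Finset.mem_Ico.1 hz).2)
  rw [nsmul_eq_mul, Int.card_Ico] at this
  have h2 : (((b - a).toNat : ℕ) : ℝ) = b - a := by
    have : (((b - a).toNat : ℕ) : ℤ) = b - a := Int.toNat_of_nonneg (by lia)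
    exact_mod_cast this
  rwa [h2] at this

lemma res_le_two_mul {a b : ℤ} {N : ℕ} {t : ℝ} (ha : -(N : ℤ) ≤ a) (hb : b ≤ N) (hab : a ≤ b)
    (h : ∀ z, a ≤ z → z < b → potential ω z ≤ t) : res ω a b ≤ 2 * N * Real.exp t := by
  refine (res_le hab h).trans (mul_le_mul_of_nonneg_right ?_ (Real.exp_pos t).le)
  have : b - a ≤ 2 * N := by lia
  exact_mod_cast this

/-- The generator on functions on the whole lattice. -/
def lap (ω : Environment) (u : ℤ → ℝ) (x : ℤ) : ℝ :=
  u x - ω x * u (x + 1) - (1 - ω x) * u (x - 1)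

lemma mu_mul_lap (hω : Elliptic κ ω) (hκ : 0 < κ) (u : ℤ → ℝ) (x : ℤ) :
    mu ω x * lap ω u x = Real.exp (-potential ω x) * (u x - u (x + 1))
      + Real.exp (-potential ω (x - 1)) * (u x - u (x - 1)) := by
  have h1 := mu_mul_right hω hκ x
  have h2 := mu_mul_left hω hκ (x - 1)
  rw [sub_add_cancel] at h2
  rw [← h1, ← h2, lap]
  ring

/-- Harmonicity says that the current `e^{-V(y)} (u(y+1) - u(y))` is the same through all edges; an
increment of `u` is this current times the resistance. -/
lemma sub_eq_of_lap_eq_zero (hω : Elliptic κ ω) (hκ : 0 < κ) {u : ℤ → ℝ} {a b : ℤ}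
    (hu : ∀ x, a < x → x < b → lap ω u x = 0) {y : ℤ} (ha : a ≤ y) (hb : y ≤ b) :
    u y - u a = Real.exp (-potential ω a) * (u (a + 1) - u a) * res ω a y := by
  have hflow : ∀ y, a ≤ y → y < b → Real.exp (-potential ω y) * (u (y + 1) - u y)
      = Real.exp (-potential ω a) * (u (a + 1) - u a) := by
    intro y ha
    induction y, ha using Int.leInduction with
    | base => intro _; rfl
    | succ y hy ih =>
      intro hb
      have h1 := mu_mul_lap hω hκ u (y + 1)
      rw [hu (y + 1) (by lia) hb, mul_zero, add_sub_cancel_right] at h1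
      linarith [ih (by lia)]
  induction y, ha using Int.leInduction with
  | base => simp [res_self]
  | succ y hy ih =>
    rw [res_succ hy, mul_add, ← ih (by lia), ← hflow y hy (by lia), Real.exp_neg]
    have := (Real.exp_pos (potential ω y)).ne'
    field_simp
    ring

/-- Harmonic functions are affine functions of the resistance. -/
lemma sub_mul_res_of_lap_eq_zero (hω : Elliptic κ ω) (hκ : 0 < κ) {u : ℤ → ℝ} {a b : ℤ}
    (hu : ∀ x, a < x → x < b → lap ω u x = 0) {y : ℤ} (ha : a ≤ y) (hb : y ≤ b) :
    (u y - u a) * res ω a b = (u b - u a) * res ω a y := by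
  rw [sub_eq_of_lap_eq_zero hω hκ hu ha hb, sub_eq_of_lap_eq_zero hω hκ hu (ha.trans hb) le_rfl]
  ring

lemma eq_zero_of_lap_eq_zero (hω : Elliptic κ ω) (hκ : 0 < κ) {u : ℤ → ℝ} {a b : ℤ}
    (hu : ∀ x, a < x → x < b → lap ω u x = 0) (h0 : u a = 0) (h1 : u b = 0) {y : ℤ}
    (ha : a ≤ y) (hb : y ≤ b) : u y = 0 := by
  rcases eq_or_lt_of_le (ha.trans hb) with rfl | hab
  · rwa [show y = a by lia]
  have h := sub_mul_res_of_lap_eq_zero hω hκ hu ha hb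
  rw [h0, h1, sub_zero, sub_zero, zero_mul] at h
  exact (mul_eq_zero.1 h).resolve_right (res_pos hab).ne'

/-! ### The Dirichlet form -/

/-- The Dirichlet form on functions that vanish outside of `(-N, N)`. -/
def energy (ω : Environment) (N : ℕ) (f : ℤ → ℝ) : ℝ :=
  ∑ x ∈ Finset.Ico (-(N : ℤ)) N, Real.exp (-potential ω x) * (f (x + 1) - f x) ^ 2

/-- Summation by parts: each edge is counted from its two ends. Because `f` vanishes at `-N` and
`N`, one sum extends to `-N` and the other to `N`, after which both run over all edges. -/
lemma sum_mu_mul_lap (hω : Elliptic κ ω) (hκ : 0 < κ) {N : ℕ} {f : ℤ → ℝ}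
    (hf : f (-N) = 0) (hf' : f N = 0) :
    ∑ x ∈ box N, mu ω x * (f x * lap ω f x) = energy ω N f := by
  rcases Nat.eq_zero_or_pos N with rfl | hN
  · simp [box, energy]
  have h1 : ∀ x, mu ω x * (f x * lap ω f x)
      = f x * (Real.exp (-potential ω x) * (f x - f (x + 1)))
        + f x * (Real.exp (-potential ω (x - 1)) * (f x - f (x - 1))) := fun x => by
    rw [mul_left_comm, mu_mul_lap hω hκ]; ring
  have h2 : ∑ x ∈ box N, f x * (Real.exp (-potential ω x) * (f x - f (x + 1)))
      = ∑ x ∈ Finset.Ico (-(N : ℤ)) N, f x * (Real.exp (-potential ω x) * (f x - f (x + 1))) := by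
    refine Finset.sum_subset (fun x hx => ?_) fun x hx hx' => ?_
    · simp only [box, Finset.mem_Ioo, Finset.mem_Ico] at hx ⊢; lia
    · simp only [box, Finset.mem_Ioo, Finset.mem_Ico] at hx hx'
      rw [show x = -(N : ℤ) by lia, hf, zero_mul]
  have h3 : ∑ x ∈ box N, f x * (Real.exp (-potential ω (x - 1)) * (f x - f (x - 1)))
      = ∑ x ∈ Finset.Ioc (-(N : ℤ)) N,
        f x * (Real.exp (-potential ω (x - 1)) * (f x - f (x - 1))) := by
    refine Finset.sum_subset (fun x hx => ?_) fun x hx hx' => ?_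
    · simp only [box, Finset.mem_Ioo, Finset.mem_Ioc] at hx ⊢; lia
    · simp only [box, Finset.mem_Ioo, Finset.mem_Ioc] at hx hx'
      rw [show x = (N : ℤ) by lia, hf', zero_mul]
  have h4 : ∑ x ∈ Finset.Ioc (-(N : ℤ)) N,
        f x * (Real.exp (-potential ω (x - 1)) * (f x - f (x - 1)))
      = ∑ x ∈ Finset.Ico (-(N : ℤ)) N,
        f (x + 1) * (Real.exp (-potential ω x) * (f (x + 1) - f x)) := by
    refine Finset.sum_nbij' (fun x => x - 1) (fun x => x + 1) ?_ ?_ ?_ ?_ ?_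
    · intro x hx; simp only [Finset.mem_Ioc, Finset.mem_Ico] at hx ⊢; lia
    · intro x hx; simp only [Finset.mem_Ioc, Finset.mem_Ico] at hx ⊢; lia
    · intro x _; simp
    · intro x _; simp
    · intro x _; simp
  rw [Finset.sum_congr rfl fun x _ => h1 x, Finset.sum_add_distrib, h2, h3, h4,
    ← Finset.sum_add_distrib, energy]
  exact Finset.sum_congr rfl fun x _ => by ring

lemma energy_nonneg (ω : Environment) (N : ℕ) (f : ℤ → ℝ) : 0 ≤ energy ω N f :=
  Finset.sum_nonneg fun _ _ => mul_nonneg (Real.exp_pos _).le (sq_nonneg _)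

/-- Cauchy-Schwarz for the telescoping sum, with weights `e^V` and `e^{-V}`. -/
lemma sq_sub_le_res_mul_energy {N : ℕ} (f : ℤ → ℝ) {a b : ℤ} (ha : -(N : ℤ) ≤ a) (hab : a ≤ b)
    (hb : b ≤ N) : (f b - f a) ^ 2 ≤ res ω a b * energy ω N f := by
  have h1 : f b - f a = ∑ x ∈ Finset.Ico a b, (f (x + 1) - f x) := by
    clear ha hb
    induction b, hab using Int.leInduction with
    | base => simp
    | succ b hb ih =>
      have h1 : Finset.Ico a (b + 1) = insert b (Finset.Ico a b) := by
        ext i; simp only [Finset.mem_Ico, Finset.mem_insert]; lia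
      rw [h1, Finset.sum_insert (by simp), ← ih]; ring
  have h2 : (∑ x ∈ Finset.Ico a b, (f (x + 1) - f x)) ^ 2 ≤ res ω a b *
      ∑ x ∈ Finset.Ico a b, Real.exp (-potential ω x) * (f (x + 1) - f x) ^ 2 := by
    refine Finset.sum_sq_le_sum_mul_sum_of_sq_le_mul _ (fun _ _ => (Real.exp_pos _).le)
      (fun _ _ => mul_nonneg (Real.exp_pos _).le (sq_nonneg _)) fun x _ => ?_
    rw [← mul_assoc, ← Real.exp_add]; simp
  rw [h1]
  refine h2.trans (mul_le_mul_of_nonneg_left ?_ (res_nonneg _ _ _))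
  refine Finset.sum_le_sum_of_subset_of_nonneg (Finset.Ico_subset_Ico ha hb)
    fun _ _ _ => mul_nonneg (Real.exp_pos _).le (sq_nonneg _)

/-- A function that vanishes at a point `s` which is accessible from `y` below the level
`V(y) + h` is controlled at `y` by its energy. -/
lemma mu_mul_sq_le_energy (hω : Elliptic κ ω) (hκ : 0 < κ) {N : ℕ} {f : ℤ → ℝ} {h : ℝ} {y s : ℤ}
    (hy : -(N : ℤ) ≤ y) (hy' : y ≤ N) (hs : -(N : ℤ) ≤ s) (hs' : s ≤ N) (hfs : f s = 0)
    (hV : ∀ z ∈ Set.uIcc y s, potential ω z ≤ potential ω y + h) :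
    mu ω y * f y ^ 2 ≤ 2 * N / κ * Real.exp h * energy ω N f := by
  have hE := energy_nonneg ω N f
  have h1 : f y ^ 2 ≤ 2 * N * Real.exp (potential ω y + h) * energy ω N f := by
    rcases le_total y s with hys | hys
    · have h2 := sq_sub_le_res_mul_energy (ω := ω) f hy hys hs'
      rw [hfs, zero_sub, neg_sq] at h2
      refine h2.trans (mul_le_mul_of_nonneg_right (res_le_two_mul hy hs' hys fun z h1 h2 => ?_) hE)
      exact hV z (by rw [Set.uIcc_of_le hys]; exact ⟨h1, h2.le⟩)
    · have h2 := sq_sub_le_res_mul_energy (ω := ω) f hs hys hy'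
      rw [hfs, sub_zero] at h2
      refine h2.trans (mul_le_mul_of_nonneg_right (res_le_two_mul hs hy' hys fun z h1 h2 => ?_) hE)
      exact hV z (by rw [Set.uIcc_of_ge hys]; exact ⟨h1, h2.le⟩)
  -- The factor `e^{V(y)}` of the resistance cancels against `e^{-V(y)}` in `mu`; only the climb `h`
  -- remains.
  calc mu ω y * f y ^ 2 ≤ Real.exp (-potential ω y) / κ *
        (2 * N * Real.exp (potential ω y + h) * energy ω N f) :=
        mul_le_mul (mu_le hω hκ y) h1 (sq_nonneg _) (by positivity)
    _ = 2 * N / κ * Real.exp h * energy ω N f := by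
        rw [Real.exp_add, Real.exp_neg]
        have := (Real.exp_pos (potential ω y)).ne'
        field_simp

end

/-! ### Small eigenvalues of a symmetric operator from almost orthogonal trial vectors -/

section Abstract

variable {E : Type*} [NormedAddCommGroup E] [InnerProductSpace ℝ E]

/-- Almost orthonormal vectors `φ` and a subspace `W`, orthogonal with respect to the quadratic form
of `T`; the values `Λ` of the form at the `φ i` are well separated, and far below the lower bound
`l` of the form on `W`. -/
structure IsTrialSystem (T : E →ₗ[ℝ] E) {q : ℕ} (φ : Fin q → E) (Λ : Fin q → ℝ)
    (W : Submodule ℝ E) (l ε : ℝ) : Prop where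
  norm_eq : ∀ i, ‖φ i‖ = 1
  inner_le : ∀ i j, i ≠ j → |inner ℝ (φ i) (φ j)| ≤ ε
  form_eq_zero : ∀ i j, i ≠ j → inner ℝ (T (φ i)) (φ j) = 0
  form_self : ∀ i, inner ℝ (T (φ i)) (φ i) = Λ i
  form_mem : ∀ i, ∀ w ∈ W, inner ℝ (T (φ i)) w = 0
  coercive : ∀ w ∈ W, l * ‖w‖ ^ 2 ≤ inner ℝ (T w) w
  exists_sub_mem : ∀ f, ∃ c : Fin q → ℝ, f - ∑ i, c i • φ i ∈ W
  pos : ∀ i, 0 < Λ i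
  sep : ∀ i j, i < j → Λ i ≤ ε * Λ j
  le : ∀ i, Λ i ≤ ε * l
  l_pos : 0 < l
  eps_pos : 0 < ε
  q_pos : 0 < q
  small : 48 * q ^ 2 * ε < 1

namespace IsTrialSystem

variable {T : E →ₗ[ℝ] E} {q : ℕ} {φ : Fin q → E} {Λ : Fin q → ℝ} {W : Submodule ℝ E} {l ε : ℝ}

lemma one_le_q (h : IsTrialSystem T φ Λ W l ε) : (1 : ℝ) ≤ q := by
  exact_mod_cast h.q_pos

lemma q_mul_eps_le (h : IsTrialSystem T φ Λ W l ε) : q * ε ≤ 1 / 48 := by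
  nlinarith [h.one_le_q, h.small, h.eps_pos, mul_le_mul_of_nonneg_right h.one_le_q h.eps_pos.le]

lemma eps_le (h : IsTrialSystem T φ Λ W l ε) : ε ≤ 1 / 48 := by
  nlinarith [h.one_le_q, h.q_mul_eps_le, h.eps_pos]

/-- The Gram matrix has unit diagonal and off-diagonal entries at most `ε`, so it differs from the
identity by at most `q ε ≤ 1/48` as a quadratic form. -/
lemma half_sum_sq_le (h : IsTrialSystem T φ Λ W l ε) (c : Fin q → ℝ) :
    (1 / 2) * ∑ i, c i ^ 2 ≤ ‖∑ i, c i • φ i‖ ^ 2 := by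
  have h1 : ‖∑ i, c i • φ i‖ ^ 2 = ∑ i, ∑ j, c i * c j * inner ℝ (φ i) (φ j) := by
    rw [← real_inner_self_eq_norm_sq, sum_inner]
    refine Finset.sum_congr rfl fun i _ => ?_
    rw [inner_sum]
    refine Finset.sum_congr rfl fun j _ => ?_
    rw [real_inner_smul_left, real_inner_smul_right]; ring
  have h2 : ∀ i j, (if i = j then c i ^ 2 else 0) - ε * (|c i| * |c j|)
      ≤ c i * c j * inner ℝ (φ i) (φ j) := by
    intro i j
    have h0 := mul_nonneg h.eps_pos.le (mul_nonneg (abs_nonneg (c i)) (abs_nonneg (c j)))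
    split_ifs with hij
    · subst hij
      rw [real_inner_self_eq_norm_sq, h.norm_eq]
      nlinarith
    · have h3 := neg_abs_le (c i * c j * inner ℝ (φ i) (φ j))
      rw [abs_mul, abs_mul] at h3
      have h4 := mul_le_mul_of_nonneg_left (h.inner_le i j hij)
        (mul_nonneg (abs_nonneg (c i)) (abs_nonneg (c j)))
      linarith
  have h3 := Finset.sum_le_sum fun i (_ : i ∈ Finset.univ) =>
    Finset.sum_le_sum fun j (_ : j ∈ Finset.univ) => h2 i j
  simp only [Finset.sum_sub_distrib, Finset.sum_ite_eq, Finset.mem_univ, if_true,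
    ← Finset.mul_sum, ← Finset.sum_mul] at h3
  have h4 : (∑ i, |c i|) ^ 2 ≤ q * ∑ i, c i ^ 2 := by
    have := sq_sum_le_card_mul_sum_sq (s := (Finset.univ : Finset (Fin q))) (f := fun i => |c i|)
    simpa using this
  have h5 : 0 ≤ ∑ i, c i ^ 2 := Finset.sum_nonneg fun i _ => sq_nonneg _
  rw [h1]
  nlinarith [h.q_mul_eps_le, h.eps_pos, mul_le_mul_of_nonneg_left h4 h.eps_pos.le,
    mul_le_mul_of_nonneg_right h.q_mul_eps_le h5]

lemma inner_map_sum (h : IsTrialSystem T φ Λ W l ε) (c : Fin q → ℝ) (k : Fin q) :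
    inner ℝ (T (φ k)) (∑ i, c i • φ i) = c k * Λ k := by
  rw [inner_sum, Finset.sum_eq_single k]
  · rw [real_inner_smul_right, h.form_self]
  · intro j _ hj
    rw [real_inner_smul_right, h.form_eq_zero k j hj.symm, mul_zero]
  · simp

/-- The form is diagonal on the span of the `φ i` with entries at most `ε l`; the factor 2 pays for
the missing orthonormality. -/
lemma form_sum_le (h : IsTrialSystem T φ Λ W l ε) (c : Fin q → ℝ) :
    inner ℝ (T (∑ i, c i • φ i)) (∑ i, c i • φ i) ≤ 2 * ε * l * ‖∑ i, c i • φ i‖ ^ 2 := by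
  have h1 : inner ℝ (T (∑ i, c i • φ i)) (∑ i, c i • φ i) = ∑ i, c i ^ 2 * Λ i := by
    conv_lhs => rw [map_sum, sum_inner]
    refine Finset.sum_congr rfl fun i _ => ?_
    rw [map_smul, real_inner_smul_left, h.inner_map_sum]; ring
  have h2 : ∑ i, c i ^ 2 * Λ i ≤ (∑ i, c i ^ 2) * (ε * l) := by
    rw [Finset.sum_mul]
    exact Finset.sum_le_sum fun i _ => mul_le_mul_of_nonneg_left (h.le i) (sq_nonneg _)
  have h3 := h.half_sum_sq_le c
  have h4 := mul_pos h.eps_pos h.l_pos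
  rw [h1]
  nlinarith

variable {ι : Type*} [Fintype ι] {b : OrthonormalBasis ι ℝ E} {e : ι → ℝ}

lemma form_eq_sum (hb : ∀ i, T (b i) = e i • b i) (f : E) :
    inner ℝ (T f) f = ∑ i, e i * inner ℝ (b i) f ^ 2 := by
  have h1 : T f = ∑ i, inner ℝ (b i) f • e i • b i := by
    conv_lhs => rw [← b.sum_repr' f, map_sum]
    exact Finset.sum_congr rfl fun i _ => by rw [map_smul, hb]
  rw [h1, sum_inner]
  refine Finset.sum_congr rfl fun i _ => ?_
  rw [real_inner_smul_left, real_inner_smul_left]; ring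

lemma norm_sq_eq_sum (f : E) : ‖f‖ ^ 2 = ∑ i, inner ℝ (b i) f ^ 2 := by
  rw [← b.sum_sq_norm_inner_right f]
  simp

/-- Min-max from above. With fewer such eigenvalues, dimension counting gives a nonzero combination
of the `φ i` orthogonal to all their eigenvectors; its Rayleigh quotient would exceed `2 ε l`. -/
lemma le_card (h : IsTrialSystem T φ Λ W l ε) (hb : ∀ i, T (b i) = e i • b i) :
    q ≤ Fintype.card {i // e i ≤ 2 * ε * l} := by
  by_contra! hlt
  let F : (Fin q → ℝ) →ₗ[ℝ] ({i // e i ≤ 2 * ε * l} → ℝ) :=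
    LinearMap.pi fun i => (innerₛₗ ℝ (b i)) ∘ₗ (Fintype.linearCombination ℝ φ)
  have hker : LinearMap.ker F ≠ ⊥ := LinearMap.ker_ne_bot_of_finrank_lt (by simpa using hlt)
  obtain ⟨c, hc, hc0⟩ := Submodule.exists_mem_ne_zero_of_ne_bot hker
  set f := ∑ i, c i • φ i with hf
  have hFc : ∀ i, e i ≤ 2 * ε * l → inner ℝ (b i) f = 0 := fun i hi => by
    have := congrFun (LinearMap.mem_ker.1 hc) ⟨i, hi⟩
    simpa [F, Fintype.linearCombination_apply] using this
  have h1 := h.form_sum_le c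
  rw [← hf, form_eq_sum hb, norm_sq_eq_sum (b := b), Finset.mul_sum] at h1
  have h2 : ∀ i ∈ Finset.univ, 2 * ε * l * inner ℝ (b i) f ^ 2 ≤ e i * inner ℝ (b i) f ^ 2 := by
    intro i _
    rcases le_or_gt (e i) (2 * ε * l) with hi | hi
    · rw [hFc i hi]; simp
    · exact mul_le_mul_of_nonneg_right hi.le (sq_nonneg _)
  have h3 := (Finset.sum_eq_sum_iff_of_le h2).1 (le_antisymm (Finset.sum_le_sum h2) h1)
  have h4 : ‖f‖ ^ 2 = 0 := by
    rw [norm_sq_eq_sum (b := b)]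
    refine Finset.sum_eq_zero fun i hi => ?_
    rcases le_or_gt (e i) (2 * ε * l) with hi' | hi'
    · rw [hFc i hi']; simp
    · have := h3 i hi
      by_contra hne
      exact hi'.ne (mul_right_cancel₀ hne this)
  have h5 := h.half_sum_sq_le c
  rw [← hf, h4] at h5
  refine hc0 (funext fun i => ?_)
  have h6 := Finset.single_le_sum (f := fun i => c i ^ 2) (fun i _ => sq_nonneg _)
    (Finset.mem_univ i)
  have h7 : c i ^ 2 ≤ 0 := by beta_reduce at h6; linarith
  simpa using h7

/-- Min-max from below. With more such eigenvalues, some nonzero combination of their eigenvectors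
is form-orthogonal to every `φ k`, hence lies in `W`, where the Rayleigh quotient is at least `l`.
-/
lemma card_le (h : IsTrialSystem T φ Λ W l ε) (hb : ∀ i, T (b i) = e i • b i) :
    Fintype.card {i // e i < l} ≤ q := by
  by_contra! hlt
  let F : ({i // e i < l} → ℝ) →ₗ[ℝ] (Fin q → ℝ) :=
    LinearMap.pi fun k => (innerₛₗ ℝ (T (φ k))) ∘ₗ
      (Fintype.linearCombination ℝ fun i : {i // e i < l} => b i)
  have hker : LinearMap.ker F ≠ ⊥ := LinearMap.ker_ne_bot_of_finrank_lt (by simpa using hlt)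
  obtain ⟨a, ha, ha0⟩ := Submodule.exists_mem_ne_zero_of_ne_bot hker
  set f := ∑ i, a i • b i with hf
  have hFa : ∀ k, inner ℝ (T (φ k)) f = 0 := fun k => by
    have := congrFun (LinearMap.mem_ker.1 ha) k
    simpa [F, Fintype.linearCombination_apply] using this
  -- Pairing the decomposition of `f` with `T (φ k)` gives `c k * Λ k = 0`, and `Λ k > 0`.
  have hfW : f ∈ W := by
    obtain ⟨c, hc⟩ := h.exists_sub_mem f
    have : ∀ k, c k = 0 := fun k => by
      have h1 := h.form_mem k _ hc
      rw [inner_sub_right, hFa, h.inner_map_sum, zero_sub, neg_eq_zero] at h1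
      exact (mul_eq_zero.1 h1).resolve_right (h.pos k).ne'
    simpa [this] using hc
  have hbf : ∀ i : {i // e i < l}, inner ℝ (b i) f = a i := fun i => by
    rw [hf, inner_sum, Finset.sum_eq_single i]
    · rw [real_inner_smul_right, real_inner_self_eq_norm_sq, b.norm_eq_one]; simp
    · intro j _ hj
      rw [real_inner_smul_right, b.inner_eq_zero (by simpa [Subtype.ext_iff] using hj.symm),
        mul_zero]
    · simp
  have hbf' : ∀ i, ¬ e i < l → inner ℝ (b i) f = 0 := fun i hi => by
    rw [hf, inner_sum]
    refine Finset.sum_eq_zero fun j _ => ?_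
    rw [real_inner_smul_right, b.inner_eq_zero (i := i) (fun hij => hi (by rw [hij]; exact j.2)), mul_zero]
  have h1 := h.coercive f hfW
  rw [form_eq_sum hb, norm_sq_eq_sum (b := b), Finset.mul_sum] at h1
  have h2 : ∀ i ∈ Finset.univ, e i * inner ℝ (b i) f ^ 2 ≤ l * inner ℝ (b i) f ^ 2 := by
    intro i _
    by_cases hi : e i < l
    · exact mul_le_mul_of_nonneg_right hi.le (sq_nonneg _)
    · rw [hbf' i hi]; simp
  have h3 := (Finset.sum_eq_sum_iff_of_le h2).1 (le_antisymm (Finset.sum_le_sum h2) h1)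
  refine ha0 (funext fun i => ?_)
  have h4 := h3 i (Finset.mem_univ _)
  rw [hbf] at h4
  by_contra hne
  exact i.2.ne (mul_right_cancel₀ (pow_ne_zero 2 hne) h4)

/-- An eigenvector with small eigenvalue is close to one of the trial vectors. -/
lemma exists_close (h : IsTrialSystem T φ Λ W l ε) (hT : T.IsSymmetric) {u : E} {r : ℝ}
    (hu : ‖u‖ = 1) (hr : T u = r • u) (hrl : r ≤ 2 * ε * l) :
    ∃ k, |r - Λ k| ≤ 20 * q ^ 2 * ε * Λ k ∧
      ∃ σ : ℝ, |σ| = 1 ∧ ‖σ • u - φ k‖ ≤ 24 * q ^ 2 * ε := by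
  have hq := h.one_le_q
  have hε := h.eps_pos
  have hqε := h.q_mul_eps_le
  have hε' := h.eps_le
  have hl := h.l_pos
  have hsmall := h.small
  have hqq : (q : ℝ) ≤ q ^ 2 := by nlinarith
  have hqqε : q * ε ≤ q ^ 2 * ε := mul_le_mul_of_nonneg_right hqq hε.le
  have hεq : ε ≤ q * ε := le_mul_of_one_le_left hε.le hq
  obtain ⟨c, hw⟩ := h.exists_sub_mem u
  set v := ∑ i, c i • φ i with hv
  set w := u - v with hw_def
  have huvw : u = v + w := by simp [hw_def]
  have hvw : inner ℝ (T v) w = 0 := by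
    rw [hv, map_sum, sum_inner]
    refine Finset.sum_eq_zero fun i _ => ?_
    rw [map_smul, real_inner_smul_left, h.form_mem i w hw, mul_zero]
  have hTw : inner ℝ (T u) w = inner ℝ (T w) w := by
    conv_lhs => rw [huvw, map_add, inner_add_left, hvw, zero_add]
  -- The eigenvalue is `∑ c i ^ 2 * Λ i + ⟨T w, w⟩`, a sum of nonnegative terms; if it were not
  -- positive, all `c i` and `w` would vanish.
  have hr0 : 0 < r := by
    have h1 : inner ℝ (T u) u = r := by
      rw [hr, real_inner_smul_left, real_inner_self_eq_norm_sq, hu]; ring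
    have h2 : inner ℝ (T u) v = ∑ i, c i ^ 2 * Λ i := by
      rw [hT, huvw, inner_add_left, ← hT w v, real_inner_comm v (T w), ← hT v w, hvw, add_zero,
        ← hT v v]
      conv_lhs => rw [hv, map_sum, sum_inner]
      refine Finset.sum_congr rfl fun i _ => ?_
      rw [map_smul, real_inner_smul_left, ← hv, hv, h.inner_map_sum]; ring
    have h3 : r = ∑ i, c i ^ 2 * Λ i + inner ℝ (T w) w := by
      rw [← h1, ← h2, ← hTw, ← inner_add_right, ← huvw]
    have h4 : 0 ≤ ∑ i, c i ^ 2 * Λ i :=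
      Finset.sum_nonneg fun i _ => mul_nonneg (sq_nonneg _) (h.pos i).le
    have h5 := h.coercive w hw
    have h6 : 0 ≤ l * ‖w‖ ^ 2 := by positivity
    by_contra hneg
    have h7 : ‖w‖ ^ 2 = 0 := by
      have : l * ‖w‖ ^ 2 = 0 := by linarith
      exact (mul_eq_zero.1 this).resolve_left hl.ne'
    have h8 : ∑ i, c i ^ 2 * Λ i = 0 := by linarith
    have h9 : ∀ i, c i = 0 := fun i => by
      have := (Finset.sum_eq_zero_iff_of_nonneg
        (fun i _ => mul_nonneg (sq_nonneg _) (h.pos i).le)).1 h8 i (Finset.mem_univ _)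
      simpa [(h.pos i).ne'] using this
    have h10 : u = 0 := by
      have hw0 : w = 0 := by simpa using h7
      rw [huvw, hw0, hv]; simp [h9]
    rw [h10, norm_zero] at hu
    exact zero_ne_one hu
  -- `l ‖w‖² ≤ ⟨T w, w⟩ = ⟨T u, w⟩ = r ⟨u, w⟩ ≤ r ‖w‖`, and `r ≤ 2 ε l`.
  have hw2 : ‖w‖ ≤ 2 * ε := by
    have h1 := h.coercive w hw
    rw [← hTw, hr, real_inner_smul_left] at h1
    have h2 := real_inner_le_norm u w
    rw [hu, one_mul] at h2
    have h3 : l * ‖w‖ ^ 2 ≤ r * ‖w‖ := h1.trans (mul_le_mul_of_nonneg_left h2 hr0.le)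
    by_contra! hlt
    have h4 : 0 < ‖w‖ := lt_trans (by positivity) hlt
    have h5 : l * ‖w‖ ≤ r := by
      rw [pow_two, ← mul_assoc] at h3
      exact le_of_mul_le_mul_right h3 h4
    nlinarith
  have hvn : ‖v‖ ≤ 1 + 2 * ε := by
    have : v = u - w := by simp [hw_def]
    rw [this]
    exact (norm_sub_le _ _).trans (by linarith)
  have hvn' : 1 - 2 * ε ≤ ‖v‖ := by
    have h1 : ‖u‖ ≤ ‖v‖ + ‖w‖ := by
      conv_lhs => rw [huvw]
      exact norm_add_le _ _
    linarith
  -- Here `c i ^ 2 ≤ 2 ‖v‖² ≤ 8`, because `‖v‖ ≤ 2`.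
  have hc3 : ∀ i, |c i| ≤ 3 := fun i => by
    have h1 := h.half_sum_sq_le c
    have h2 := Finset.single_le_sum (f := fun i => c i ^ 2) (fun i _ => sq_nonneg _)
      (Finset.mem_univ i)
    have h3 : ‖v‖ ^ 2 ≤ 2 ^ 2 := pow_le_pow_left₀ (norm_nonneg _) (by linarith) 2
    rw [← hv] at h1
    refine abs_le_of_sq_le_sq ?_ (by norm_num)
    linarith
  have hsum3 : ∑ i, |c i| ≤ 3 * q := by
    have := Finset.sum_le_card_nsmul Finset.univ (fun i => |c i|) 3 fun i _ => hc3 i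
    simpa [mul_comm] using this
  -- Pair `T u = r u` with `φ k`: form-orthogonality leaves `c k * Λ k` on one side, and on the
  -- other `r` times `c k` plus overlap errors `3 q ε` from the other `φ j` and `2 ε` from `w`.
  have hres : ∀ k, |c k| * |Λ k - r| ≤ 5 * q * ε * r := by
    intro k
    have h1 : inner ℝ (T u) (φ k) = c k * Λ k := by
      rw [hT, real_inner_comm, huvw, inner_add_right, h.form_mem k w hw, add_zero, hv,
        h.inner_map_sum]
    rw [hr, real_inner_smul_left, huvw, inner_add_left, hv, sum_inner,
      ← Finset.add_sum_erase _ _ (Finset.mem_univ k)] at h1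
    simp only [real_inner_smul_left, real_inner_self_eq_norm_sq, h.norm_eq, one_pow,
      mul_one] at h1
    set X := ∑ j ∈ Finset.univ.erase k, c j * inner ℝ (φ j) (φ k) with hX
    have hXle : |X| ≤ 3 * q * ε := by
      refine (Finset.abs_sum_le_sum_abs _ _).trans ?_
      calc ∑ j ∈ Finset.univ.erase k, |c j * inner ℝ (φ j) (φ k)|
          ≤ ∑ j ∈ Finset.univ.erase k, |c j| * ε := Finset.sum_le_sum fun j hj => by
            rw [abs_mul]
            exact mul_le_mul_of_nonneg_left (h.inner_le j k (Finset.ne_of_mem_erase hj))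
              (abs_nonneg _)
        _ ≤ ∑ j, |c j| * ε := Finset.sum_le_sum_of_subset_of_nonneg (Finset.erase_subset _ _)
            fun j _ _ => mul_nonneg (abs_nonneg _) hε.le
        _ = (∑ j, |c j|) * ε := by rw [Finset.sum_mul]
        _ ≤ 3 * q * ε := mul_le_mul_of_nonneg_right hsum3 hε.le
    have hY : |inner ℝ w (φ k)| ≤ 2 * ε := by
      refine (abs_real_inner_le_norm _ _).trans ?_
      rw [h.norm_eq, mul_one]; exact hw2
    have h2 : c k * (Λ k - r) = r * (X + inner ℝ w (φ k)) := by linarith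
    rw [← abs_mul, h2, abs_mul, abs_of_pos hr0, mul_comm]
    refine mul_le_mul_of_nonneg_right ?_ hr0.le
    refine (abs_add_le _ _).trans ?_
    nlinarith
  -- Pigeonhole: otherwise `‖v‖ ≤ 1/2`, but `‖v‖ ≥ 1 - 2 ε`.
  obtain ⟨k, hk⟩ : ∃ k, 1 / (2 * q) ≤ |c k| := by
    by_contra! hall
    have h1 : ‖v‖ ≤ ∑ i, |c i| := by
      refine (norm_sum_le _ _).trans (le_of_eq (Finset.sum_congr rfl fun i _ => ?_))
      rw [norm_smul, h.norm_eq, mul_one, Real.norm_eq_abs]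
    have h2 := Finset.sum_le_card_nsmul Finset.univ (fun i => |c i|) (1 / (2 * q))
      fun i _ => (hall i).le
    have h3 : (Finset.univ : Finset (Fin q)).card • (1 / (2 * (q : ℝ))) = 1 / 2 := by
      rw [Finset.card_univ, Fintype.card_fin, nsmul_eq_mul]
      field_simp
    rw [h3] at h2
    linarith
  have hΛr : |Λ k - r| ≤ 10 * q ^ 2 * ε * r := by
    have h1 := (mul_le_mul_of_nonneg_right hk (abs_nonneg (Λ k - r))).trans (hres k)
    rw [div_mul_eq_mul_div, one_mul, div_le_iff₀ (by positivity)] at h1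
    linarith
  set ρ := q ^ 2 * ε with hρ
  have hρ' : ρ < 1 / 48 := by rw [hρ]; linarith
  have hΛr' : |Λ k - r| ≤ 10 * ρ * r := by rw [hρ, ← mul_assoc]; exact hΛr
  obtain ⟨hΛ1, hΛ2⟩ := abs_le.1 hΛr'
  -- Since `r` is close to `Λ k` and the `Λ j` are separated by factors of at least 48, every other
  -- `Λ j` is at distance at least `r / 2` from `r`; then `hres` makes `c j` small.
  have hoth : ∀ j, j ≠ k → |c j| ≤ 10 * (q * ε) := by
    intro j hj
    have hgap : r / 2 ≤ |Λ j - r| := by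
      rcases lt_or_gt_of_ne hj with hlt | hlt
      · have h1 := h.sep j k hlt
        have h2 : ε * Λ k ≤ 1 / 48 * Λ k := mul_le_mul_of_nonneg_right hε' (h.pos k).le
        have h3 : ρ * r ≤ 1 / 48 * r := mul_le_mul_of_nonneg_right hρ'.le hr0.le
        rw [abs_sub_comm]
        exact le_trans (by linarith) (le_abs_self _)
      · have h1 := h.sep k j hlt
        have h2 : ε * Λ j ≤ 1 / 48 * Λ j := mul_le_mul_of_nonneg_right hε' (h.pos j).le
        have h3 : ρ * r ≤ 1 / 48 * r := mul_le_mul_of_nonneg_right hρ'.le hr0.le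
        exact le_trans (by linarith) (le_abs_self _)
    have h1 := (mul_le_mul_of_nonneg_left hgap (abs_nonneg (c j))).trans (hres j)
    have h2 : |c j| / 2 * r ≤ 5 * (q * ε) * r := by linarith
    linarith [le_of_mul_le_mul_right h2 hr0]
  have hclose : ‖u - c k • φ k‖ ≤ 12 * ρ := by
    have h1 : u - c k • φ k = ∑ j ∈ Finset.univ.erase k, c j • φ j + w := by
      rw [huvw, hv, ← Finset.add_sum_erase _ _ (Finset.mem_univ k)]; abel
    have h2 : ‖∑ j ∈ Finset.univ.erase k, c j • φ j‖ ≤ 10 * ρ := by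
      calc ‖∑ j ∈ Finset.univ.erase k, c j • φ j‖ ≤ ∑ j ∈ Finset.univ.erase k, 10 * (q * ε) :=
            norm_sum_le_of_le _ fun j hj => by
              rw [norm_smul, h.norm_eq, mul_one, Real.norm_eq_abs]
              exact hoth j (Finset.ne_of_mem_erase hj)
        _ ≤ ∑ j : Fin q, 10 * (q * ε) := Finset.sum_le_sum_of_subset_of_nonneg
              (Finset.erase_subset _ _) fun j _ _ => by positivity
        _ = 10 * ρ := by
            rw [Finset.sum_const, Finset.card_univ, Fintype.card_fin, nsmul_eq_mul, hρ]; ring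
    rw [h1]
    refine (norm_add_le _ _).trans ?_
    linarith
  have hck : |(|c k| - 1)| ≤ 12 * ρ := by
    have h1 := abs_norm_sub_norm_le u (c k • φ k)
    rw [norm_smul, h.norm_eq, hu, mul_one, Real.norm_eq_abs, abs_sub_comm] at h1
    exact h1.trans hclose
  -- An eigenvector is determined up to sign; the sign of its dominant coefficient aligns it with `φ
  -- k`.
  refine ⟨k, ?_, SignType.sign (c k), ?_, ?_⟩
  · rw [abs_sub_comm]
    have h1 : ρ * r ≤ 2 * ρ * Λ k := by
      have h3 : ρ * r ≤ 1 / 48 * r := mul_le_mul_of_nonneg_right hρ'.le hr0.le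
      have hρ0 : 0 ≤ ρ := by rw [hρ]; positivity
      have h4 : r ≤ 2 * Λ k := by linarith
      nlinarith [mul_le_mul_of_nonneg_left h4 hρ0]
    calc |Λ k - r| ≤ 10 * ρ * r := hΛr'
      _ ≤ 20 * q ^ 2 * ε * Λ k := by rw [mul_assoc 20, ← hρ]; linarith
  · have : c k ≠ 0 := by
      intro h0
      rw [h0, abs_zero] at hk
      exact absurd hk (not_le.2 (by positivity))
    rcases lt_or_gt_of_ne this with h1 | h1
    · simp [sign_neg h1]
    · simp [sign_pos h1]
  · have hσ : ((SignType.sign (c k) : SignType) : ℝ) * c k = |c k| := sign_mul_self _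
    have hσ1 : |((SignType.sign (c k) : SignType) : ℝ)| ≤ 1 := by
      rcases lt_trichotomy (c k) 0 with h1 | h1 | h1
      · simp [sign_neg h1]
      · simp [h1]
      · simp [sign_pos h1]
    have h1 : ((SignType.sign (c k) : SignType) : ℝ) • u - φ k
        = ((SignType.sign (c k) : SignType) : ℝ) • (u - c k • φ k) + (|c k| - 1) • φ k := by
      rw [smul_sub, smul_smul, hσ, sub_smul, one_smul]; abel
    rw [h1]
    refine (norm_add_le _ _).trans ?_
    rw [norm_smul, norm_smul, h.norm_eq, mul_one, Real.norm_eq_abs, Real.norm_eq_abs]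
    have h2 := mul_le_mul hσ1 hclose (norm_nonneg _) zero_le_one
    calc _ ≤ 1 * (12 * ρ) + 12 * ρ := add_le_add h2 hck
      _ = 24 * q ^ 2 * ε := by rw [hρ]; ring

/-- The eigenvalues below `l` correspond to the trial vectors. -/
theorem exists_eigenvalues [FiniteDimensional ℝ E] (h : IsTrialSystem T φ Λ W l ε)
    (hT : T.IsSymmetric) :
    ∃ (lam : Fin q → ℝ) (ψ : Fin q → E), StrictMono lam ∧
      (∀ r, (r < l ∧ ∃ u, u ≠ 0 ∧ T u = r • u) ↔ r ∈ Set.range lam) ∧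
      ∀ k, |lam k - Λ k| ≤ 20 * q ^ 2 * ε * Λ k ∧ ‖ψ k‖ = 1 ∧ T (ψ k) = lam k • ψ k ∧
        ‖ψ k - φ k‖ ≤ 24 * q ^ 2 * ε := by
  have hε := h.eps_pos
  have hl := h.l_pos
  set b := hT.eigenvectorBasis rfl
  set e := hT.eigenvalues rfl
  have hb : ∀ i, T (b i) = e i • b i := fun i => hT.apply_eigenvectorBasis rfl i
  have hsub : ∀ i, e i ≤ 2 * ε * l → e i < l := fun i hi => by
    nlinarith [h.eps_le]
  have hcard : Fintype.card {i // e i < l} = q := by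
    refine le_antisymm (h.card_le hb) ((h.le_card hb).trans ?_)
    exact Fintype.card_subtype_mono _ _ hsub
  -- The two counts agree, so there is no eigenvalue strictly between `2 ε l` and `l`.
  have hsub' : ∀ i, e i < l → e i ≤ 2 * ε * l := by
    have h1 : (Finset.univ.filter fun i => e i ≤ 2 * ε * l)
        ⊆ Finset.univ.filter fun i => e i < l := by
      intro i
      simpa using hsub i
    have h2 := Finset.eq_of_subset_of_card_le h1 (by
      rw [← Fintype.card_subtype, ← Fintype.card_subtype, hcard]; exact h.le_card hb)
    intro i hi
    have : i ∈ Finset.univ.filter fun i => e i ≤ 2 * ε * l := by rw [h2]; simpa using hi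
    simpa using this
  choose κ hκ1 σ hσ hκ2 using fun i : {i // e i < l} =>
    h.exists_close hT (b.norm_eq_one i) (hb i) (hsub' i i.2)
  have hsmall := h.small
  -- Two orthonormal eigenvectors are at distance `√2` for any choice of signs, but would be at
  -- distance at most `2 * 24 q² ε < 1` if both were close to the same `φ k`. This is where the
  -- constant 48 in `small` comes from.
  have hinj : Function.Injective κ := by
    intro i j hij
    by_contra hne
    have h1 : ‖σ i • b i - σ j • b j‖ ^ 2 = 2 := by
      rw [norm_sub_sq_real, norm_smul, norm_smul, b.norm_eq_one, b.norm_eq_one,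
        real_inner_smul_left, real_inner_smul_right,
        b.inner_eq_zero (fun h0 => hne (Subtype.ext h0)), Real.norm_eq_abs, Real.norm_eq_abs,
        hσ, hσ]
      norm_num
    have h2 : ‖σ i • b i - σ j • b j‖ ≤ 1 := by
      have h3 : σ i • b i - σ j • b j = (σ i • b i - φ (κ i)) - (σ j • b j - φ (κ i)) := by abel
      rw [h3]
      refine (norm_sub_le _ _).trans ?_
      have h4 := hκ2 j
      rw [← hij] at h4
      linarith [hκ2 i]
    nlinarith [norm_nonneg (σ i • b i - σ j • b j)]
  have hbij : Function.Bijective κ :=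
    (Fintype.bijective_iff_injective_and_card κ).2 ⟨hinj, by rw [hcard, Fintype.card_fin]⟩
  let eqv := Equiv.ofBijective κ hbij
  have heq : ∀ k, κ (eqv.symm k) = k := fun k => eqv.apply_symm_apply k
  have hlam : ∀ k, |e (eqv.symm k) - Λ k| ≤ 20 * q ^ 2 * ε * Λ k := fun k => by
    have := hκ1 (eqv.symm k)
    rwa [heq] at this
  refine ⟨fun k => e (eqv.symm k), fun k => σ (eqv.symm k) • b (eqv.symm k), ?_, ?_, ?_⟩
  · intro j k hjk
    have h1 := abs_le.1 (hlam j)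
    have h2 := abs_le.1 (hlam k)
    have h3 := h.sep j k hjk
    have h4 := h.pos j
    have h5 := h.pos k
    have h6 : ε * Λ k ≤ 1 / 48 * Λ k := mul_le_mul_of_nonneg_right h.eps_le h5.le
    have h7 : q ^ 2 * ε * Λ j ≤ 1 / 48 * Λ j :=
      mul_le_mul_of_nonneg_right (by linarith) h4.le
    have h8 : q ^ 2 * ε * Λ k ≤ 1 / 48 * Λ k :=
      mul_le_mul_of_nonneg_right (by linarith) h5.le
    -- The relative errors are below `20/48`, much less than the separation by a factor 48.
    change e (eqv.symm j) < e (eqv.symm k)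
    linarith [h1.2, h2.1]
  · intro r
    constructor
    · rintro ⟨hrl, u, hu0, hu⟩
      -- An eigenvector overlaps with some member of the eigenbasis, and by symmetry the two
      -- eigenvalues agree.
      obtain ⟨i, hi⟩ : ∃ i, inner ℝ (b i) u ≠ 0 := by
        by_contra! hall
        refine hu0 ?_
        rw [← b.sum_repr' u]
        exact Finset.sum_eq_zero fun i _ => by rw [hall, zero_smul]
      have h1 : inner ℝ (T (b i)) u = inner ℝ (b i) (T u) := hT _ _
      rw [hb, hu, real_inner_smul_left, real_inner_smul_right] at h1
      have h2 : e i = r := mul_right_cancel₀ hi h1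
      refine ⟨κ ⟨i, h2 ▸ hrl⟩, ?_⟩
      have : eqv.symm (κ ⟨i, h2 ▸ hrl⟩) = ⟨i, h2 ▸ hrl⟩ := eqv.symm_apply_apply _
      simp only [this, h2]
    · rintro ⟨k, rfl⟩
      exact ⟨(eqv.symm k).2, b (eqv.symm k), b.orthonormal.ne_zero _, hb _⟩
  · intro k
    refine ⟨hlam k, ?_, ?_, ?_⟩
    · rw [norm_smul, b.norm_eq_one, mul_one, Real.norm_eq_abs, hσ]
    · rw [map_smul, hb, smul_comm]
    · have := hκ2 (eqv.symm k)
      rwa [heq] at this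

end IsTrialSystem

end Abstract

/-! ### From paths on `[-1, 1]` to the lattice -/

/-- Removes the infima from the definition of `barrier`. The minimum over the finite set `A` is
attained, and the set of saddles is a nonempty finite union of compact sets, so its infimum `zStar`
is itself a saddle. -/
lemma barrier_spec {γ : ℝ → ℝ} (hγ : ContinuousOn γ (Set.Icc (-1) 1)) {x : ℝ} {A : Set ℝ}
    (hx : x ∈ Set.Icc (-1 : ℝ) 1) (hA : A.Finite) (hne : A.Nonempty)
    (hsub : A ⊆ Set.Icc (-1) 1) :
    (∀ s ∈ A, γ x + barrier γ x A ≤ sSup (γ '' Set.uIcc x s)) ∧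
      ∃ s ∈ A, sSup (γ '' Set.uIcc x s) = γ x + barrier γ x A := by
  have hset : {m | ∃ a ∈ ({x} : Set ℝ), ∃ b ∈ A, m = sSup (γ '' Set.uIcc a b)}
      = (fun b => sSup (γ '' Set.uIcc x b)) '' A := by
    ext m
    simp only [Set.mem_singleton_iff, exists_eq_left, Set.mem_ofPred_eq, Set.mem_image,
      eq_comm (a := m)]
  have hfin : ((fun b => sSup (γ '' Set.uIcc x b)) '' A).Finite := hA.image _
  have hminMax : minMax γ {x} A ∈ (fun b => sSup (γ '' Set.uIcc x b)) '' A := by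
    rw [minMax, hset]
    exact (hne.image _).csInf_mem hfin
  have hcont : ∀ s ∈ A, ContinuousOn γ (Set.uIcc x s) := fun s hs =>
    hγ.mono (Set.uIcc_subset_Icc hx (hsub hs))
  have hz : zStar γ {x} A ∈ saddles γ {x} A := by
    have heq : saddles γ {x} A
        = ⋃ s ∈ A, (Set.uIcc x s ∩ γ ⁻¹' {minMax γ {x} A}) := by
      ext z
      simp only [saddles, Set.mem_singleton_iff, exists_eq_left, Set.mem_ofPred_eq,
        Set.mem_iUnion, Set.mem_inter_iff, Set.mem_preimage, exists_prop]
      constructor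
      · rintro ⟨⟨b, hb, h1⟩, h2⟩; exact ⟨b, hb, h1, h2⟩
      · rintro ⟨b, hb, h1, h2⟩; exact ⟨⟨b, hb, h1⟩, h2⟩
    have hcomp : IsCompact (saddles γ {x} A) := by
      rw [heq]
      refine hA.isCompact_biUnion fun s hs => ?_
      exact isCompact_uIcc.of_isClosed_subset
        ((hcont s hs).preimage_isClosed_of_isClosed isClosed_Icc isClosed_singleton)
        Set.inter_subset_left
    refine hcomp.sInf_mem ?_
    obtain ⟨s, hs, hs'⟩ := hminMax
    obtain ⟨z, hz, hz'⟩ := isCompact_uIcc.exists_sSup_image_eq Set.nonempty_uIcc (hcont s hs)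
    exact ⟨z, ⟨x, rfl, s, hs, hz⟩, by rw [← hz', ← hs']⟩
  have hb : γ x + barrier γ x A = minMax γ {x} A := by
    rw [barrier, hz.2]; ring
  rw [hb]
  refine ⟨fun s hs => ?_, ?_⟩
  · rw [minMax, hset]
    exact csInf_le hfin.bddBelow ⟨s, hs, rfl⟩
  · obtain ⟨s, hs, hs'⟩ := hminMax
    exact ⟨s, hs, hs'⟩

section
variable {ω : Environment} {N : ℕ}

lemma rescaledPotential_int (hN : 0 < N) (n : ℤ) :
    rescaledPotential ω N (n / N) = potential ω n / √N := by
  have hN' : (N : ℝ) ≠ 0 := by positivity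
  rw [rescaledPotential, mul_div_cancel₀ _ hN', Int.fract_intCast, Int.floor_intCast]
  simp

lemma rescaledPotential_affine (hN : 0 < N) {n : ℤ} {t : ℝ} (h1 : (n : ℝ) / N ≤ t)
    (h2 : t ≤ (n + 1 : ℤ) / N) :
    rescaledPotential ω N t
      = (potential ω n + (N * t - n) * (potential ω (n + 1) - potential ω n)) / √N := by
  have hN' : (0 : ℝ) < N := by positivity
  rw [div_le_iff₀' hN'] at h1
  rw [le_div_iff₀' hN'] at h2
  rcases eq_or_lt_of_le h2 with h3 | h3
  · have : t = (n + 1 : ℤ) / N := by rw [eq_div_iff hN'.ne', mul_comm]; exact h3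
    rw [h3, this, rescaledPotential_int hN]
    push_cast; ring
  · have hf : ⌊(N * t : ℝ)⌋ = n := Int.floor_eq_iff.2 ⟨h1, by push_cast at h3; exact h3⟩
    rw [rescaledPotential, Int.fract, hf]
    ring

lemma floor_bounds (hN : 0 < N) {a b : ℤ} {t : ℝ} (h1 : (a : ℝ) / N ≤ t) (h2 : t < (b : ℝ) / N) :
    ∃ n : ℤ, a ≤ n ∧ n + 1 ≤ b ∧ (n : ℝ) / N ≤ t ∧ t < (n + 1 : ℤ) / N := by
  have hN' : (0 : ℝ) < N := by positivity
  refine ⟨⌊(N * t : ℝ)⌋, ?_, ?_, ?_, ?_⟩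
  · rw [div_le_iff₀' hN'] at h1; exact Int.le_floor.2 h1
  · rw [lt_div_iff₀' hN'] at h2; exact Int.add_one_le_iff.2 (Int.floor_lt.2 h2)
  · rw [div_le_iff₀' hN']; exact Int.floor_le _
  · rw [lt_div_iff₀' hN']; push_cast; exact Int.lt_floor_add_one _

lemma exists_int_between (hN : 0 < N) {a b : ℤ} {t : ℝ} (h1 : (a : ℝ) / N ≤ t)
    (h2 : t ≤ (b : ℝ) / N) :
    (∃ z, a ≤ z ∧ z ≤ b ∧ potential ω z / √N ≤ rescaledPotential ω N t) ∧
      ∃ z, a ≤ z ∧ z ≤ b ∧ rescaledPotential ω N t ≤ potential ω z / √N := by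
  have hN' : (0 : ℝ) < N := by positivity
  have hs : (0 : ℝ) < √N := Real.sqrt_pos.2 hN'
  rcases eq_or_lt_of_le h2 with rfl | h2
  · rw [rescaledPotential_int hN]
    have hab : a ≤ b := by
      have := (div_le_div_iff_of_pos_right hN').1 h1
      exact_mod_cast this
    exact ⟨⟨b, hab, le_rfl, le_rfl⟩, b, hab, le_rfl, le_rfl⟩
  · obtain ⟨n, hn1, hn2, hn3, hn4⟩ := floor_bounds hN h1 h2
    rw [rescaledPotential_affine hN hn3 hn4.le]
    rw [div_le_iff₀' hN'] at hn3
    rw [lt_div_iff₀' hN'] at hn4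
    push_cast at hn4
    simp only [div_le_div_iff_of_pos_right hs]
    rcases le_total (potential ω n) (potential ω (n + 1)) with h | h
    · exact ⟨⟨n, hn1, by lia, by nlinarith⟩, n + 1, by lia, hn2, by nlinarith⟩
    · exact ⟨⟨n + 1, by lia, hn2, by nlinarith⟩, n, hn1, by lia, by nlinarith⟩

/-- On the last cell the right end has only the value `V(x)`; strictness comes from the positive
weight of the left end. -/
lemma lt_rescaledPotential (hN : 0 < N) {a x : ℤ} {t : ℝ} (h1 : (a : ℝ) / N ≤ t)
    (h2 : t < (x : ℝ) / N) (h : ∀ z, a ≤ z → z < x → potential ω x < potential ω z) :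
    rescaledPotential ω N (x / N) < rescaledPotential ω N t := by
  have hN' : (0 : ℝ) < N := by positivity
  have hs : (0 : ℝ) < √N := Real.sqrt_pos.2 hN'
  obtain ⟨n, hn1, hn2, hn3, hn4⟩ := floor_bounds hN h1 h2
  rw [rescaledPotential_affine hN hn3 hn4.le, rescaledPotential_int hN,
    div_lt_div_iff_of_pos_right hs]
  rw [div_le_iff₀' hN'] at hn3
  rw [lt_div_iff₀' hN'] at hn4
  push_cast at hn4
  have h3 := h n hn1 (by lia)
  have h4 : potential ω x ≤ potential ω (n + 1) := by
    rcases eq_or_lt_of_le hn2 with h5 | h5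
    · rw [h5]
    · exact (h _ (by lia) h5).le
  nlinarith

lemma mem_uIcc_div (hN : 0 < N) {a b z : ℤ} :
    (z / N : ℝ) ∈ Set.uIcc (a / N : ℝ) (b / N) ↔ z ∈ Set.uIcc a b := by
  have hN' : (0 : ℝ) < N := by positivity
  simp only [Set.mem_uIcc, div_le_div_iff_of_pos_right hN', Int.cast_le]

lemma sSup_rescaledPotential (hN : 0 < N) (a b : ℤ) :
    (∀ z ∈ Set.uIcc a b, potential ω z / √N
        ≤ sSup (rescaledPotential ω N '' Set.uIcc (a / N) (b / N))) ∧
      ∃ z ∈ Set.uIcc a b, sSup (rescaledPotential ω N '' Set.uIcc (a / N) (b / N))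
        ≤ potential ω z / √N := by
  have hN' : (0 : ℝ) < N := by positivity
  have hs : (0 : ℝ) < √N := Real.sqrt_pos.2 hN'
  obtain ⟨z, hz, hmax⟩ := Finset.exists_max_image (Finset.uIcc a b) (potential ω)
    Finset.nonempty_uIcc
  have hub : ∀ y ∈ rescaledPotential ω N '' Set.uIcc (a / N : ℝ) (b / N),
      y ≤ potential ω z / √N := by
    rintro _ ⟨t, ht, rfl⟩
    have hmono : Monotone fun n : ℤ => (n / N : ℝ) := fun i j hij =>
      (div_le_div_iff_of_pos_right hN').2 (Int.cast_le.2 hij)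
    have h1 : ((a ⊓ b : ℤ) / N : ℝ) ≤ t := by
      have := ht.1
      rwa [← hmono.map_inf] at this
    have h2 : t ≤ ((a ⊔ b : ℤ) / N : ℝ) := by
      have := ht.2
      rwa [← hmono.map_sup] at this
    obtain ⟨-, w, hw1, hw2, hw⟩ := exists_int_between (ω := ω) hN h1 h2
    refine hw.trans ((div_le_div_iff_of_pos_right hs).2 (hmax w ?_))
    rw [Finset.uIcc, Finset.mem_Icc]; exact ⟨hw1, hw2⟩
  refine ⟨fun y hy => ?_, z, by rwa [← Finset.coe_uIcc], csSup_le (Set.nonempty_uIcc.image _) hub⟩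
  rw [← rescaledPotential_int hN]
  exact le_csSup ⟨_, hub⟩ ⟨_, (mem_uIcc_div hN).2 hy, rfl⟩

/-- The points of `M_h^-` are lattice points in the interior. -/
lemma exists_int_of_mem_hMinima (hN : 0 < N) {h : ℝ} (hh : 0 < h) {x : ℝ}
    (hx : x ∈ hMinima h (rescaledPotential ω N)) :
    ∃ n : ℤ, x = n / N ∧ -(N : ℤ) < n ∧ n < N := by
  have hN' : (0 : ℝ) < N := by positivity
  have hs : (0 : ℝ) < √N := Real.sqrt_pos.2 hN'
  obtain ⟨⟨a, b, ha, hax, hxb, hb, hγa, hγb, hmin⟩, hleft⟩ := hx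
  set γ := rescaledPotential ω N with hγ
  set n := ⌊(N * x : ℝ)⌋ with hn
  have hn1 : (n / N : ℝ) ≤ x := by rw [div_le_iff₀' hN']; exact Int.floor_le _
  have hn2 : x < (n + 1 : ℤ) / N := by
    rw [lt_div_iff₀' hN']; push_cast; exact Int.lt_floor_add_one _
  have hxn : x = n / N := by
    by_contra hne
    have hlt : (n / N : ℝ) < x := lt_of_le_of_ne hn1 (Ne.symm hne)
    have haff : ∀ t, (n / N : ℝ) ≤ t → t ≤ (n + 1 : ℤ) / N → γ t
        = (potential ω n + (N * t - n) * (potential ω (n + 1) - potential ω n)) / √N :=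
      fun t h1 h2 => rescaledPotential_affine hN h1 h2
    have hdiff : ∀ t, (n / N : ℝ) ≤ t → t ≤ (n + 1 : ℤ) / N → γ t - γ x
        = (t - x) * (N * (potential ω (n + 1) - potential ω n) / √N) := fun t h1 h2 => by
      rw [haff t h1 h2, haff x hn1 hn2.le]; ring
    set s := N * (potential ω (n + 1) - potential ω n) / √N with hs_def
    -- If `x` is interior to a cell, where the path is affine, then minimality against a point on
    -- each side, inside both the cell and `[a, b]`, makes the slope vanish.
    have hs0 : s = 0 := by
      refine le_antisymm ?_ ?_
      · have h1 : max a (n / N) < x := max_lt hax hlt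
        have h2 := hdiff (max a (n / N)) (le_max_right _ _) (h1.le.trans hn2.le)
        have h3 := hmin (max a (n / N)) ⟨le_max_left _ _, h1.le.trans hxb.le⟩
        nlinarith
      · have h1 : x < min b ((n + 1 : ℤ) / N) := lt_min hxb hn2
        have h2 := hdiff (min b ((n + 1 : ℤ) / N)) (hn1.trans h1.le) (min_le_right _ _)
        have h3 := hmin (min b ((n + 1 : ℤ) / N)) ⟨hax.le.trans h1.le, min_le_left _ _⟩
        nlinarith
    have hflat : ∀ t, (n / N : ℝ) ≤ t → t ≤ (n + 1 : ℤ) / N → γ t = γ x := fun t h1 h2 => by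
      have := hdiff t h1 h2
      rw [hs0, mul_zero] at this
      linarith
    -- The wall `a` is at least `h` higher, so it is off the flat piece. The same walls then make `n
    -- / N` an equivalent h-minimum to the left of `x`.
    have han : a < n / N := by
      by_contra! hle
      have := hflat a hle (hax.le.trans hn2.le)
      linarith
    have hγn := hflat (n / N) le_rfl (hlt.le.trans hn2.le)
    have h1 : IsHMin h γ (n / N) :=
      ⟨a, b, ha, han, hlt.trans hxb, hb, by rwa [hγn], by rwa [hγn], by rwa [hγn]⟩
    refine absurd (hleft _ h1 fun z hz => ?_) (not_le.2 hlt)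
    rw [Set.uIcc_of_ge hlt.le] at hz
    rw [hflat z hz.1 (hz.2.trans hn2.le), sub_self, abs_zero]
    exact hh
  refine ⟨n, hxn, ?_, ?_⟩
  · have h1 : (-1 : ℝ) < n / N := by linarith
    rw [lt_div_iff₀ hN'] at h1
    have : (-(N : ℤ) : ℝ) < n := by push_cast; linarith
    exact_mod_cast this
  · have h1 : (n / N : ℝ) < 1 := by linarith
    rw [div_lt_iff₀ hN'] at h1
    have : (n : ℝ) < (N : ℤ) := by push_cast; linarith
    exact_mod_cast this

/-- Every site is connected, below the level `V(y) + h`, to a lower point of `M_h^-` or to the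
boundary. -/
lemma exists_hMinima_below (hN : 0 < N) {h : ℝ} (hh : 0 < h) {y : ℤ} (hy : -(N : ℤ) < y)
    (hy' : y < N) :
    (∃ n : ℤ, (n / N : ℝ) ∈ hMinima h (rescaledPotential ω N) ∧ potential ω n ≤ potential ω y ∧
        ∀ z ∈ Set.uIcc y n, potential ω z ≤ potential ω y + h * √N) ∨
      (∀ z ∈ Set.uIcc y N, potential ω z ≤ potential ω y + h * √N) ∨
      (∀ z ∈ Set.uIcc y (-N), potential ω z ≤ potential ω y + h * √N) := by
  have hN' : (0 : ℝ) < N := by positivity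
  have hs : (0 : ℝ) < √N := Real.sqrt_pos.2 hN'
  set V := potential ω with hV
  by_contra! hcon
  obtain ⟨hcon, ⟨b1, hb1, hb1'⟩, a1, ha1, ha1'⟩ := hcon
  rw [Set.uIcc_of_le hy'.le] at hb1
  rw [Set.uIcc_of_ge hy.le] at ha1
  -- `b` and `a` are the nearest sites to the right and left of `y` above the level `V(y) + h√N`.
  obtain ⟨b, hb, hbmin⟩ := Finset.exists_min_image
    ((Finset.Icc y N).filter fun z => V y + h * √N < V z) id
    ⟨b1, by simp only [Finset.mem_filter, Finset.mem_Icc]; exact ⟨hb1, hb1'⟩⟩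
  obtain ⟨a, ha, hamax⟩ := Finset.exists_max_image
    ((Finset.Icc (-(N : ℤ)) y).filter fun z => V y + h * √N < V z) id
    ⟨a1, by simp only [Finset.mem_filter, Finset.mem_Icc]; exact ⟨ha1, ha1'⟩⟩
  simp only [Finset.mem_filter, Finset.mem_Icc, id, and_imp] at hb ha hbmin hamax
  -- The candidate is the leftmost minimizer `x` of `V` between the walls; being leftmost makes it
  -- the smallest of its class.
  obtain ⟨w, hw, hwmin⟩ := Finset.exists_min_image (Finset.Icc a b) V ⟨y, by
    rw [Finset.mem_Icc]; exact ⟨ha.1.2, hb.1.1⟩⟩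
  obtain ⟨x, hx, hxmin⟩ := Finset.exists_min_image
    ((Finset.Icc a b).filter fun z => V z = V w) id ⟨w, by simpa using hw⟩
  simp only [Finset.mem_filter, Finset.mem_Icc, id, and_imp] at hw hwmin hx hxmin
  have hxle : ∀ z, a ≤ z → z ≤ b → V x ≤ V z := fun z h1 h2 => hx.2 ▸ hwmin z h1 h2
  have hxlt : ∀ z, a ≤ z → z < x → V x < V z := fun z h1 h2 =>
    lt_of_le_of_ne (hxle z h1 (by lia)) fun heq =>
      absurd (hxmin z h1 (by lia) (heq.symm.trans hx.2)) (by lia)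
  have hxy : V x ≤ V y := hxle y ha.1.2 hb.1.1
  have hxa : V x + h * √N < V a := by linarith [ha.2]
  have hxb : V x + h * √N < V b := by linarith [hb.2]
  have hbelow : ∀ z, a < z → z < b → V z ≤ V y + h * √N := by
    intro z h1 h2
    by_contra! h3
    rcases le_total z y with h4 | h4
    · exact absurd (hamax z (by lia) h4 h3) (by lia)
    · exact absurd (hbmin z h4 (by lia) h3) (by lia)
  have hhs : 0 < h * √N := by positivity
  have hxa' : a < x := lt_of_le_of_ne hx.1.1 (by rintro rfl; linarith)
  have hxb' : x < b := lt_of_le_of_ne hx.1.2 (by rintro rfl; linarith)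
  have hcast : ∀ {i j : ℤ}, i < j → (i / N : ℝ) < j / N := fun hij =>
    (div_lt_div_iff_of_pos_right hN').2 (Int.cast_lt.2 hij)
  have hγint := fun n : ℤ => rescaledPotential_int (ω := ω) hN n
  set γ := rescaledPotential ω N with hγ
  have hheight : ∀ {c : ℤ}, V x + h * √N < V c → γ (x / N) + h ≤ γ (c / N) := fun {c} hc => by
    rw [hγint, hγint, div_add' _ _ _ hs.ne']
    exact (div_le_div_iff_of_pos_right hs).2 hc.le
  have hγle : ∀ t, (a / N : ℝ) ≤ t → t ≤ b / N → γ (x / N) ≤ γ t := fun t h1 h2 => by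
    obtain ⟨⟨z, hz1, hz2, hz⟩, -⟩ := exists_int_between (ω := ω) hN h1 h2
    refine le_trans ?_ hz
    rw [hγint]
    exact (div_le_div_iff_of_pos_right hs).2 (hxle z hz1 hz2)
  have hmin : IsHMin h γ (x / N) := by
    refine ⟨a / N, b / N, ?_, hcast hxa', hcast hxb', ?_, hheight hxa, hheight hxb,
      fun z hz => hγle z hz.1 hz.2⟩
    · rw [le_div_iff₀ hN', neg_one_mul]; exact_mod_cast ha.1.1
    · rw [div_le_iff₀ hN', one_mul]; exact_mod_cast hb.1.2
  -- A smaller equivalent `y'` lies right of `a`, since `a` breaks the equivalence; so it is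
  -- strictly higher than `x`. Its right wall is then either beyond `x`, against its minimality, or
  -- before `x` and more than `h` above `x`, against the equivalence.
  have hleft : ∀ y', IsHMin h γ y' → HEquiv h γ (x / N) y' → (x / N : ℝ) ≤ y' := by
    intro y' hy' heq
    by_contra! hlt
    have hay : (a / N : ℝ) < y' := by
      by_contra! hle
      have h1 := heq (a / N) (by
        rw [Set.uIcc_of_ge hlt.le]; exact ⟨hle, (hcast hxa').le⟩)
      have h2 := hheight hxa
      rw [abs_lt] at h1
      linarith
    have h1 : γ (x / N) < γ y' := lt_rescaledPotential hN hay.le hlt hxlt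
    obtain ⟨a', b', -, ha', hb', -, -, h2, h3⟩ := hy'
    rcases le_or_gt (x / N : ℝ) b' with h4 | h4
    · exact absurd (h3 (x / N) ⟨(ha'.trans hlt).le, h4⟩) (not_le.2 h1)
    · have h5 := heq b' (by rw [Set.uIcc_of_ge hlt.le]; exact ⟨hb'.le, h4.le⟩)
      rw [abs_lt] at h5
      linarith
  -- The way from `y` to `x` stays strictly between the walls, hence below the level.
  obtain ⟨z, hz, hz'⟩ := hcon x ⟨hmin, hleft⟩ hxy
  refine absurd (hbelow z ?_ ?_) (not_le.2 hz')
  · exact (lt_min (lt_of_le_of_ne ha.1.2 (by rintro rfl; linarith)) hxa').trans_le hz.1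
  · exact hz.2.trans_lt (max_lt (lt_of_le_of_ne hb.1.1 (by rintro rfl; linarith)) hxb')

end

/-- The points of a labeling with label less than `k`, and the end points, on the lattice. -/
def latticeS (N : ℕ) {q : ℕ} (m : Fin q → ℤ) (k : ℕ) : Set ℤ :=
  {n | ∃ i : Fin q, (i : ℕ) < k ∧ n = m i} ∪ {-(N : ℤ), (N : ℤ)}

/-- The properties of a potential `V` with a good path: the points `m` with barriers `d`. -/
structure IsLandscape (V : ℤ → ℝ) (N : ℕ) {q : ℕ} (m : Fin q → ℤ) (d : Fin q → ℝ) (h δ : ℝ) :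
    Prop where
  injective : Function.Injective m
  neg_lt : ∀ k, -(N : ℤ) < m k
  lt : ∀ k, m k < N
  barrier_le : ∀ k : Fin q, ∀ s ∈ latticeS N m k, ∃ z ∈ Set.uIcc (m k) s, V (m k) + d k ≤ V z
  le_barrier : ∀ k : Fin q, ∃ s ∈ latticeS N m k, ∀ z ∈ Set.uIcc (m k) s, V z ≤ V (m k) + d k
  gap : ∀ k j : Fin q, k < j → ∃ s ∈ latticeS N m k, ∀ z ∈ Set.uIcc (m j) s, V z ≤ V (m j) + d k - δ
  separated : ∀ k i, i ≠ k → ∃ z ∈ Set.uIcc (m k) (m i), V (m k) + h + δ ≤ V z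
  depth : ∀ k, h + δ ≤ d k
  exhaustive : ∀ y, -(N : ℤ) < y → y < N →
    (∃ k, V (m k) ≤ V y ∧ ∀ z ∈ Set.uIcc y (m k), V z ≤ V y + h) ∨
      (∀ z ∈ Set.uIcc y N, V z ≤ V y + h) ∨ (∀ z ∈ Set.uIcc y (-N), V z ≤ V y + h)

lemma div_mem_S_iff {N : ℕ} (hN : 0 < N) {q : ℕ} {x : Fin q → ℝ} {m : Fin q → ℤ}
    (hxm : ∀ k, x k = m k / N) (k : ℕ) (n : ℤ) : (n / N : ℝ) ∈ S x k ↔ n ∈ latticeS N m k := by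
  have hN' : (N : ℝ) ≠ 0 := by positivity
  simp only [S, latticeS, Set.mem_union, Set.mem_ofPred_eq, Set.mem_insert_iff,
    Set.mem_singleton_iff, hxm, div_left_inj' hN', Int.cast_inj, div_eq_iff hN', one_mul, neg_mul]
  refine or_congr Iff.rfl (or_congr ?_ ?_) <;> norm_cast

lemma exists_of_mem_S {N : ℕ} (hN : 0 < N) {q : ℕ} {x : Fin q → ℝ} {m : Fin q → ℤ}
    (hxm : ∀ k, x k = m k / N) {k : ℕ} {s : ℝ} (hs : s ∈ S x k) :
    ∃ n ∈ latticeS N m k, s = n / N := by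
  have hN' : (N : ℝ) ≠ 0 := by positivity
  rcases id hs with ⟨i, hi, rfl⟩ | rfl | rfl
  · exact ⟨m i, (div_mem_S_iff hN hxm k _).1 (hxm i ▸ hs), hxm i⟩
  · exact ⟨-N, Or.inr (Or.inl rfl), by push_cast; rw [neg_div, div_self hN']⟩
  · exact ⟨N, Or.inr (Or.inr rfl), by push_cast; rw [div_self hN']⟩

/-- Suprema of the interpolated path are attained at sites, so every condition on the path becomes
one on `V`, with heights multiplied by `√N`. The labeling yields the gaps, the depth condition on
good paths yields `separated` and `depth`, and `exists_hMinima_below` yields `exhaustive`. -/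
theorem isLandscape_of_isGoodPath {ω : Environment} {N : ℕ} (hN : 0 < N) {h δ : ℝ} (hh : 0 < h)
    (hgood : IsGoodPath h δ (rescaledPotential ω N)) {q : ℕ} {x : Fin q → ℝ}
    (hlab : IsLabeling h δ (rescaledPotential ω N) x) :
    ∃ m : Fin q → ℤ, (∀ k, x k = m k / N) ∧ IsLandscape (potential ω) N m
      (fun k => √N * barrier (rescaledPotential ω N) (x k) (S x k)) (h * √N) (δ * √N) := by
  have hN' : (0 : ℝ) < N := by positivity
  have hs : (0 : ℝ) < √N := Real.sqrt_pos.2 hN'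
  obtain ⟨hcont, -, hdeep, -⟩ := hgood
  obtain ⟨hinj, hrange, hgap⟩ := hlab
  have hmem : ∀ k, x k ∈ hMinima h (rescaledPotential ω N) := fun k =>
    hrange ▸ Set.mem_range_self k
  choose m hxm hm1 hm2 using fun k => exists_int_of_mem_hMinima hN hh (hmem k)
  have hγint := fun n : ℤ => rescaledPotential_int (ω := ω) hN n
  set γ := rescaledPotential ω N with hγ
  have hIcc : ∀ n : ℤ, -(N : ℤ) ≤ n → n ≤ N → (n / N : ℝ) ∈ Set.Icc (-1 : ℝ) 1 := fun n h1 h2 => by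
    rw [Set.mem_Icc, le_div_iff₀ hN', div_le_iff₀ hN', neg_one_mul, one_mul]
    exact ⟨by exact_mod_cast h1, by exact_mod_cast h2⟩
  have hxIcc : ∀ k, x k ∈ Set.Icc (-1 : ℝ) 1 := fun k => by
    rw [hxm]; exact hIcc _ (hm1 k).le (hm2 k).le
  have hSIcc : ∀ k, S x k ⊆ Set.Icc (-1) 1 := by
    rintro k s (⟨i, -, rfl⟩ | rfl | rfl)
    · exact hxIcc i
    · norm_num
    · norm_num
  have hSfin : ∀ k, (S x k).Finite := fun k =>
    ((Set.finite_range x).subset (by rintro _ ⟨i, -, rfl⟩; exact ⟨i, rfl⟩)).union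
      (Set.toFinite _)
  have hSne : ∀ k, (S x k).Nonempty := fun k => ⟨1, Or.inr (Or.inr rfl)⟩
  have hspec := fun j k => barrier_spec hcont (hxIcc j) (hSfin k) (hSne k) (hSIcc k)
  -- the passage between heights of paths and heights on the lattice
  have hlow : ∀ (k : Fin q) (n : ℤ) (t : ℝ),
      γ (x k) + t ≤ sSup (γ '' Set.uIcc (x k) (n / N)) →
        ∃ z ∈ Set.uIcc (m k) n, potential ω (m k) + √N * t ≤ potential ω z := by
    intro k n t ht
    obtain ⟨-, z, hz, hz'⟩ := sSup_rescaledPotential (ω := ω) hN (m k) n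
    refine ⟨z, hz, ?_⟩
    rw [hxm] at ht
    have h1 := ht.trans hz'
    rw [hγint, le_div_iff₀ hs, add_mul, div_mul_cancel₀ _ hs.ne'] at h1
    linarith
  have hup : ∀ (k : Fin q) (n : ℤ) (t : ℝ),
      sSup (γ '' Set.uIcc (x k) (n / N)) ≤ γ (x k) + t →
        ∀ z ∈ Set.uIcc (m k) n, potential ω z ≤ potential ω (m k) + √N * t := by
    intro k n t ht z hz
    have h2 := (sSup_rescaledPotential (ω := ω) hN (m k) n).1 z hz
    rw [hxm] at ht
    have h1 := h2.trans ht
    rw [hγint, div_le_iff₀ hs, add_mul, div_mul_cancel₀ _ hs.ne'] at h1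
    linarith
  have hdeep' : ∀ k, ∀ s ∈ (hMinima h γ ∪ {-1, 1}) \ {x k},
      γ (x k) + (h + δ) ≤ sSup (γ '' Set.uIcc (x k) s) := by
    intro k s hs
    have hsub : hMinima h γ ∪ {-1, 1} ⊆ Set.Icc (-1) 1 := by
      rw [← hrange]
      rintro s (⟨i, rfl⟩ | rfl | rfl)
      · exact hxIcc i
      · norm_num
      · norm_num
    have hfin : (hMinima h γ ∪ {-1, 1}).Finite := by
      rw [← hrange]; exact (Set.finite_range x).union (Set.toFinite _)
    have h1 := (barrier_spec hcont (hxIcc k) (hfin.subset Set.sdiff_subset)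
      ⟨s, hs⟩ (Set.sdiff_subset.trans hsub)).1 s hs
    linarith [hdeep (x k) (hmem k)]
  refine ⟨m, hxm, ?_, hm1, hm2, ?_, ?_, ?_, ?_, ?_, ?_⟩
  · intro i j hij
    exact hinj (by rw [hxm, hxm, hij])
  · intro k s hs
    exact hlow k s _ ((hspec k k).1 _ ((div_mem_S_iff hN hxm k s).2 hs))
  · intro k
    obtain ⟨s, hs, hs'⟩ := (hspec k k).2
    obtain ⟨n, hn, rfl⟩ := exists_of_mem_S hN hxm hs
    exact ⟨n, hn, hup k n _ hs'.le⟩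
  · intro k j hkj
    obtain ⟨s, hs, hs'⟩ := (hspec j k).2
    obtain ⟨n, hn, rfl⟩ := exists_of_mem_S hN hxm hs
    refine ⟨n, hn, fun z hz => ?_⟩
    have h1 := hup j n (barrier γ (x k) (S x k) - δ) (hs'.le.trans (by linarith [hgap k j hkj])) z hz
    linarith
  · intro k i hik
    have h1 := hdeep' k (x i) ⟨Or.inl (hmem i), fun h0 => hik (hinj h0)⟩
    rw [hxm i] at h1
    obtain ⟨z, hz, hz'⟩ := hlow k (m i) _ h1
    exact ⟨z, hz, by linarith⟩
  -- The point of `S x k` that realizes the barrier is an h-minimum or an end point other than `x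
  -- k`, so the depth condition applies to it.
  · intro k
    obtain ⟨s, hs1, hs'⟩ := (hspec k k).2
    have h1 := hdeep' k s ⟨?_, ?_⟩
    · rw [← add_mul, mul_comm]
      exact mul_le_mul_of_nonneg_left (by linarith) hs.le
    · rcases hs1 with ⟨i, -, rfl⟩ | h0
      · exact Or.inl (hmem i)
      · exact Or.inr h0
    · rintro rfl
      have h2 := (div_mem_S_iff hN hxm k (m k)).1 (hxm k ▸ hs1)
      rcases h2 with ⟨i, hi, h3⟩ | h3 | h3
      · have : x k = x i := by rw [hxm, hxm, h3]
        exact absurd (hinj this) (by rintro rfl; exact lt_irrefl _ hi)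
      · exact (hm1 k).ne' h3
      · exact (hm2 k).ne h3
  · intro y hy hy'
    refine (exists_hMinima_below (ω := ω) hN hh hy hy').imp ?_ id
    rintro ⟨n, hn, h1, h2⟩
    rw [← hγ, ← hrange] at hn
    obtain ⟨k, hk⟩ := hn
    rw [hxm, div_left_inj' hN'.ne', Int.cast_inj] at hk
    exact ⟨k, by rw [hk]; exact h1, by rw [hk]; exact h2⟩

/-! ### Equilibrium potentials -/

/-- `u` is the equilibrium potential of the point `m` with zero boundary condition on `A` and
outside of `(-N, N)`. -/
structure IsEquilibrium (ω : Environment) (N : ℕ) (A : Set ℤ) (m : ℤ) (u : ℤ → ℝ) : Prop where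
  eq_one : u m = 1
  eq_zero : ∀ s ∈ A, u s = 0
  harmonic : ∀ y, -(N : ℤ) < y → y < N → y ∉ A → y ≠ m → lap ω u y = 0
  nonneg : ∀ y, 0 ≤ u y
  le_one : ∀ y, u y ≤ 1
  outside : ∀ y, y ∉ box N → u y = 0

/-- The extension by zero of a function on `D`. -/
def extend (D : Finset ℤ) (f : D → ℝ) (y : ℤ) : ℝ := if h : y ∈ D then f ⟨y, h⟩ else 0

lemma extend_coe {D : Finset ℤ} (f : D → ℝ) (x : D) : extend D f x = f x := by
  simp [extend]

lemma extend_of_notMem {D : Finset ℤ} (f : D → ℝ) {y : ℤ} (h : y ∉ D) : extend D f y = 0 := by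
  simp [extend, h]

lemma latticeS_mem_Icc {V : ℤ → ℝ} {N q : ℕ} {m : Fin q → ℤ} {d : Fin q → ℝ} {h δ : ℝ}
    (hL : IsLandscape V N m d h δ) {k : ℕ} {s : ℤ} (hs : s ∈ latticeS N m k) :
    -(N : ℤ) ≤ s ∧ s ≤ N := by
  rcases hs with ⟨i, -, rfl⟩ | rfl | rfl
  · exact ⟨(hL.neg_lt i).le, (hL.lt i).le⟩
  · lia
  · lia

lemma m_notMem_latticeS {V : ℤ → ℝ} {N q : ℕ} {m : Fin q → ℤ} {d : Fin q → ℝ} {h δ : ℝ}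
    (hL : IsLandscape V N m d h δ) {k j : Fin q} (hjk : j ≤ k) : m k ∉ latticeS N m j := by
  rintro (⟨i, hi, h1⟩ | h1 | h1)
  · obtain rfl := hL.injective h1
    exact absurd hi (not_lt.2 hjk)
  · exact (hL.neg_lt k).ne' h1
  · exact (hL.lt k).ne h1

/-- Steps go to nearest neighbours, so a harmonic function at `y` sees only the two closest sites of
the boundary. -/
lemma exists_neighbours {N q : ℕ} {m : Fin q → ℤ} (k : ℕ) {y : ℤ} (hy : -(N : ℤ) < y) (hy' : y < N)
    (hyA : y ∉ latticeS N m k) :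
    ∃ a ∈ latticeS N m k, ∃ b ∈ latticeS N m k, a < y ∧ y < b ∧
      ∀ z, a < z → z < b → z ∉ latticeS N m k := by
  classical
  obtain ⟨a, ha, hamax⟩ := Finset.exists_max_image
    ((Finset.Icc (-(N : ℤ)) y).filter fun z => z ∈ latticeS N m k) id
    ⟨-N, by
      simp only [Finset.mem_filter, Finset.mem_Icc]
      exact ⟨⟨le_rfl, hy.le⟩, Or.inr (Or.inl rfl)⟩⟩
  obtain ⟨b, hb, hbmin⟩ := Finset.exists_min_image
    ((Finset.Icc y (N : ℤ)).filter fun z => z ∈ latticeS N m k) id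
    ⟨N, by
      simp only [Finset.mem_filter, Finset.mem_Icc]
      exact ⟨⟨hy'.le, le_rfl⟩, Or.inr (Or.inr rfl)⟩⟩
  simp only [Finset.mem_filter, Finset.mem_Icc, id, and_imp] at ha hb hamax hbmin
  refine ⟨a, ha.2, b, hb.2, lt_of_le_of_ne ha.1.2 ?_, lt_of_le_of_ne hb.1.1 ?_, fun z h1 h2 hz => ?_⟩
  · rintro rfl; exact hyA ha.2
  · rintro rfl; exact hyA hb.2
  · rcases le_total z y with h3 | h3
    · exact absurd (hamax z (by lia) h3 hz) (by lia)
    · exact absurd (hbmin z h3 (by lia) hz) (by lia)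

lemma hitProb_nonneg (ω : Environment) (N : ℕ) (n : ℤ) (A B : Set ℝ) : 0 ≤ hitProb ω N n A B :=
  measureReal_nonneg

lemma hitProb_le_one (ω : Environment) (N : ℕ) (n : ℤ) (A B : Set ℝ) : hitProb ω N n A B ≤ 1 :=
  measureReal_le_one

section
variable {κ : ℝ} {ω : Environment} {N q : ℕ} {m : Fin q → ℤ} {d : Fin q → ℝ} {h δ : ℝ}

lemma isEquilibrium_eqPotential (hN : 0 < N) {x : Fin q → ℝ} (hxm : ∀ k, x k = m k / N)
    (hL : IsLandscape (potential ω) N m d h δ) (k : Fin q) :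
    IsEquilibrium ω N (latticeS N m k) (m k) (extend (box N) (eqPotential ω N x k)) := by
  classical
  have hN' : (N : ℝ) ≠ 0 := by positivity
  have hxk : ∀ y : ℤ, (y / N : ℝ) = x k ↔ y = m k := fun y => by
    rw [hxm, div_left_inj' hN', Int.cast_inj]
  have hmA : m k ∉ latticeS N m k := m_notMem_latticeS hL le_rfl
  have hbox : ∀ y, y ∈ box N ↔ -(N : ℤ) < y ∧ y < N := fun y => by simp [box]
  have hval : ∀ y, extend (box N) (eqPotential ω N x k) y = if y ∈ box N then
      if y = m k then 1 else if y ∈ latticeS N m k then 0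
        else hitProb ω N y {x k} (S x k) else 0 := fun y => by
    simp only [extend, eqPotential, hxk, div_mem_S_iff hN hxm, dite_eq_ite]
  have hmbox : m k ∈ box N := (hbox _).2 ⟨hL.neg_lt k, hL.lt k⟩
  have hzero : ∀ s ∈ latticeS N m k, extend (box N) (eqPotential ω N x k) s = 0 := fun s hs => by
    rw [hval, if_neg (fun h0 : s = m k => hmA (h0 ▸ hs)), if_pos hs, ite_self]
  refine ⟨?_, hzero, ?_, ?_, ?_, fun y hy => extend_of_notMem _ hy⟩
  · rw [hval, if_pos hmbox, if_pos rfl]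
  · intro y hy hy' hyA hym
    -- `hitProb_eq` tests the boundary before the pole, `eqPotential` the other way round; the order
    -- is irrelevant because `m k` is not in its own boundary. The extension by zero is right at
    -- `-N` and `N` because these belong to `latticeS`.
    set u : ℤ → ℝ := fun y => if (y / N : ℝ) ∈ S x k then 0
      else if (y / N : ℝ) ∈ ({x k} : Set ℝ) then 1 else hitProb ω N y {x k} (S x k) with hu
    have hagree : ∀ z, -(N : ℤ) ≤ z → z ≤ N → u z = extend (box N) (eqPotential ω N x k) z := by
      intro z h1 h2
      by_cases hzA : z ∈ latticeS N m k
      · rw [hzero z hzA]; simp only [hu, div_mem_S_iff hN hxm, if_pos hzA]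
      · have hz1 : z ≠ -N := by rintro rfl; exact hzA (Or.inr (Or.inl rfl))
        have hz2 : z ≠ N := by rintro rfl; exact hzA (Or.inr (Or.inr rfl))
        rw [hval, if_pos ((hbox z).2 ⟨by lia, by lia⟩)]
        simp only [hu, div_mem_S_iff hN hxm, if_neg hzA, Set.mem_singleton_iff, hxk]
    have h1 := hitProb_eq ω N {x k} (S x k) y u fun y => rfl
    rw [hagree _ (by lia) (by lia), hagree _ (by lia) (by lia)] at h1
    rw [lap, hval y, if_pos ((hbox y).2 ⟨hy, hy'⟩), if_neg hym, if_neg hyA, h1]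
    ring
  · intro y
    rw [hval]
    split_ifs
    exacts [zero_le_one, le_rfl, hitProb_nonneg _ _ _ _ _, le_rfl]
  · intro y
    rw [hval]
    split_ifs
    exacts [le_rfl, zero_le_one, hitProb_le_one _ _ _ _ _, zero_le_one]

/-- The generator of h_k at its pole is one minus the mean of h_k after one step. Complementarity of
the two hitting probabilities follows from uniqueness of harmonic functions, without using that
hitting times are finite. -/
lemma lap_eqPotential (hω : Elliptic κ ω) (hκ : 0 < κ) (hN : 0 < N) {x : Fin q → ℝ}
    (hxm : ∀ k, x k = m k / N) (hL : IsLandscape (potential ω) N m d h δ) (k : Fin q) :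
    lap ω (extend (box N) (eqPotential ω N x k)) (m k) = hitProb ω N (m k) (S x k) {x k} := by
  classical
  have hN' : (N : ℝ) ≠ 0 := by positivity
  have hxk : ∀ y : ℤ, (y / N : ℝ) = x k ↔ y = m k := fun y => by
    rw [hxm, div_left_inj' hN', Int.cast_inj]
  have hmA : m k ∉ latticeS N m k := m_notMem_latticeS hL le_rfl
  have hU := isEquilibrium_eqPotential hN hxm hL k
  set u := extend (box N) (eqPotential ω N x k) with hu
  obtain ⟨a, ha, b, hb, ham, hmb, hab⟩ :=
    exists_neighbours k (hL.neg_lt k) (hL.lt k) hmA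
  have ha1 := (latticeS_mem_Icc hL ha).1
  have hb1 := (latticeS_mem_Icc hL hb).2
  set v : ℤ → ℝ := fun y => if (y / N : ℝ) ∈ ({x k} : Set ℝ) then 0
    else if (y / N : ℝ) ∈ S x k then 1 else hitProb ω N y (S x k) {x k} with hv
  have hv1 : ∀ y, hitProb ω N y (S x k) {x k} = ω y * v (y + 1) + (1 - ω y) * v (y - 1) :=
    fun y => hitProb_eq ω N (S x k) {x k} y v fun _ => rfl
  have hvm : v (m k) = 0 := by simp [hv, hxm]
  have hvA : ∀ s ∈ latticeS N m k, v s = 1 := fun s hs => by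
    simp only [hv, Set.mem_singleton_iff, hxk, div_mem_S_iff hN hxm, if_pos hs]
    exact if_neg fun h0 : s = m k => hmA (h0 ▸ hs)
  have hvlap : ∀ y, y ∉ latticeS N m k → y ≠ m k → lap ω v y = 0 := fun y h1 h2 => by
    have h3 : v y = hitProb ω N y (S x k) {x k} := by
      simp only [hv, Set.mem_singleton_iff, hxk, div_mem_S_iff hN hxm, if_neg h1, if_neg h2]
    rw [lap, h3, hv1]; ring
  -- This defect vanishes at `a`, `m k`, `b` and is harmonic between them, hence is zero throughout.
  set w : ℤ → ℝ := fun y => u y + v y - 1 with hw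
  have hwlap : ∀ y, a < y → y < b → y ≠ m k → lap ω w y = 0 := fun y h1 h2 h3 => by
    have h4 := hU.harmonic y (by lia) (by lia) (hab y h1 h2) h3
    have h5 := hvlap y (hab y h1 h2) h3
    simp only [lap, hw] at h4 h5 ⊢
    linear_combination h4 + h5
  have hwa : w a = 0 := by simp [hw, hU.eq_zero a ha, hvA a ha]
  have hwb : w b = 0 := by simp [hw, hU.eq_zero b hb, hvA b hb]
  have hwm : w (m k) = 0 := by simp [hw, hU.eq_one, hvm]
  have h1 : w (m k + 1) = 0 := eq_zero_of_lap_eq_zero hω hκ (a := m k) (b := b)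
    (fun y h1 h2 => hwlap y (by lia) h2 (by lia)) hwm hwb (by lia) (by lia)
  have h2 : w (m k - 1) = 0 := eq_zero_of_lap_eq_zero hω hκ (a := a) (b := m k)
    (fun y h1 h2 => hwlap y h1 (by lia) (by lia)) hwa hwm (by lia) (by lia)
  rw [hv1, lap, hU.eq_one]
  simp only [hw] at h1 h2
  linear_combination (-(ω (m k) : ℝ)) * h1 - (1 - (ω (m k) : ℝ)) * h2

/-! ### Bounds on capacities, norms and overlaps -/

lemma IsLandscape.exp_le_res_left (hL : IsLandscape (potential ω) N m d h δ) (hδ : 0 < h + δ)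
    {k : Fin q} {a : ℤ} (ha : a ∈ latticeS N m k) (ham : a < m k) :
    Real.exp (potential ω (m k) + d k) ≤ res ω a (m k) := by
  obtain ⟨z, hz, hz'⟩ := hL.barrier_le k a ha
  rw [Set.uIcc_of_ge ham.le] at hz
  have hzm : z ≠ m k := by
    rintro rfl
    linarith [hL.depth k]
  exact (Real.exp_le_exp.2 hz').trans (exp_le_res hz.1 (lt_of_le_of_ne hz.2 hzm))

/-- The barrier may sit at `b`, whose weight does not enter the resistance; its left neighbour does,
and ellipticity costs `κ`. On the left side no such loss occurs. -/
lemma IsLandscape.exp_le_res_right (hω : Elliptic κ ω) (hκ : 0 < κ)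
    (hL : IsLandscape (potential ω) N m d h δ) (hδ : 0 < h + δ)
    {k : Fin q} {b : ℤ} (hb : b ∈ latticeS N m k) (hmb : m k < b) :
    κ * Real.exp (potential ω (m k) + d k) ≤ res ω (m k) b := by
  obtain ⟨z, hz, hz'⟩ := hL.barrier_le k b hb
  rw [Set.uIcc_of_le hmb.le] at hz
  have hzm : m k ≠ z := by
    rintro rfl
    linarith [hL.depth k]
  have h1 := mul_exp_potential_succ_le hω hκ (z - 1)
  rw [sub_add_cancel] at h1
  have h2 : m k < z := lt_of_le_of_ne hz.1 hzm
  calc κ * Real.exp (potential ω (m k) + d k) ≤ κ * Real.exp (potential ω z) :=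
        mul_le_mul_of_nonneg_left (Real.exp_le_exp.2 hz') hκ.le
    _ ≤ Real.exp (potential ω (z - 1)) := h1
    _ ≤ res ω (m k) b := exp_le_res (by lia) (by have := hz.2; lia)

/-- Two resistors in parallel: on each side `u` drops from 1 to 0 linearly in the resistance, so the
current is the reciprocal of the resistance. -/
lemma IsEquilibrium.capacity_eq (hω : Elliptic κ ω) (hκ : 0 < κ) {A : Set ℤ} {p : ℤ} {u : ℤ → ℝ}
    (hu : IsEquilibrium ω N A p u) {a b : ℤ} (ha : a ∈ A) (hb : b ∈ A) (hap : a < p) (hpb : p < b)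
    (haN : -(N : ℤ) ≤ a) (hbN : b ≤ N) (hab : ∀ z, a < z → z < b → z ∉ A) :
    mu ω p * lap ω u p = 1 / res ω p b + 1 / res ω a p := by
  have h1 := sub_mul_res_of_lap_eq_zero hω hκ (u := u) (a := p) (b := b)
    (fun y h1 h2 => hu.harmonic y (by lia) (by lia) (hab y (by lia) h2) (by lia))
    (y := p + 1) (by lia) (by lia)
  have h2 := sub_mul_res_of_lap_eq_zero hω hκ (u := u) (a := a) (b := p)
    (fun y h1 h2 => hu.harmonic y (by lia) (by lia) (hab y h1 (by lia)) (by lia))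
    (y := p - 1) (by lia) (by lia)
  have h3 : res ω p (p + 1) = Real.exp (potential ω p) := by
    rw [res_succ le_rfl, res_self, zero_add]
  have h4 := res_succ (ω := ω) (a := a) (b := p - 1) (by lia)
  rw [sub_add_cancel] at h4
  rw [hu.eq_one, hu.eq_zero b hb, h3] at h1
  rw [hu.eq_one, hu.eq_zero a ha] at h2
  have h5 := res_pos (ω := ω) hpb
  have h6 := res_pos (ω := ω) hap
  have h7 : 1 - u (p + 1) = Real.exp (potential ω p) / res ω p b := by
    rw [eq_div_iff h5.ne']; linarith
  have h8 : 1 - u (p - 1) = Real.exp (potential ω (p - 1)) / res ω a p := by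
    rw [eq_div_iff h6.ne']; linarith
  rw [mu_mul_lap hω hκ, hu.eq_one, h7, h8, Real.exp_neg, Real.exp_neg]
  have h9 := (Real.exp_pos (potential ω p)).ne'
  have h10 := (Real.exp_pos (potential ω (p - 1))).ne'
  field_simp

variable {u : ℤ → ℝ}

lemma IsLandscape.capacity_le (hω : Elliptic κ ω) (hκ : 0 < κ)
    (hL : IsLandscape (potential ω) N m d h δ) (hδ : 0 < h + δ) {k : Fin q}
    (hu : IsEquilibrium ω N (latticeS N m k) (m k) u) :
    mu ω (m k) * lap ω u (m k)
      ≤ (1 + 1 / κ) * Real.exp (-d k) * Real.exp (-potential ω (m k)) := by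
  obtain ⟨a, ha, b, hb, ham, hmb, hab⟩ :=
    exists_neighbours k (hL.neg_lt k) (hL.lt k) (m_notMem_latticeS hL le_rfl)
  rw [hu.capacity_eq hω hκ ha hb ham hmb (latticeS_mem_Icc hL ha).1 (latticeS_mem_Icc hL hb).2 hab]
  have h1 := one_div_le_one_div_of_le (Real.exp_pos _) (hL.exp_le_res_left hδ ha ham)
  have h2 := one_div_le_one_div_of_le (mul_pos hκ (Real.exp_pos _))
    (hL.exp_le_res_right hω hκ hδ hb hmb)
  refine (add_le_add h2 h1).trans (le_of_eq ?_)
  rw [Real.exp_add, Real.exp_neg, Real.exp_neg]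
  have h9 := (Real.exp_pos (potential ω (m k))).ne'
  have h10 := (Real.exp_pos (d k)).ne'
  field_simp
  ring

/-- It suffices to bound the resistance on the side where the barrier `d k` is realized: the nearest
boundary site there is no farther than `s`, and each of at most `2 N` weights is below the barrier.
-/
lemma IsLandscape.le_capacity (hω : Elliptic κ ω) (hκ : 0 < κ)
    (hL : IsLandscape (potential ω) N m d h δ) {k : Fin q}
    (hu : IsEquilibrium ω N (latticeS N m k) (m k) u) (hN : 0 < N) :
    1 / (2 * N) * Real.exp (-d k) * Real.exp (-potential ω (m k))
      ≤ mu ω (m k) * lap ω u (m k) := by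
  obtain ⟨a, ha, b, hb, ham, hmb, hab⟩ :=
    exists_neighbours k (hL.neg_lt k) (hL.lt k) (m_notMem_latticeS hL le_rfl)
  have haN := (latticeS_mem_Icc hL ha).1
  have hbN := (latticeS_mem_Icc hL hb).2
  have hmN := hL.neg_lt k
  have hmN' := hL.lt k
  rw [hu.capacity_eq hω hκ ha hb ham hmb haN hbN hab]
  have hN' : (0 : ℝ) < N := by positivity
  have h0 : 1 / (2 * N) * Real.exp (-d k) * Real.exp (-potential ω (m k))
      = 1 / (2 * N * Real.exp (potential ω (m k) + d k)) := by
    rw [Real.exp_add, Real.exp_neg, Real.exp_neg]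
    field_simp
  have h1 := res_pos (ω := ω) hmb
  have h2 := res_pos (ω := ω) ham
  rw [h0]
  obtain ⟨s, hs, hV⟩ := hL.le_barrier k
  have hsm : s ≠ m k := fun h0 => m_notMem_latticeS hL le_rfl (h0 ▸ hs)
  rcases lt_or_gt_of_ne hsm with h3 | h3
  · have hsa : s ≤ a := by
      by_contra! h4
      exact hab s h4 (by lia) hs
    have h4 : res ω a (m k) ≤ 2 * N * Real.exp (potential ω (m k) + d k) :=
      res_le_two_mul haN hmN'.le ham.le fun z hz1 hz2 => hV z (by
        rw [Set.uIcc_of_ge h3.le]; exact ⟨hsa.trans hz1, hz2.le⟩)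
    have := one_div_le_one_div_of_le h2 h4
    have h5 : 0 < 1 / res ω (m k) b := by positivity
    linarith
  · have hsb : b ≤ s := by
      by_contra! h4
      exact hab s (by lia) h4 hs
    have h4 : res ω (m k) b ≤ 2 * N * Real.exp (potential ω (m k) + d k) :=
      res_le_two_mul hmN.le hbN hmb.le fun z hz1 hz2 => hV z (by
        rw [Set.uIcc_of_le h3.le]; exact ⟨hz1, hz2.le.trans hsb⟩)
    have := one_div_le_one_div_of_le h1 h4
    have h5 : 0 < 1 / res ω a (m k) := by positivity
    linarith

/-- A site outside of the boundary either lies in the valley of `m k`, or its barrier to the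
boundary is at most `d k - δ`. -/
lemma IsLandscape.valley_or_escape (hL : IsLandscape (potential ω) N m d h δ) (k : Fin q) {y : ℤ}
    (hy : -(N : ℤ) < y) (hy' : y < N) :
    (potential ω (m k) ≤ potential ω y ∧
        ∀ z ∈ Set.uIcc y (m k), potential ω z ≤ potential ω y + h) ∨
      ∃ s ∈ latticeS N m k, ∀ z ∈ Set.uIcc y s, potential ω z ≤ potential ω y + d k - δ := by
  have hd := hL.depth k
  rcases hL.exhaustive y hy hy' with ⟨i, h1, h2⟩ | h1 | h1
  · rcases lt_trichotomy i k with hik | rfl | hik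
    · exact Or.inr ⟨m i, Or.inl ⟨i, hik, rfl⟩, fun z hz => by linarith [h2 z hz]⟩
    · exact Or.inl ⟨h1, h2⟩
    · obtain ⟨s, hs, h3⟩ := hL.gap k i hik
      refine Or.inr ⟨s, hs, fun z hz => ?_⟩
      rcases Set.uIcc_subset_uIcc_union_uIcc (b := m i) hz with h4 | h4
      · linarith [h2 z h4]
      · linarith [h3 z h4]
  · exact Or.inr ⟨N, Or.inr (Or.inr rfl), fun z hz => by linarith [h1 z hz]⟩
  · exact Or.inr ⟨-N, Or.inr (Or.inl rfl), fun z hz => by linarith [h1 z hz]⟩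

lemma IsEquilibrium.mu_mul_sq_le (hω : Elliptic κ ω) (hκ : 0 < κ) {A : Set ℤ} {p : ℤ}
    (hu : IsEquilibrium ω N A p u) (y : ℤ) :
    mu ω y * u y ^ 2 ≤ Real.exp (-potential ω y) / κ * u y := by
  have h1 : u y ^ 2 ≤ u y := by nlinarith [hu.nonneg y, hu.le_one y]
  exact mul_le_mul (mu_le hω hκ y) h1 (sq_nonneg _) (by positivity)

/-- The mass of the equilibrium potential is small outside of the valley. -/
lemma IsLandscape.mass_le (hω : Elliptic κ ω) (hκ : 0 < κ) (hκ1 : κ ≤ 1)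
    (hL : IsLandscape (potential ω) N m d h δ) (hh : 0 < h) (hδ : 0 < δ) {k : Fin q}
    (hu : IsEquilibrium ω N (latticeS N m k) (m k) u) (hN : 0 < N) {y : ℤ} (hy : y ∈ box N) :
    mu ω y * u y ^ 2 ≤ 2 * N / κ ^ 2 * Real.exp (-δ) * Real.exp (-potential ω (m k)) ∨
      (potential ω (m k) ≤ potential ω y ∧
        ∀ z ∈ Set.uIcc y (m k), potential ω z ≤ potential ω y + h) := by
  have hN' : (1 : ℝ) ≤ N := by exact_mod_cast hN
  have hbound : 0 ≤ 2 * N / κ ^ 2 * Real.exp (-δ) * Real.exp (-potential ω (m k)) := by positivity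
  have hhδ : 0 < h + δ := by linarith
  simp only [box, Finset.mem_Ioo] at hy
  rcases hL.valley_or_escape k hy.1 hy.2 with hv | ⟨s, hs, hV⟩
  · exact Or.inr hv
  refine Or.inl ?_
  by_cases hyA : y ∈ latticeS N m k
  · rw [hu.eq_zero y hyA]; simpa using hbound
  obtain ⟨a, ha, b, hb, hay, hyb, hab⟩ := exists_neighbours k hy.1 hy.2 hyA
  have haN := (latticeS_mem_Icc hL ha).1
  have hbN := (latticeS_mem_Icc hL hb).2
  have hmA : m k ∉ latticeS N m k := m_notMem_latticeS hL le_rfl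
  have hmass := hu.mu_mul_sq_le hω hκ y
  have hE : 0 < Real.exp (-potential ω y) / κ := by positivity
  have hsab : s ≤ a ∨ b ≤ s := by
    by_contra! h1
    exact hab s h1.1 h1.2 hs
  -- the height of `y` exceeds that of `m k` by `δ`
  have hhigh : potential ω (m k) + δ ≤ potential ω y →
      mu ω y * u y ^ 2 ≤ 2 * N / κ ^ 2 * Real.exp (-δ) * Real.exp (-potential ω (m k)) := by
    intro h1
    refine hmass.trans ((mul_le_of_le_one_right hE.le (hu.le_one y)).trans ?_)
    have h2 : Real.exp (-potential ω y) ≤ Real.exp (-δ) * Real.exp (-potential ω (m k)) := by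
      rw [← Real.exp_add]; exact Real.exp_le_exp.2 (by linarith)
    have h3 : 1 / κ ≤ 2 * N / κ ^ 2 := by
      rw [div_le_div_iff₀ hκ (by positivity)]
      nlinarith
    calc Real.exp (-potential ω y) / κ = 1 / κ * Real.exp (-potential ω y) := by ring
      _ ≤ 2 * N / κ ^ 2 * (Real.exp (-δ) * Real.exp (-potential ω (m k))) :=
        mul_le_mul h3 h2 (Real.exp_pos _).le (by positivity)
      _ = _ := by ring
  -- the value at `y` is a quotient of resistances
  have hquot : ∀ r R : ℝ, u y * R = r → r ≤ 2 * N * Real.exp (potential ω y + d k - δ) →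
      κ * Real.exp (potential ω (m k) + d k) ≤ R →
      mu ω y * u y ^ 2 ≤ 2 * N / κ ^ 2 * Real.exp (-δ) * Real.exp (-potential ω (m k)) := by
    intro r R h1 h2 h3
    have h4 : u y * (κ * Real.exp (potential ω (m k) + d k))
        ≤ 2 * N * Real.exp (potential ω y + d k - δ) :=
      (mul_le_mul_of_nonneg_left h3 (hu.nonneg y)).trans (h1.le.trans h2)
    have h5 : u y ≤ 2 * N * Real.exp (potential ω y + d k - δ)
        / (κ * Real.exp (potential ω (m k) + d k)) := (le_div_iff₀ (by positivity)).2 h4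
    -- Both `V(y)` and `d k` cancel between the two resistances and the weight of `y`, leaving
    -- `e^{-δ}` and `e^{-V(m k)}`.
    refine hmass.trans ((mul_le_mul_of_nonneg_left h5 hE.le).trans (le_of_eq ?_))
    rw [sub_eq_add_neg, Real.exp_add, Real.exp_add, Real.exp_add, Real.exp_neg (potential ω y),
      Real.exp_neg (potential ω (m k))]
    field_simp
  rcases lt_trichotomy y (m k) with hym | hym | hym
  · rcases lt_or_ge (m k) b with hmb | hmb
    · rcases hsab with hsa | hbs
      -- The escape route leads away from `m k`, so `u y` is the quotient of the resistances from
      -- `a` to `y` and from `a` to `m k`.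
      · have h1 := sub_mul_res_of_lap_eq_zero hω hκ (u := u) (a := a) (b := m k)
          (fun z h1 h2 => hu.harmonic z (by lia) (by lia) (hab z h1 (by lia)) (by lia))
          hay.le hym.le
        rw [hu.eq_one, hu.eq_zero a ha, sub_zero, sub_zero, one_mul] at h1
        refine hquot _ _ h1 (res_le_two_mul haN hy.2.le hay.le fun z hz1 hz2 => hV z ?_) ?_
        · rw [Set.uIcc_of_ge (hsa.trans hay.le)]; exact ⟨hsa.trans hz1, hz2.le⟩
        · refine (mul_le_of_le_one_left (Real.exp_pos _).le hκ1).trans ?_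
          exact hL.exp_le_res_left hhδ ha (hay.trans hym)
      -- The escape route passes `m k` and crosses its barrier; being at most `V(y) + d k - δ` high,
      -- it forces `y` to be high.
      · refine hhigh ?_
        obtain ⟨z, hz, hz'⟩ := hL.barrier_le k b hb
        rw [Set.uIcc_of_le hmb.le] at hz
        have := hV z (by
          rw [Set.uIcc_of_le (hyb.le.trans hbs)]; exact ⟨hym.le.trans hz.1, hz.2.trans hbs⟩)
        linarith
    -- A boundary site separates `y` from the pole.
    · have : u y = 0 := eq_zero_of_lap_eq_zero hω hκ (a := a) (b := b)
        (fun z h1 h2 => hu.harmonic z (by lia) (by lia) (hab z h1 h2) (by lia))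
        (hu.eq_zero a ha) (hu.eq_zero b hb) hay.le hyb.le
      rw [this]; simpa using hbound
  · exfalso
    obtain ⟨z, hz, hz'⟩ := hL.barrier_le k s hs
    rw [hym] at hV
    linarith [hV z hz]
  · rcases lt_or_ge a (m k) with hma | hma
    · rcases hsab with hsa | hbs
      · refine hhigh ?_
        obtain ⟨z, hz, hz'⟩ := hL.barrier_le k a ha
        rw [Set.uIcc_of_ge hma.le] at hz
        have := hV z (by
          rw [Set.uIcc_of_ge (hsa.trans hay.le)]; exact ⟨hsa.trans hz.1, hz.2.trans hym.le⟩)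
        linarith
      · have h1 := sub_mul_res_of_lap_eq_zero hω hκ (u := u) (a := m k) (b := b)
          (fun z h1 h2 => hu.harmonic z (by lia) (by lia) (hab z (by lia) h2) (by lia))
          hym.le hyb.le
        rw [hu.eq_one, hu.eq_zero b hb, ← res_add hym.le hyb.le] at h1
        refine hquot (res ω y b) _ (by rw [← res_add hym.le hyb.le]; linarith)
          (res_le_two_mul hy.1.le hbN hyb.le fun z hz1 hz2 => hV z ?_)
          (hL.exp_le_res_right hω hκ hhδ hb (hym.trans hyb))
        rw [Set.uIcc_of_le (hyb.le.trans hbs)]; exact ⟨hz1, hz2.le.trans hbs⟩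
    · have : u y = 0 := eq_zero_of_lap_eq_zero hω hκ (a := a) (b := b)
        (fun z h1 h2 => hu.harmonic z (by lia) (by lia) (hab z h1 h2) (by lia))
        (hu.eq_zero a ha) (hu.eq_zero b hb) hay.le hyb.le
      rw [this]; simpa using hbound

lemma IsLandscape.mass_le' (hω : Elliptic κ ω) (hκ : 0 < κ) (hκ1 : κ ≤ 1)
    (hL : IsLandscape (potential ω) N m d h δ) (hh : 0 < h) (hδ : 0 < δ) {k : Fin q}
    (hu : IsEquilibrium ω N (latticeS N m k) (m k) u) (hN : 0 < N)
    (hNδ : 2 * N / κ * Real.exp (-δ) ≤ 1) {y : ℤ} (hy : y ∈ box N) :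
    mu ω y * u y ^ 2 ≤ 1 / κ * Real.exp (-potential ω (m k)) := by
  rcases hL.mass_le hω hκ hκ1 hh hδ hu hN hy with h1 | ⟨h1, -⟩
  · refine h1.trans ?_
    calc 2 * N / κ ^ 2 * Real.exp (-δ) * Real.exp (-potential ω (m k))
        = 1 / κ * (2 * N / κ * Real.exp (-δ)) * Real.exp (-potential ω (m k)) := by
          field_simp
      _ ≤ 1 / κ * 1 * Real.exp (-potential ω (m k)) := by gcongr
      _ = _ := by rw [mul_one]
  · refine (hu.mu_mul_sq_le hω hκ y).trans
      ((mul_le_of_le_one_right (by positivity) (hu.le_one y)).trans ?_)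
    rw [div_eq_mul_one_div, mul_comm]
    gcongr

lemma card_box_le (N : ℕ) : ((box N).card : ℝ) ≤ 2 * N := by
  rw [box, Int.card_Ioo]
  have : ((N : ℤ) - -N - 1).toNat ≤ 2 * N := by lia
  exact_mod_cast this

lemma IsLandscape.sum_mass_le (hω : Elliptic κ ω) (hκ : 0 < κ) (hκ1 : κ ≤ 1)
    (hL : IsLandscape (potential ω) N m d h δ) (hh : 0 < h) (hδ : 0 < δ) {k : Fin q}
    (hu : IsEquilibrium ω N (latticeS N m k) (m k) u) (hN : 0 < N)
    (hNδ : 2 * N / κ * Real.exp (-δ) ≤ 1) :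
    ∑ y ∈ box N, mu ω y * u y ^ 2 ≤ 2 * N / κ * Real.exp (-potential ω (m k)) := by
  have h1 := Finset.sum_le_card_nsmul (box N) _ _ fun y hy =>
    hL.mass_le' hω hκ hκ1 hh hδ hu hN hNδ hy
  rw [nsmul_eq_mul] at h1
  refine h1.trans ((mul_le_mul_of_nonneg_right (card_box_le N) (by positivity)).trans
    (le_of_eq ?_))
  ring

lemma IsLandscape.le_sum_mass (hω : Elliptic κ ω) (hκ : 0 < κ)
    (hL : IsLandscape (potential ω) N m d h δ) {k : Fin q}
    (hu : IsEquilibrium ω N (latticeS N m k) (m k) u) :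
    Real.exp (-potential ω (m k)) ≤ ∑ y ∈ box N, mu ω y * u y ^ 2 := by
  have h1 := Finset.single_le_sum (s := box N) (f := fun y => mu ω y * u y ^ 2)
    (fun y _ => mul_nonneg (mu_pos hω hκ y).le (sq_nonneg _)) (a := m k) (by
      simp only [box, Finset.mem_Ioo]; exact ⟨hL.neg_lt k, hL.lt k⟩)
  refine le_trans ?_ h1
  rw [hu.eq_one, one_pow, mul_one]
  exact exp_neg_le_mu hω hκ _

/-- The equilibrium potentials are almost orthogonal. -/
lemma IsLandscape.overlap_le (hω : Elliptic κ ω) (hκ : 0 < κ) (hκ1 : κ ≤ 1)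
    (hL : IsLandscape (potential ω) N m d h δ) (hh : 0 < h) (hδ : 0 < δ) {k j : Fin q}
    (hkj : k ≠ j) {v : ℤ → ℝ} (hu : IsEquilibrium ω N (latticeS N m k) (m k) u)
    (hv : IsEquilibrium ω N (latticeS N m j) (m j) v) (hN : 0 < N)
    (hNδ : 2 * N / κ * Real.exp (-δ) ≤ 1) :
    (∑ y ∈ box N, mu ω y * (u y * v y)) ^ 2 ≤ 8 * N ^ 3 / κ ^ 3 * Real.exp (-δ) *
      (Real.exp (-potential ω (m k)) * Real.exp (-potential ω (m j))) := by
  have hN' : (1 : ℝ) ≤ N := by exact_mod_cast hN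
  have hpt : ∀ y ∈ box N, (mu ω y * (u y * v y)) ^ 2 ≤ 2 * N / κ ^ 3 * Real.exp (-δ) *
      (Real.exp (-potential ω (m k)) * Real.exp (-potential ω (m j))) := by
    intro y hy
    have e1 : (mu ω y * (u y * v y)) ^ 2 = (mu ω y * u y ^ 2) * (mu ω y * v y ^ 2) := by ring
    have hmu := (mu_pos hω hκ y).le
    have hu0 : 0 ≤ mu ω y * u y ^ 2 := by positivity
    have hv0 : 0 ≤ mu ω y * v y ^ 2 := by positivity
    have hu1 := hL.mass_le' hω hκ hκ1 hh hδ hu hN hNδ hy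
    have hv1 := hL.mass_le' hω hκ hκ1 hh hδ hv hN hNδ hy
    -- At each site one of the two masses carries the factor `e^{-δ}`; the other only needs the
    -- crude bound.
    have key : mu ω y * u y ^ 2 ≤ 2 * N / κ ^ 2 * Real.exp (-δ) * Real.exp (-potential ω (m k)) ∨
        mu ω y * v y ^ 2 ≤ 2 * N / κ ^ 2 * Real.exp (-δ) * Real.exp (-potential ω (m j)) := by
      rcases hL.mass_le hω hκ hκ1 hh hδ hu hN hy with h1 | ⟨h1, h2⟩
      · exact Or.inl h1
      rcases hL.mass_le hω hκ hκ1 hh hδ hv hN hy with h3 | ⟨h3, h4⟩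
      · exact Or.inr h3
      left
      -- If `y` is in both valleys, the route from `m k` through `y` to `m j` stays below `V(y) +
      -- h`, yet reaches `V(m k) + h + δ`.
      have h5 : potential ω (m k) + δ ≤ potential ω y := by
        obtain ⟨z, hz, hz'⟩ := hL.separated k j hkj.symm
        rcases Set.uIcc_subset_uIcc_union_uIcc (b := y) hz with h6 | h6
        · rw [Set.uIcc_comm] at h6
          linarith [h2 z h6]
        · linarith [h4 z h6]
      refine (hu.mu_mul_sq_le hω hκ y).trans
        ((mul_le_of_le_one_right (by positivity) (hu.le_one y)).trans ?_)
      have h2 : Real.exp (-potential ω y) ≤ Real.exp (-δ) * Real.exp (-potential ω (m k)) := by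
        rw [← Real.exp_add]; exact Real.exp_le_exp.2 (by linarith)
      have h3 : 1 / κ ≤ 2 * N / κ ^ 2 := by
        rw [div_le_div_iff₀ hκ (by positivity)]
        nlinarith
      calc Real.exp (-potential ω y) / κ = 1 / κ * Real.exp (-potential ω y) := by ring
        _ ≤ 2 * N / κ ^ 2 * (Real.exp (-δ) * Real.exp (-potential ω (m k))) :=
          mul_le_mul h3 h2 (Real.exp_pos _).le (by positivity)
        _ = _ := by ring
    rw [e1]
    rcases key with h1 | h1
    · refine (mul_le_mul h1 hv1 hv0 (by positivity)).trans (le_of_eq ?_)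
      field_simp
    · refine (mul_le_mul hu1 h1 hv0 (by positivity)).trans (le_of_eq ?_)
      field_simp
  -- Cauchy-Schwarz over at most `2 N` sites; two factors of the cardinality arise.
  have h1 := sq_sum_le_card_mul_sum_sq (s := box N) (f := fun y => mu ω y * (u y * v y))
  have h2 := Finset.sum_le_card_nsmul (box N) _ _ hpt
  rw [nsmul_eq_mul] at h2
  have hc := card_box_le N
  have hc0 : (0 : ℝ) ≤ (box N).card := Nat.cast_nonneg _
  refine h1.trans ?_
  set B := 2 * N / κ ^ 3 * Real.exp (-δ) *
      (Real.exp (-potential ω (m k)) * Real.exp (-potential ω (m j))) with hB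
  have hB0 : 0 ≤ B := by positivity
  calc _ ≤ ((box N).card : ℝ) * ((box N).card * B) := mul_le_mul_of_nonneg_left h2 hc0
    _ ≤ (2 * N) * (2 * N * B) := by gcongr
    _ = _ := by rw [hB]; ring

/-- The boundary of `m k` is contained in that of `m j`, so the site given by `gap` also bounds the
barrier of `m j`. -/
lemma IsLandscape.depth_add_le (hL : IsLandscape (potential ω) N m d h δ) {k j : Fin q}
    (hkj : k < j) : d j + δ ≤ d k := by
  obtain ⟨s, hs, h1⟩ := hL.gap k j hkj
  have hs' : s ∈ latticeS N m j := by
    rcases hs with ⟨i, hi, rfl⟩ | hs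
    · exact Or.inl ⟨i, hi.trans hkj, rfl⟩
    · exact Or.inr hs
  obtain ⟨z, hz, h2⟩ := hL.barrier_le j s hs'
  linarith [h1 z hz]

end

/-! ### Matrices that are symmetric with respect to a weight -/

section Weighted

variable {ι : Type*} (w : ι → ℝ) (hw : ∀ i, 0 < w i)

/-- The isometry from `L²(ι, w)` to the Euclidean space. -/
def emb : (ι → ℝ) ≃ₗ[ℝ] EuclideanSpace ℝ ι :=
  (LinearEquiv.piCongrRight fun i =>
    LinearEquiv.smulOfNeZero ℝ ℝ (√(w i)) (Real.sqrt_pos.2 (hw i)).ne').trans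
    (WithLp.linearEquiv 2 ℝ (ι → ℝ)).symm

lemma emb_apply (f : ι → ℝ) (i : ι) : emb w hw f i = √(w i) * f i := rfl

variable [Fintype ι]

lemma inner_emb (f g : ι → ℝ) : inner ℝ (emb w hw f) (emb w hw g) = ∑ i, w i * (f i * g i) := by
  rw [PiLp.inner_apply]
  refine Finset.sum_congr rfl fun i _ => ?_
  rw [emb_apply, emb_apply]
  simp only [RCLike.inner_apply, conj_trivial]
  have := Real.mul_self_sqrt (hw i).le
  linear_combination (f i * g i) * this

lemma norm_emb_sq (f : ι → ℝ) : ‖emb w hw f‖ ^ 2 = ∑ i, w i * f i ^ 2 := by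
  rw [← real_inner_self_eq_norm_sq, inner_emb]
  exact Finset.sum_congr rfl fun i _ => by ring

variable [DecidableEq ι]

/-- The operator on the Euclidean space that is conjugate to the matrix `L`. -/
def conjOp (L : Matrix ι ι ℝ) : EuclideanSpace ℝ ι →ₗ[ℝ] EuclideanSpace ℝ ι :=
  (emb w hw).conj (Matrix.toLin' L)

lemma conjOp_emb (L : Matrix ι ι ℝ) (f : ι → ℝ) :
    conjOp w hw L (emb w hw f) = emb w hw (L.mulVec f) := by
  simp [conjOp, LinearEquiv.conj_apply]

lemma conjOp_isSymmetric {L : Matrix ι ι ℝ} (hL : ∀ i j, w i * L i j = w j * L j i) :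
    (conjOp w hw L).IsSymmetric := by
  intro u v
  obtain ⟨f, rfl⟩ := (emb w hw).surjective u
  obtain ⟨g, rfl⟩ := (emb w hw).surjective v
  rw [conjOp_emb, conjOp_emb, inner_emb, inner_emb]
  simp only [Matrix.mulVec, dotProduct, Finset.sum_mul, Finset.mul_sum]
  rw [Finset.sum_comm]
  refine Finset.sum_congr rfl fun i _ => Finset.sum_congr rfl fun j _ => ?_
  linear_combination (f i * g j) * hL j i

lemma mem_spectrum_iff_exists_mulVec {L : Matrix ι ι ℝ} {r : ℝ} :
    r ∈ spectrum ℝ L ↔ ∃ f, f ≠ 0 ∧ L.mulVec f = r • f := by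
  rw [← Matrix.spectrum_toLin', ← Module.End.hasEigenvalue_iff_mem_spectrum]
  constructor
  · intro h
    obtain ⟨f, hf⟩ := h.exists_hasEigenvector
    exact ⟨f, hf.2, by simpa using hf.apply_eq_smul⟩
  · rintro ⟨f, hf, hf'⟩
    exact Module.End.hasEigenvalue_of_hasEigenvector
      ⟨Module.End.mem_eigenspace_iff.2 (by simpa using hf'), hf⟩

lemma mem_spectrum_iff_exists_conjOp {L : Matrix ι ι ℝ} {r : ℝ} :
    r ∈ spectrum ℝ L ↔ ∃ u, u ≠ 0 ∧ conjOp w hw L u = r • u := by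
  rw [mem_spectrum_iff_exists_mulVec]
  constructor
  · rintro ⟨f, hf, hf'⟩
    exact ⟨emb w hw f, by simpa using hf, by rw [conjOp_emb, hf', map_smul]⟩
  · rintro ⟨u, hu, hu'⟩
    obtain ⟨f, rfl⟩ := (emb w hw).surjective u
    refine ⟨f, by simpa using hu, (emb w hw).injective ?_⟩
    rw [← conjOp_emb, hu', map_smul]

end Weighted

lemma exists_least_eigenvalue {E : Type*} [NormedAddCommGroup E] [InnerProductSpace ℝ E]
    [FiniteDimensional ℝ E] [Nontrivial E] {T : E →ₗ[ℝ] E} (hT : T.IsSymmetric) :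
    ∃ l, (∃ u, u ≠ 0 ∧ T u = l • u) ∧ ∀ f, l * ‖f‖ ^ 2 ≤ inner ℝ (T f) f := by
  set b := hT.eigenvectorBasis rfl
  set e := hT.eigenvalues rfl
  have hb : ∀ i, T (b i) = e i • b i := fun i => hT.apply_eigenvectorBasis rfl i
  have : Nonempty (Fin (Module.finrank ℝ E)) := ⟨⟨0, Module.finrank_pos⟩⟩
  obtain ⟨i, -, hi⟩ := Finset.exists_min_image Finset.univ e Finset.univ_nonempty
  refine ⟨e i, ⟨b i, b.orthonormal.ne_zero i, hb i⟩, fun f => ?_⟩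
  rw [IsTrialSystem.form_eq_sum hb, IsTrialSystem.norm_sq_eq_sum (b := b), Finset.mul_sum]
  exact Finset.sum_le_sum fun j hj => mul_le_mul_of_nonneg_right (hi j hj) (sq_nonneg _)

/-! ### The generator -/

section
variable {κ : ℝ} {ω : Environment} {N : ℕ}

/-- Zero boundary conditions are encoded by extension by zero, so that harmonic functions on the
whole lattice can be used. -/
lemma generator_mulVec (ω : Environment) (D : Finset ℤ) (f : D → ℝ) (x : D) :
    (generator ω D).mulVec f x = lap ω (extend D f) x := by
  have h1 : ∀ y : D, generator ω D x y * f y = (if x = y then f y else 0)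
      - transition ω x y * extend D f y := fun y => by
    rw [extend_coe, generator, Matrix.of_apply, sub_mul, ite_mul, one_mul, zero_mul]
  have h2 : ∑ y : D, transition ω x y * extend D f y
      = ω x * extend D f (x + 1) + (1 - ω x) * extend D f (x - 1) := by
    rw [Finset.sum_coe_sort D fun y => transition ω x y * extend D f y]
    have h3 : ∀ y, transition ω x y * extend D f y
        = (if y = (x : ℤ) + 1 then ω x * extend D f y else 0)
          + (if y = (x : ℤ) - 1 then (1 - ω x) * extend D f y else 0) := fun y => by
      unfold transition
      split_ifs with h4 h5
      · exact absurd h4 (by lia)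
      all_goals simp
    simp only [h3, Finset.sum_add_distrib, Finset.sum_ite_eq']
    congr 1
    · split_ifs with h4
      · rfl
      · rw [extend_of_notMem f h4, mul_zero]
    · split_ifs with h4
      · rfl
      · rw [extend_of_notMem f h4, mul_zero]
  rw [Matrix.mulVec, dotProduct, Finset.sum_congr rfl fun y _ => h1 y, Finset.sum_sub_distrib, h2,
    Finset.sum_ite_eq, if_pos (Finset.mem_univ x), lap, extend_coe]
  ring

lemma mu_mul_transition (hω : Elliptic κ ω) (hκ : 0 < κ) (x y : ℤ) :
    mu ω x * transition ω x y = mu ω y * transition ω y x := by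
  unfold transition
  rcases eq_or_ne y (x + 1) with rfl | h1
  · rw [if_pos rfl, if_neg (by lia), if_pos (by lia), mu_mul_right hω hκ, mu_mul_left hω hκ]
  · rw [if_neg h1]
    rcases eq_or_ne y (x - 1) with rfl | h2
    · have h3 := mu_mul_left hω hκ (x - 1)
      rw [sub_add_cancel] at h3
      rw [if_pos rfl, if_pos (by lia), mu_mul_right hω hκ, h3]
    · rw [if_neg h2, if_neg (by lia), if_neg (by lia), mul_zero, mul_zero]

lemma mu_mul_generator (hω : Elliptic κ ω) (hκ : 0 < κ) (D : Finset ℤ) (x y : D) :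
    mu ω x * generator ω D x y = mu ω y * generator ω D y x := by
  have h1 := mu_mul_transition hω hκ (x : ℤ) y
  simp only [generator, Matrix.of_apply, mul_sub, h1]
  congr 1
  by_cases h2 : x = y
  · rw [h2]
  · rw [if_neg h2, if_neg (Ne.symm h2), mul_zero, mul_zero]

/-- The isometry from `L²(D, μ)` to the Euclidean space. -/
abbrev muEmb (hω : Elliptic κ ω) (hκ : 0 < κ) (D : Finset ℤ) :
    (D → ℝ) ≃ₗ[ℝ] EuclideanSpace ℝ D :=
  emb (fun x : D => mu ω x) fun x => mu_pos hω hκ x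

/-- The generator as an operator on the Euclidean space. -/
abbrev generatorOp (hω : Elliptic κ ω) (hκ : 0 < κ) (D : Finset ℤ) :
    EuclideanSpace ℝ D →ₗ[ℝ] EuclideanSpace ℝ D :=
  conjOp (fun x : D => mu ω x) (fun x => mu_pos hω hκ x) (generator ω D)

lemma generatorOp_isSymmetric (hω : Elliptic κ ω) (hκ : 0 < κ) (D : Finset ℤ) :
    (generatorOp hω hκ D).IsSymmetric :=
  conjOp_isSymmetric _ _ (mu_mul_generator hω hκ D)

lemma norm2_eq (hω : Elliptic κ ω) (hκ : 0 < κ) (D : Finset ℤ) (f : D → ℝ) :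
    norm2 ω D f = ‖muEmb hω hκ D f‖ := by
  rw [norm2, ← norm_emb_sq, Real.sqrt_sq (norm_nonneg _)]

lemma inner_muEmb (hω : Elliptic κ ω) (hκ : 0 < κ) (D : Finset ℤ) (f g : D → ℝ) :
    inner ℝ (muEmb hω hκ D f) (muEmb hω hκ D g)
      = ∑ x ∈ D, mu ω x * (extend D f x * extend D g x) := by
  rw [inner_emb, ← Finset.sum_coe_sort D fun x => mu ω x * (extend D f x * extend D g x)]
  exact Finset.sum_congr rfl fun x _ => by rw [extend_coe, extend_coe]

lemma norm_muEmb_sq (hω : Elliptic κ ω) (hκ : 0 < κ) (D : Finset ℤ) (f : D → ℝ) :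
    ‖muEmb hω hκ D f‖ ^ 2 = ∑ x ∈ D, mu ω x * extend D f x ^ 2 := by
  rw [norm_emb_sq, ← Finset.sum_coe_sort D fun x => mu ω x * extend D f x ^ 2]
  exact Finset.sum_congr rfl fun x _ => by rw [extend_coe]

lemma inner_generatorOp (hω : Elliptic κ ω) (hκ : 0 < κ) (D : Finset ℤ) (f g : D → ℝ) :
    inner ℝ (generatorOp hω hκ D (muEmb hω hκ D f)) (muEmb hω hκ D g)
      = ∑ x ∈ D, mu ω x * (lap ω (extend D f) x * extend D g x) := by
  rw [conjOp_emb, inner_emb,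
    ← Finset.sum_coe_sort D fun x => mu ω x * (lap ω (extend D f) x * extend D g x)]
  exact Finset.sum_congr rfl fun x _ => by rw [extend_coe, generator_mulVec]

/-- Generators on different subsets of the box share one form, which allows the threshold of the
smaller set to be used on the box. -/
lemma inner_generatorOp_self (hω : Elliptic κ ω) (hκ : 0 < κ) {D : Finset ℤ} (hD : D ⊆ box N)
    (f : D → ℝ) :
    inner ℝ (generatorOp hω hκ D (muEmb hω hκ D f)) (muEmb hω hκ D f)
      = energy ω N (extend D f) := by
  rw [inner_generatorOp, ← sum_mu_mul_lap hω hκ]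
  · rw [← Finset.sum_subset hD fun x _ hx => by
      rw [extend_of_notMem f hx, zero_mul, mul_zero]]
    exact Finset.sum_congr rfl fun x _ => by ring
  · exact extend_of_notMem f fun hx => by have := hD hx; simp [box] at this
  · exact extend_of_notMem f fun hx => by have := hD hx; simp [box] at this

lemma norm_muEmb_sq' (hω : Elliptic κ ω) (hκ : 0 < κ) {D : Finset ℤ} (hD : D ⊆ box N)
    (f : D → ℝ) : ‖muEmb hω hκ D f‖ ^ 2 = ∑ x ∈ box N, mu ω x * extend D f x ^ 2 := by
  rw [norm_muEmb_sq]
  exact Finset.sum_subset hD fun x _ hx => by rw [extend_of_notMem f hx]; simp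

variable {q : ℕ} {m : Fin q → ℤ} {d : Fin q → ℝ} {h δ : ℝ}

/-- By `exhaustive`, every site reaches a zero of `f` by climbing at most `h`; the pointwise bound
is then summed over at most `2 N` sites. -/
lemma IsLandscape.norm_sq_le_energy (hω : Elliptic κ ω) (hκ : 0 < κ)
    (hL : IsLandscape (potential ω) N m d h δ) {f : ℤ → ℝ} (hf : ∀ k, f (m k) = 0)
    (hfN : f N = 0) (hfN' : f (-N) = 0) :
    ∑ x ∈ box N, mu ω x * f x ^ 2 ≤ 4 * N ^ 2 / κ * Real.exp h * energy ω N f := by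
  have h1 : ∀ y ∈ box N, mu ω y * f y ^ 2 ≤ 2 * N / κ * Real.exp h * energy ω N f := by
    intro y hy
    simp only [box, Finset.mem_Ioo] at hy
    rcases hL.exhaustive y hy.1 hy.2 with ⟨k, -, h1⟩ | h1 | h1
    · exact mu_mul_sq_le_energy hω hκ hy.1.le hy.2.le (hL.neg_lt k).le (hL.lt k).le (hf k) h1
    · exact mu_mul_sq_le_energy hω hκ hy.1.le hy.2.le (by lia) le_rfl hfN h1
    · exact mu_mul_sq_le_energy hω hκ hy.1.le hy.2.le le_rfl (by lia) hfN' h1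
  have h2 := Finset.sum_le_card_nsmul _ _ _ h1
  have hE := energy_nonneg ω N f
  rw [nsmul_eq_mul] at h2
  refine h2.trans ((mul_le_mul_of_nonneg_right (card_box_le N) (by positivity)).trans
    (le_of_eq ?_))
  ring

/-- The threshold: the smallest eigenvalue of the generator with additional zero conditions. -/
lemma IsLandscape.exists_threshold (hω : Elliptic κ ω) (hκ : 0 < κ)
    (hL : IsLandscape (potential ω) N m d h δ) {D : Finset ℤ} (hD : D.Nonempty)
    (hDbox : ∀ y, y ∈ D ↔ y ∈ box N ∧ ∀ k, y ≠ m k) (hN : 0 < N) :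
    ∃ l, IsLeast (spectrum ℝ (generator ω D)) l ∧ κ / (4 * N ^ 2) * Real.exp (-h) ≤ l ∧
      ∀ f : box N → ℝ, (∀ k, extend (box N) f (m k) = 0) →
        l * ‖muEmb hω hκ (box N) f‖ ^ 2 ≤
          inner ℝ (generatorOp hω hκ (box N) (muEmb hω hκ (box N) f)) (muEmb hω hκ (box N) f) := by
  have hN' : (0 : ℝ) < N := by positivity
  have hsub : D ⊆ box N := fun y hy => ((hDbox y).1 hy).1
  have : Nonempty D := hD.to_subtype
  obtain ⟨l, ⟨u, hu0, hu⟩, hl⟩ := exists_least_eigenvalue (generatorOp_isSymmetric hω hκ D)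
  refine ⟨l, ⟨(mem_spectrum_iff_exists_conjOp _ _).2 ⟨u, hu0, hu⟩, fun r hr => ?_⟩, ?_, ?_⟩
  · obtain ⟨v, hv0, hv⟩ := (mem_spectrum_iff_exists_conjOp _ fun x : D => mu_pos hω hκ x).1 hr
    have h1 := hl v
    rw [hv, real_inner_smul_left, real_inner_self_eq_norm_sq] at h1
    exact le_of_mul_le_mul_right h1 (by positivity)
  · obtain ⟨f, rfl⟩ := (muEmb hω hκ D).surjective u
    have h1 := inner_generatorOp_self hω hκ hsub f
    rw [hu, real_inner_smul_left, real_inner_self_eq_norm_sq] at h1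
    have h2 := hL.norm_sq_le_energy hω hκ (f := extend D f)
      (fun k => extend_of_notMem f fun hk => ((hDbox _).1 hk).2 k rfl)
      (extend_of_notMem f fun hx => by have := hsub hx; simp [box] at this)
      (extend_of_notMem f fun hx => by have := hsub hx; simp [box] at this)
    rw [← norm_muEmb_sq' hω hκ hsub, ← h1] at h2
    have h3 : 0 < ‖muEmb hω hκ D f‖ ^ 2 := by positivity
    have h4 : 1 ≤ 4 * N ^ 2 / κ * Real.exp h * l := by
      refine le_of_mul_le_mul_right ?_ h3
      linarith
    rw [Real.exp_neg, div_mul_eq_mul_div, div_le_iff₀ (by positivity), ← div_eq_mul_inv,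
      div_le_iff₀ (Real.exp_pos h)]
    rw [div_mul_eq_mul_div, div_mul_eq_mul_div, le_div_iff₀ hκ] at h4
    linarith
  · intro f hf
    -- A function on the box that vanishes at the points `m k` is the extension by zero of its
    -- restriction to `D`.
    have h1 : extend D (fun x : D => extend (box N) f x) = extend (box N) f := by
      funext y
      by_cases hy : y ∈ D
      · exact extend_coe _ (⟨y, hy⟩ : D)
      · rw [extend_of_notMem _ hy]
        by_cases hy' : y ∈ box N
        · have : ∃ k, y = m k := by
            by_contra! h0
            exact hy ((hDbox y).2 ⟨hy', h0⟩)
          obtain ⟨k, rfl⟩ := this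
          exact (hf k).symm
        · exact (extend_of_notMem _ hy').symm
    have h2 := hl (muEmb hω hκ D fun x : D => extend (box N) f x)
    rw [inner_generatorOp_self hω hκ hsub, norm_muEmb_sq' hω hκ hsub, h1] at h2
    rwa [inner_generatorOp_self hω hκ subset_rfl, norm_muEmb_sq' hω hκ subset_rfl]

end

/-! ### The eigenvalues of the generator -/

section
variable {κ : ℝ} {ω : Environment} {N q : ℕ} {m : Fin q → ℤ} {d : Fin q → ℝ} {h δ : ℝ}

/-- The Dirichlet form of an equilibrium potential and a function that vanishes on its boundary
and at its pole. -/
lemma IsEquilibrium.sum_lap_mul_eq_zero {A : Set ℤ} {p : ℤ} {u : ℤ → ℝ}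
    (hu : IsEquilibrium ω N A p u) {g : ℤ → ℝ} (hg : ∀ y ∈ A, g y = 0) (hgp : g p = 0) :
    ∑ y ∈ box N, mu ω y * (lap ω u y * g y) = 0 := by
  refine Finset.sum_eq_zero fun y hy => ?_
  simp only [box, Finset.mem_Ioo] at hy
  by_cases hyA : y ∈ A
  · rw [hg y hyA, mul_zero, mul_zero]
  by_cases hyp : y = p
  · rw [hyp, hgp, mul_zero, mul_zero]
  · rw [hu.harmonic y hy.1 hy.2 hyA hyp, zero_mul, mul_zero]

lemma IsEquilibrium.sum_lap_mul_self {A : Set ℤ} {p : ℤ} {u : ℤ → ℝ}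
    (hu : IsEquilibrium ω N A p u) (hp : p ∈ box N) :
    ∑ y ∈ box N, mu ω y * (lap ω u y * u y) = mu ω p * lap ω u p := by
  rw [Finset.sum_eq_single p]
  · rw [hu.eq_one, mul_one]
  · intro y hy hyp
    simp only [box, Finset.mem_Ioo] at hy
    by_cases hyA : y ∈ A
    · rw [hu.eq_zero y hyA, mul_zero, mul_zero]
    · rw [hu.harmonic y hy.1 hy.2 hyA hyp, zero_mul, mul_zero]
  · exact fun h0 => absurd hp h0

/-- The matrix of values is triangular with unit diagonal, hence invertible. Subtracting such a
combination brings any function into `vanishing`. -/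
lemma exists_combination {U : Fin q → ℤ → ℝ} (hU1 : ∀ k, U k (m k) = 1)
    (hU0 : ∀ i k, i < k → U k (m i) = 0) (g : Fin q → ℝ) :
    ∃ a : Fin q → ℝ, ∀ i, ∑ k, a k * U k (m i) = g i := by
  let H : Matrix (Fin q) (Fin q) ℝ := Matrix.of fun i k => U k (m i)
  have hdet : H.det = 1 := by
    rw [Matrix.det_of_isLowerTriangular H (fun i j hij => hU0 i j hij)]
    exact Finset.prod_eq_one fun k _ => hU1 k
  have hsurj : Function.Surjective H.mulVec := by
    rw [Matrix.mulVec_surjective_iff_isUnit, Matrix.isUnit_iff_isUnit_det, hdet]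
    exact isUnit_one
  obtain ⟨a, ha⟩ := hsurj g
  refine ⟨a, fun i => ?_⟩
  rw [← ha]
  exact Finset.sum_congr rfl fun k _ => mul_comm _ _

lemma extend_smul (D : Finset ℤ) (c : ℝ) (f : D → ℝ) (y : ℤ) :
    extend D (c • f) y = c * extend D f y := by
  unfold extend
  split_ifs
  · rfl
  · rw [mul_zero]

lemma extend_sub (D : Finset ℤ) (f g : D → ℝ) (y : ℤ) :
    extend D (f - g) y = extend D f y - extend D g y := by
  unfold extend
  split_ifs
  · rfl
  · rw [sub_zero]

lemma extend_sum {ι : Type*} (s : Finset ι) (D : Finset ℤ) (f : ι → D → ℝ) (y : ℤ) :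
    extend D (∑ i ∈ s, f i) y = ∑ i ∈ s, extend D (f i) y := by
  unfold extend
  split_ifs
  · rw [Finset.sum_apply]
  · rw [Finset.sum_const_zero]

/-- The functions on `(-N, N)` that vanish at the points `m`, in the Euclidean space. -/
def vanishing (hω : Elliptic κ ω) (hκ : 0 < κ) (N : ℕ) (m : Fin q → ℤ) :
    Submodule ℝ (EuclideanSpace ℝ (box N)) where
  carrier := {v | ∀ k, extend (box N) ((muEmb hω hκ (box N)).symm v) (m k) = 0}
  add_mem' := by
    intro u v hu hv k
    have h1 := extend_sub (box N) ((muEmb hω hκ (box N)).symm u)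
      ((-1 : ℝ) • (muEmb hω hκ (box N)).symm v) (m k)
    rw [extend_smul, hu k, hv k] at h1
    rw [map_add]
    simpa using h1
  zero_mem' := by
    intro k
    have h1 := extend_smul (box N) 0 ((muEmb hω hκ (box N)).symm 0) (m k)
    simpa using h1
  smul_mem' := by
    intro c v hv k
    rw [map_smul, extend_smul, hv k, mul_zero]

/-- The expression for the `k`-th eigenvalue in terms of the equilibrium potential. -/
def approxEigenvalue (ω : Environment) (N : ℕ) (x : Fin q → ℝ) (m : Fin q → ℤ) (k : Fin q) : ℝ :=
  mu ω (m k) * hitProb ω N (m k) (S x k) {x k} / norm2 ω (box N) (eqPotential ω N x k) ^ 2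

lemma norm2_eqPotential_bounds (hω : Elliptic κ ω) (hκ : 0 < κ) (hκ1 : κ ≤ 1) (hN : 0 < N)
    {x : Fin q → ℝ} (hxm : ∀ k, x k = m k / N) (hL : IsLandscape (potential ω) N m d h δ)
    (hh : 0 < h) (hδ : 0 < δ) (hNδ : 2 * N / κ * Real.exp (-δ) ≤ 1) (k : Fin q) :
    Real.exp (-potential ω (m k)) ≤ norm2 ω (box N) (eqPotential ω N x k) ^ 2 ∧
      norm2 ω (box N) (eqPotential ω N x k) ^ 2 ≤ 2 * N / κ * Real.exp (-potential ω (m k)) := by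
  rw [norm2_eq hω hκ, norm_muEmb_sq]
  have hU := isEquilibrium_eqPotential hN hxm hL k
  exact ⟨hL.le_sum_mass hω hκ hU, hL.sum_mass_le hω hκ hκ1 hh hδ hU hN hNδ⟩

/-- Capacity and squared norm both carry the factor `e^{-V(m k)}`, which cancels; only the depth `d
k` remains. -/
lemma approxEigenvalue_bounds (hω : Elliptic κ ω) (hκ : 0 < κ) (hκ1 : κ ≤ 1) (hN : 0 < N)
    {x : Fin q → ℝ} (hxm : ∀ k, x k = m k / N) (hL : IsLandscape (potential ω) N m d h δ)
    (hh : 0 < h) (hδ : 0 < δ) (hNδ : 2 * N / κ * Real.exp (-δ) ≤ 1) (k : Fin q) :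
    κ / (4 * N ^ 2) * Real.exp (-d k) ≤ approxEigenvalue ω N x m k ∧
      approxEigenvalue ω N x m k ≤ (1 + 1 / κ) * Real.exp (-d k) := by
  have hN' : (0 : ℝ) < N := by positivity
  obtain ⟨h1, h2⟩ := norm2_eqPotential_bounds hω hκ hκ1 hN hxm hL hh hδ hNδ k
  have hU := isEquilibrium_eqPotential hN hxm hL k
  have h3 := hL.capacity_le hω hκ (by linarith) hU
  have h4 := hL.le_capacity hω hκ hU hN
  have hV := Real.exp_pos (-potential ω (m k))
  rw [lap_eqPotential hω hκ hN hxm hL] at h3 h4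
  rw [approxEigenvalue]
  constructor
  · rw [le_div_iff₀ (hV.trans_le h1)]
    calc κ / (4 * N ^ 2) * Real.exp (-d k) * norm2 ω (box N) (eqPotential ω N x k) ^ 2
        ≤ κ / (4 * N ^ 2) * Real.exp (-d k) * (2 * N / κ * Real.exp (-potential ω (m k))) := by
          gcongr
      _ = 1 / (2 * N) * Real.exp (-d k) * Real.exp (-potential ω (m k)) := by
          field_simp; norm_num
      _ ≤ _ := h4
  · rw [div_le_iff₀ (hV.trans_le h1)]
    exact h3.trans (mul_le_mul_of_nonneg_left h1 (by positivity))

/-- The tenth power is a budget. A squared overlap has the factor `θ ^ 10`, of which `θ ^ 6` absorbs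
`N ^ 3` and `θ ^ 4 = ε ^ 2` remains. A ratio of eigenvalues also has `θ ^ 10`, of which `θ ^ 8`
absorbs the polynomial constants and `θ ^ 2 = ε` remains. -/
theorem IsLandscape.isTrialSystem (hω : Elliptic κ ω) (hκ : 0 < κ) (hκ1 : κ ≤ 1) (hN : 0 < N)
    {x : Fin q → ℝ} (hxm : ∀ k, x k = m k / N) (hL : IsLandscape (potential ω) N m d h δ)
    (hh : 0 < h) (hδ : 0 < δ) {θ l : ℝ} (hθ : 0 < θ) (hexp : Real.exp (-δ) = θ ^ 10)
    (h1 : 2 * N / κ * θ ^ 10 ≤ 1) (h2 : 8 * N ^ 3 / κ ^ 3 * θ ^ 6 ≤ 1)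
    (h3 : (1 + 1 / κ) * θ ^ 8 ≤ κ / (4 * N ^ 2)) (h4 : 48 * q ^ 2 * θ ^ 2 < 1) (hq : 0 < q)
    (hl : κ / (4 * N ^ 2) * Real.exp (-h) ≤ l)
    (hcoer : ∀ f : box N → ℝ, (∀ k, extend (box N) f (m k) = 0) →
        l * ‖muEmb hω hκ (box N) f‖ ^ 2 ≤
          inner ℝ (generatorOp hω hκ (box N) (muEmb hω hκ (box N) f)) (muEmb hω hκ (box N) f)) :
    IsTrialSystem (generatorOp hω hκ (box N))
      (fun k => (norm2 ω (box N) (eqPotential ω N x k))⁻¹ •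
        muEmb hω hκ (box N) (eqPotential ω N x k))
      (approxEigenvalue ω N x m) (vanishing hω hκ N m) l (θ ^ 2) := by
  have hN' : (0 : ℝ) < N := by positivity
  have hNδ : 2 * N / κ * Real.exp (-δ) ≤ 1 := by rwa [hexp]
  have hU := fun k => isEquilibrium_eqPotential hN hxm hL k
  have hbox : ∀ k, m k ∈ box N := fun k => by
    simp only [box, Finset.mem_Ioo]; exact ⟨hL.neg_lt k, hL.lt k⟩
  have hmS : ∀ i k : Fin q, i < k → m i ∈ latticeS N m k := fun i k hik => Or.inl ⟨i, hik, rfl⟩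
  have hmono : ∀ i k : Fin q, i < k → latticeS N m i ⊆ latticeS N m k := by
    rintro i k hik s (⟨j, hj, rfl⟩ | hs)
    · exact Or.inl ⟨j, hj.trans hik, rfl⟩
    · exact Or.inr hs
  have hnb := norm2_eqPotential_bounds hω hκ hκ1 hN hxm hL hh hδ hNδ
  have hΛ := approxEigenvalue_bounds hω hκ hκ1 hN hxm hL hh hδ hNδ
  set n := fun k => norm2 ω (box N) (eqPotential ω N x k) with hn
  have hnpos : ∀ k, 0 < n k := fun k => by
    have h5 : 0 < n k ^ 2 := (Real.exp_pos _).trans_le (hnb k).1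
    have h6 : 0 ≤ n k := Real.sqrt_nonneg _
    exact lt_of_le_of_ne h6 fun h0 => by rw [← h0] at h5; norm_num at h5
  set T := generatorOp hω hκ (box N) with hT
  have hTsym : T.IsSymmetric := generatorOp_isSymmetric hω hκ (box N)
  have hform : ∀ i : Fin q, ∀ g : box N → ℝ,
      (∀ y ∈ latticeS N m i, extend (box N) g y = 0) → extend (box N) g (m i) = 0 →
      inner ℝ (T ((n i)⁻¹ • muEmb hω hκ (box N) (eqPotential ω N x i)))
        (muEmb hω hκ (box N) g) = 0 := by
    intro i g hg hg'
    rw [map_smul, real_inner_smul_left, inner_generatorOp, (hU i).sum_lap_mul_eq_zero hg hg',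
      mul_zero]
  -- The potential of larger label vanishes wherever the generator of the other can be nonzero;
  -- symmetry covers the opposite order.
  have hform_lt : ∀ i j, i < j →
      inner ℝ (T ((n i)⁻¹ • muEmb hω hκ (box N) (eqPotential ω N x i)))
        ((n j)⁻¹ • muEmb hω hκ (box N) (eqPotential ω N x j)) = 0 := by
    intro i j hij
    rw [real_inner_smul_right, hform, mul_zero]
    · exact fun y hy => (hU j).eq_zero y (hmono i j hij hy)
    · exact (hU j).eq_zero _ (hmS i j hij)
  have hsmall : ∀ t s : ℝ, t + δ ≤ s → (1 + 1 / κ) * Real.exp (-s)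
      ≤ θ ^ 2 * (κ / (4 * N ^ 2) * Real.exp (-t)) := by
    intro t s hts
    calc (1 + 1 / κ) * Real.exp (-s) ≤ (1 + 1 / κ) * (Real.exp (-t) * θ ^ 10) := by
          rw [← hexp, ← Real.exp_add]; gcongr; linarith
      _ = θ ^ 2 * ((1 + 1 / κ) * θ ^ 8 * Real.exp (-t)) := by ring
      _ ≤ _ := by gcongr
  constructor
  · intro k
    rw [norm_smul, ← norm2_eq, norm_inv, Real.norm_eq_abs]
    change |n k|⁻¹ * n k = 1
    rw [abs_of_pos (hnpos k), inv_mul_cancel₀ (hnpos k).ne']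
  · intro i j hij
    rw [real_inner_smul_left, real_inner_smul_right, inner_muEmb]
    have h5 := hL.overlap_le hω hκ hκ1 hh hδ hij (hU i) (hU j) hN hNδ
    set X := ∑ y ∈ box N, mu ω y * (extend (box N) (eqPotential ω N x i) y *
      extend (box N) (eqPotential ω N x j) y) with hX
    have hi := hnpos i
    have hj := hnpos j
    refine abs_le_of_sq_le_sq ?_ (by positivity)
    have h6 : X ^ 2 ≤ θ ^ 4 * (n i ^ 2 * n j ^ 2) := by
      refine h5.trans ?_
      calc 8 * N ^ 3 / κ ^ 3 * Real.exp (-δ) *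
            (Real.exp (-potential ω (m i)) * Real.exp (-potential ω (m j)))
          ≤ 8 * N ^ 3 / κ ^ 3 * θ ^ 10 * (n i ^ 2 * n j ^ 2) := by
            rw [hexp]
            have := (hnb i).1
            have := (hnb j).1
            gcongr
        _ = θ ^ 4 * (8 * N ^ 3 / κ ^ 3 * θ ^ 6) * (n i ^ 2 * n j ^ 2) := by ring
        _ ≤ θ ^ 4 * 1 * (n i ^ 2 * n j ^ 2) := by gcongr
        _ = _ := by ring
    calc ((n i)⁻¹ * ((n j)⁻¹ * X)) ^ 2 = X ^ 2 / (n i ^ 2 * n j ^ 2) := by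
          field_simp
      _ ≤ (θ ^ 2) ^ 2 := by
          rw [div_le_iff₀ (by positivity)]
          refine h6.trans (le_of_eq ?_)
          ring
  · intro i j hij
    rcases lt_or_gt_of_ne hij with h5 | h5
    · exact hform_lt i j h5
    · rw [hTsym, real_inner_comm]
      exact hform_lt j i h5
  · intro k
    rw [map_smul, real_inner_smul_left, real_inner_smul_right, inner_generatorOp,
      (hU k).sum_lap_mul_self (hbox k), lap_eqPotential hω hκ hN hxm hL, approxEigenvalue]
    change (n k)⁻¹ * ((n k)⁻¹ * _) = _ / n k ^ 2
    have := (hnpos k).ne'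
    field_simp
  · intro i w hw
    obtain ⟨g, rfl⟩ := (muEmb hω hκ (box N)).surjective w
    have hg : ∀ k, extend (box N) g (m k) = 0 := fun k => by simpa using hw k
    refine hform i g ?_ (hg i)
    rintro y (⟨j, -, rfl⟩ | rfl | rfl)
    · exact hg j
    · exact extend_of_notMem g (by simp [box])
    · exact extend_of_notMem g (by simp [box])
  · intro w hw
    obtain ⟨g, rfl⟩ := (muEmb hω hκ (box N)).surjective w
    exact hcoer g fun k => by simpa using hw k
  · intro f
    obtain ⟨g, rfl⟩ := (muEmb hω hκ (box N)).surjective f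
    obtain ⟨a, ha⟩ := exists_combination (U := fun k => extend (box N) (eqPotential ω N x k))
      (fun k => (hU k).eq_one) (fun i k hik => (hU k).eq_zero _ (hmS i k hik))
      fun i => extend (box N) g (m i)
    refine ⟨fun k => a k * n k, fun k => ?_⟩
    have h5 : ∑ i, (a i * n i) • (n i)⁻¹ • muEmb hω hκ (box N) (eqPotential ω N x i)
        = muEmb hω hκ (box N) (∑ i, a i • eqPotential ω N x i) := by
      rw [map_sum]
      refine Finset.sum_congr rfl fun i _ => ?_
      rw [map_smul, smul_smul, mul_assoc, mul_inv_cancel₀ (hnpos i).ne', mul_one]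
    rw [h5, ← map_sub, LinearEquiv.symm_apply_apply, extend_sub, extend_sum,
      Finset.sum_congr rfl fun i _ => extend_smul _ _ _ _, ha, sub_self]
  · intro k
    exact lt_of_lt_of_le (by positivity) (hΛ k).1
  · intro i j hij
    refine (hΛ i).2.trans ((hsmall (d j) (d i) (hL.depth_add_le hij)).trans ?_)
    exact mul_le_mul_of_nonneg_left (hΛ j).1 (by positivity)
  · intro i
    refine (hΛ i).2.trans ((hsmall h (d i) (hL.depth i)).trans ?_)
    exact mul_le_mul_of_nonneg_left hl (by positivity)
  · exact lt_of_lt_of_le (by positivity) hl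
  · positivity
  · exact hq
  · exact h4

theorem IsLandscape.exists_eigenvalues (hω : Elliptic κ ω) (hκ : 0 < κ) (hκ1 : κ ≤ 1) (hN : 0 < N)
    {x : Fin q → ℝ} (hxm : ∀ k, x k = m k / N) (hL : IsLandscape (potential ω) N m d h δ)
    (hh : 0 < h) (hδ : 0 < δ) {θ : ℝ} (hθ : 0 < θ) (hexp : Real.exp (-δ) = θ ^ 10)
    (h1 : 2 * N / κ * θ ^ 10 ≤ 1) (h2 : 8 * N ^ 3 / κ ^ 3 * θ ^ 6 ≤ 1)
    (h3 : (1 + 1 / κ) * θ ^ 8 ≤ κ / (4 * N ^ 2)) (h4 : 48 * q ^ 2 * θ < 1) (hθ1 : θ ≤ 1)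
    (hq : 0 < q) {D : Finset ℤ} (hD : D.Nonempty)
    (hDbox : ∀ y, y ∈ D ↔ y ∈ box N ∧ ∀ k, y ≠ m k) :
    ∃ (lamStar : ℝ) (lam : Fin q → ℝ), IsLeast (spectrum ℝ (generator ω D)) lamStar ∧
      StrictMono lam ∧
      spectrum ℝ (generator ω (box N)) ∩ Set.Iio lamStar = Set.range lam ∧
      κ / (4 * N ^ 2) * Real.exp (-h) ≤ lamStar ∧
      ∀ k, |lam k - approxEigenvalue ω N x m k| ≤ θ * approxEigenvalue ω N x m k ∧
        κ / (8 * N ^ 2) * Real.exp (-d k) ≤ lam k ∧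
        lam k ≤ 2 * (1 + 1 / κ) * Real.exp (-d k) ∧
        ∃ ψ : box N → ℝ, norm2 ω (box N) ψ = 1 ∧
          (generator ω (box N)).mulVec ψ = lam k • ψ ∧
          norm2 ω (box N) (fun n => ψ n
            - eqPotential ω N x k n / norm2 ω (box N) (eqPotential ω N x k)) ≤ θ := by
  have hN' : (0 : ℝ) < N := by positivity
  have hNδ : 2 * N / κ * Real.exp (-δ) ≤ 1 := by rwa [hexp]
  obtain ⟨l, hleast, hl, hcoer⟩ := hL.exists_threshold hω hκ hD hDbox hN
  have hq2 : (0 : ℝ) ≤ q ^ 2 := by positivity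
  have hθθ : θ ^ 2 ≤ θ := by nlinarith
  have h4' : 48 * q ^ 2 * θ ^ 2 < 1 := by nlinarith
  have hsys := hL.isTrialSystem hω hκ hκ1 hN hxm hh hδ hθ hexp h1 h2 h3 h4' hq hl hcoer
  obtain ⟨lam, ψ, hmono, hspec, hk⟩ := hsys.exists_eigenvalues
    (generatorOp_isSymmetric hω hκ (box N))
  refine ⟨l, lam, hleast, hmono, ?_, hl, fun k => ?_⟩
  · ext r
    rw [← hspec, Set.mem_inter_iff, Set.mem_Iio, and_comm,
      mem_spectrum_iff_exists_conjOp (fun x : box N => mu ω x) fun x => mu_pos hω hκ x]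
  obtain ⟨e1, e2, e3, e4⟩ := hk k
  obtain ⟨b1, b2⟩ := approxEigenvalue_bounds hω hκ hκ1 hN hxm hL hh hδ hNδ k
  set Λ := approxEigenvalue ω N x m k with hΛ
  have hΛ0 : 0 < Λ := hsys.pos k
  -- With `ε = θ ^ 2`, one factor `θ` absorbs `q ^ 2` and the other is the stated error. The cruder
  -- bound by `1 / 2` below accounts for the constants in the two-sided estimate of `lam k`.
  have e5 : 20 * q ^ 2 * θ ^ 2 * Λ ≤ θ * Λ := by
    refine mul_le_mul_of_nonneg_right ?_ hΛ0.le
    nlinarith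
  have e6 : 20 * q ^ 2 * θ ^ 2 * Λ ≤ 1 / 2 * Λ := by
    refine mul_le_mul_of_nonneg_right ?_ hΛ0.le
    linarith
  obtain ⟨e7, e8⟩ := abs_le.1 e1
  refine ⟨e1.trans e5, ?_, ?_, (muEmb hω hκ (box N)).symm (ψ k), ?_, ?_, ?_⟩
  · have : κ / (8 * N ^ 2) * Real.exp (-d k) = 1 / 2 * (κ / (4 * N ^ 2) * Real.exp (-d k)) := by
      field_simp; norm_num
    linarith
  · linarith
  · rw [norm2_eq hω hκ, LinearEquiv.apply_symm_apply, e2]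
  · apply (muEmb hω hκ (box N)).injective
    rw [← conjOp_emb, LinearEquiv.apply_symm_apply, e3, map_smul, LinearEquiv.apply_symm_apply]
  · rw [norm2_eq hω hκ]
    have e9 : (fun n => (muEmb hω hκ (box N)).symm (ψ k) n
          - eqPotential ω N x k n / norm2 ω (box N) (eqPotential ω N x k))
        = (muEmb hω hκ (box N)).symm (ψ k)
          - (norm2 ω (box N) (eqPotential ω N x k))⁻¹ • eqPotential ω N x k := by
      funext n
      simp only [Pi.sub_apply, Pi.smul_apply, smul_eq_mul, div_eq_inv_mul]
    rw [e9, map_sub, map_smul, LinearEquiv.apply_symm_apply]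
    refine e4.trans ?_
    nlinarith

end

/-! ### Choice of the threshold for `N` and proof of the theorem. -/

lemma eventually_mul_pow_mul_exp_lt_one (K : ℝ) {δ : ℝ} (hδ : 0 < δ) :
    ∀ᶠ N : ℕ in Filter.atTop, K * N ^ 3 * Real.exp (-(δ / 10) * √N) < 1 := by
  -- With `t = (δ / 10) √N` one has `N ^ 3 = (10 / δ) ^ 6 t ^ 6`, and `t ^ 6 e^{-t}` tends to 0.
  have h1 : Filter.Tendsto (fun N : ℕ => δ / 10 * √(N : ℝ)) Filter.atTop Filter.atTop :=
    (Real.tendsto_sqrt_atTop.comp tendsto_natCast_atTop_atTop).const_mul_atTop (by positivity)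
  have h2 := ((Real.tendsto_pow_mul_exp_neg_atTop_nhds_zero 6).comp h1).const_mul
    (K * (10 / δ) ^ 6)
  rw [mul_zero] at h2
  filter_upwards [h2.eventually_lt_const zero_lt_one] with N hN
  have h3 : (√(N : ℝ)) ^ 6 = (N : ℝ) ^ 3 := by
    rw [show (6 : ℕ) = 2 * 3 by norm_num, pow_mul, Real.sq_sqrt (Nat.cast_nonneg N)]
  simp only [Function.comp_apply, mul_pow, h3] at hN
  refine lt_of_eq_of_lt ?_ hN
  rw [neg_mul]
  field_simp

end SinaiWalk
end

open SinaiWalk in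
theorem theorem1 (κ : ℝ) (hκ : 0 < κ) :
    ∃ c c' C : ℝ, 0 < c ∧ 0 < c' ∧ 0 < C ∧
    ∀ Q δ : ℝ, 0 < Q → 0 < δ → ∃ N₀ : ℕ,
    ∀ h : ℝ, 0 < h → ∀ N : ℕ, N₀ ≤ N → ∀ ω : Environment,
    (∀ y, κ ≤ (ω y : ℝ) ∧ (ω y : ℝ) ≤ 1 - κ) →
    IsGoodPath h δ (rescaledPotential ω N) →
    ∀ (q : ℕ) (x : Fin q → ℝ), IsLabeling h δ (rescaledPotential ω N) x → (q : ℝ) ≤ Q →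
    -- the integers `m k` are the positions of the h-minima on the unscaled lattice
    ∃ (lamStar : ℝ) (lam : Fin q → ℝ) (m : Fin q → ℤ),
      (∀ k, x k = m k / N) ∧
      -- the threshold and the `q` eigenvalues below it
      IsLeast (spectrum ℝ
        (generator ω (boxMinus N (hMinima h (rescaledPotential ω N))))) lamStar ∧
      StrictMono lam ∧
      spectrum ℝ (generator ω (box N)) ∩ Set.Iio lamStar = Set.range lam ∧
      c * (N : ℝ)⁻¹ ^ 2 * Real.exp (-(h * √N)) ≤ lamStar ∧
      ∀ k : Fin q,
        -- the probabilistic approximation of the eigenvalue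
        |lam k - mu ω (m k) * hitProb ω N (m k) (S x k) {x k}
              / norm2 ω (box N) (eqPotential ω N x k) ^ 2|
          ≤ C * Real.exp (-(δ / 10) * √N)
            * (mu ω (m k) * hitProb ω N (m k) (S x k) {x k}
              / norm2 ω (box N) (eqPotential ω N x k) ^ 2) ∧
        -- the bounds on the eigenvalue
        c * (N : ℝ)⁻¹ ^ 2
            * Real.exp (-(√N * barrier (rescaledPotential ω N) (x k) (S x k))) ≤ lam k ∧
        lam k ≤ c' * Real.exp (-(√N * barrier (rescaledPotential ω N) (x k) (S x k))) ∧
        -- the normalized eigenvector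
        ∃ ψ : box N → ℝ, norm2 ω (box N) ψ = 1 ∧
          (generator ω (box N)).mulVec ψ = lam k • ψ ∧
          norm2 ω (box N) (fun n => ψ n
              - eqPotential ω N x k n / norm2 ω (box N) (eqPotential ω N x k))
            ≤ Real.exp (-(δ / 10) * √N) := by
  -- The sum of the constants of the four smallness conditions; all are nonnegative, so a single
  -- limit settles every condition.
  set Kf : ℝ → ℝ := fun Q => 2 / κ + 8 / κ ^ 3 + (1 + 1 / κ) * (4 / κ) + 48 * Q ^ 2 with hKf
  refine ⟨κ / 8, 2 * (1 + 1 / κ), 1, by positivity, by positivity, one_pos, fun Q δ hQ hδ => ?_⟩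
  obtain ⟨N₁, hN₁⟩ := Filter.eventually_atTop.1 (eventually_mul_pow_mul_exp_lt_one (Kf Q) hδ)
  -- This ensures `q < N`, so that the box is not exhausted by the h-minima and the threshold
  -- exists.
  obtain ⟨N₂, hN₂⟩ := exists_nat_gt Q
  refine ⟨max N₁ (N₂ + 1), fun h hh N hN ω hω hgood q x hlab hqQ => ?_⟩
  have hN0 : 0 < N := by have := le_of_max_le_right hN; lia
  have hN' : (1 : ℝ) ≤ N := by exact_mod_cast hN0
  have hs : (0 : ℝ) < √N := Real.sqrt_pos.2 (by linarith)
  have hω' : Elliptic κ ω := hω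
  have hκ1 : κ ≤ 1 := (hω 0).1.trans (ω 0).2.2
  have hqN : q < N := by
    have h1 : (q : ℝ) < N₂ := hqQ.trans_lt hN₂
    have h2 : q < N₂ := by exact_mod_cast h1
    have := le_of_max_le_right hN
    lia
  have hK := hN₁ N (le_of_max_le_left hN)
  obtain ⟨m, hxm, hL⟩ := isLandscape_of_isGoodPath hN0 hh hgood hlab
  have hq : 0 < q := by
    obtain ⟨-, ⟨y, hy⟩, -⟩ := hgood
    rw [← hlab.2.1] at hy
    obtain ⟨k, -⟩ := hy
    exact k.pos
  set θ := Real.exp (-(δ / 10) * √N) with hθ_def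
  have hθ : 0 < θ := Real.exp_pos _
  have hθ1 : θ ≤ 1 := Real.exp_le_one_iff.2 (by nlinarith)
  -- The exponent `δ / 10` of the theorem is this tenth root.
  have hexp : Real.exp (-(δ * √N)) = θ ^ 10 := by
    rw [hθ_def, ← Real.exp_nat_mul]
    congr 1
    push_cast
    ring
  -- Since `N ≥ 1` and `θ ≤ 1`, the worst case is `N ^ 3 * θ`.
  have hpow : ∀ (a : ℝ) (i j : ℕ), 0 ≤ a → i ≤ 3 → j ≠ 0 → a ≤ Kf Q →
      a * (N : ℝ) ^ i * θ ^ j < 1 := by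
    intro a i j ha hi hj haK
    refine lt_of_le_of_lt ?_ hK
    have h1 : (N : ℝ) ^ i ≤ N ^ 3 := pow_le_pow_right₀ hN' hi
    have h2 : θ ^ j ≤ θ := pow_le_of_le_one hθ.le hθ1 hj
    gcongr
  have p1 : 0 ≤ 2 / κ := by positivity
  have p2 : 0 ≤ 8 / κ ^ 3 := by positivity
  have p3 : 0 ≤ (1 + 1 / κ) * (4 / κ) := by positivity
  have p4 : 0 ≤ 48 * Q ^ 2 := by positivity
  have h1 : 2 * N / κ * θ ^ 10 ≤ 1 := by
    have := hpow (2 / κ) 1 10 p1 (by norm_num) (by norm_num) (by simp only [hKf]; linarith)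
    refine le_trans (le_of_eq ?_) this.le
    ring
  have h2 : 8 * N ^ 3 / κ ^ 3 * θ ^ 6 ≤ 1 := by
    have := hpow (8 / κ ^ 3) 3 6 p2 (by norm_num) (by norm_num) (by simp only [hKf]; linarith)
    refine le_trans (le_of_eq ?_) this.le
    ring
  have h3 : (1 + 1 / κ) * θ ^ 8 ≤ κ / (4 * N ^ 2) := by
    have := hpow ((1 + 1 / κ) * (4 / κ)) 2 8 p3 (by norm_num) (by norm_num)
      (by simp only [hKf]; linarith)
    rw [le_div_iff₀ (by positivity)]
    have h4 : (1 + 1 / κ) * θ ^ 8 * (4 * N ^ 2)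
        = κ * ((1 + 1 / κ) * (4 / κ) * N ^ 2 * θ ^ 8) := by field_simp
    rw [h4]
    exact mul_le_of_le_one_right hκ.le this.le
  have h4 : 48 * q ^ 2 * θ < 1 := by
    have := hpow (48 * Q ^ 2) 0 1 p4 (by norm_num) (by norm_num) (by simp only [hKf]; linarith)
    rw [pow_zero, mul_one, pow_one] at this
    refine lt_of_le_of_lt ?_ this
    gcongr
  have hDbox : ∀ y, y ∈ boxMinus N (hMinima h (rescaledPotential ω N)) ↔
      y ∈ box N ∧ ∀ k, y ≠ m k := by
    intro y
    simp only [boxMinus, Finset.mem_filter, ← hlab.2.1]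
    refine and_congr_right fun _ => ?_
    rw [Set.mem_range, not_exists]
    refine forall_congr' fun k => not_congr ?_
    rw [hxm, div_left_inj' (by positivity : (N : ℝ) ≠ 0), Int.cast_inj, eq_comm]
  -- The box has `2 N - 1` sites, more than `q`.
  have hD : (boxMinus N (hMinima h (rescaledPotential ω N))).Nonempty := by
    by_contra hne
    have h5 : box N ⊆ Finset.univ.image m := by
      intro y hy
      by_contra hy'
      refine hne ⟨y, (hDbox y).2 ⟨hy, fun k hk => hy' ?_⟩⟩
      exact Finset.mem_image.2 ⟨k, Finset.mem_univ k, hk.symm⟩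
    have h6 := (Finset.card_le_card h5).trans Finset.card_image_le
    rw [Finset.card_univ, Fintype.card_fin, box, Int.card_Ioo] at h6
    lia
  obtain ⟨lamStar, lam, r1, r2, r3, r4, r5⟩ := hL.exists_eigenvalues hω' hκ hκ1 hN0 hxm
    (by positivity) (by positivity) hθ hexp h1 h2 h3 h4 hθ1 hq hD hDbox
  refine ⟨lamStar, lam, m, hxm, r1, r2, r3, le_trans ?_ r4, fun k => ?_⟩
  · refine mul_le_mul_of_nonneg_right ?_ (Real.exp_pos _).le
    rw [inv_pow, ← div_eq_mul_inv, div_div]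
    gcongr
    norm_num
  · obtain ⟨s1, s2, s3, s4⟩ := r5 k
    refine ⟨by rw [one_mul]; exact s1, ?_, s3, s4⟩
    refine le_trans (le_of_eq ?_) s2
    rw [inv_pow, ← div_eq_mul_inv, div_div]
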